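/- Let $d\in\mathbb N$ and let $B=(B_{jk})$ be a regular magnetic field on $\mathbb R^d$, i.e. a smooth closed real 2-form whose components are bounded together with all their derivatives. Let $A_k(x)=\sum_{j=1}^d\int_0^1 s\,x_jB_{jk}(sx)\,ds$ be its potential in the transversal gauge and $\varphi(x,y)=\int_{[y,x]}A$ the circulation of $A$ along the segment from $y$ to $x$. Write $\mathcal B(V,W)$ for the continuous linear maps from $V$ to $W$ with the topology of uniform convergence on bounded sets; $\mathscr S'$ carries the strong dual topology. A tempered weight on $\mathbb R^{4d}$ is a function $M:\mathbb R^{4d}\to(0,\infty)$ for which there are $a,C>0$ with $M(U+V)\le C\,M(U)\,(1+\|V\|^2)^{a/2}$ for all $U,V$, and $S_0(M)$ is the set of $\Phi\in C^\infty(\mathbb R^{4d};\mathbb C)$ such that $\sup_{X}M(X)^{-1}|\partial^\gamma\Phi(X)|<\infty$ for every multi-index $\gamma$. The magnetic super Weyl transform of $\Phi\in\mathscr S(\mathbb R^{4d})$ is $$(K^A\Phi)(x_L,x_R,y_L,y_R)=\frac1{(2\pi)^{2d}}\int d\xi_L\,d\xi_R\;e^{i[\xi_L\cdot(x_L-y_L)-\xi_R\cdot(x_R-y_R)]}\,e^{i[\varphi(x_L,y_L)-\varphi(x_R,y_R)]}\,\Phi\Big(\tfrac{x_L+y_L}2,\xi_L,\tfrac{x_R+y_R}2,\xi_R\Big),$$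 extended to tempered distributions by duality. For $\Phi\in S_0(M)$, $\mathrm{Op}^A(\Phi)$ is the super operator in $\mathcal B\big(\mathcal B(\mathscr S'(\mathbb R^d),\mathscr S(\mathbb R^d)),\mathcal B(\mathscr S(\mathbb R^d),\mathscr S'(\mathbb R^d))\big)$ determined by $$\langle(\mathrm{Op}^A(\Phi)T)f,g\rangle=\big\langle K^A\Phi,\;g(x_L)f(x_R)k_T(y_L,y_R)\big\rangle\qquad(f,g\in\mathscr S(\mathbb R^d)),$$ where $k_T(x,y)=(T\delta_y)(x)$ is the integral kernel of the smoothing operator $T$. A super operator $\mathfrak T$ has super symbol $\Psi$ if $\mathfrak T=\mathrm{Op}^A(\Psi)$. Let $Q_j$ and $P_j^A=-i\partial_j-A_j$ be the position and magnetic momentum operators on $\mathscr S(\mathbb R^d)$ and, by duality, on $\mathscr S'(\mathbb R^d)$, and put $(S\odot\mathrm{Id})T=ST$ and $(\mathrm{Id}\odot S)T=TS$. **Proposition.** For every tempered weight $M$ on $\mathbb R^{4d}$ and every $\Phi\in S_0(M)$, the super operator $\mathrm{Op}^A(\Phi)$ exists, and for all $n\ge0$ and all $\mathfrak S_1,\dots,\mathfrak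 S_n\in\{Q_j\odot\mathrm{Id},\ \mathrm{Id}\odot Q_j,\ P_j^A\odot\mathrm{Id},\ \mathrm{Id}\odot P_j^A : 1\le j\le d\}$ the iterated commutator $$[\mathfrak S_n,[\cdots[\mathfrak S_2,[\mathfrak S_1,\mathrm{Op}^A(\Phi)]]\cdots]]$$ has a super symbol in $S_0(M)$. -/

import Mathlib

open scoped SchwartzMap ContDiff LineDeriv
open MeasureTheory

set_option maxSynthPendingDepth 3

namespace MagneticSuper

noncomputable section

/-! ### Spaces -/

/-- Position (or momentum) space `ℝ^d` with the Euclidean norm. -/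
abbrev Pos (d : ℕ) := EuclideanSpace ℝ (Fin d)

/-- `ℝ^{4d}`, with points `((x_L, ξ_L), (x_R, ξ_R))`. -/
abbrev SuperPhase (d : ℕ) := (Pos d × Pos d) × (Pos d × Pos d)

/-- The Schwartz functions `𝓢(ℝ^d)`. -/
abbrev Schw (d : ℕ) := 𝓢(Pos d, ℂ)

/-- The tempered distributions on `ℝ^d` with the strong dual topology, that is, the topology of
uniform convergence on bounded sets. -/
abbrev Temp (d : ℕ) := Schw d →L[ℂ] ℂ

/-- The smoothing operators: continuous operators from tempered distributions to Schwartz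
functions, with the topology of uniform convergence on bounded sets. -/
abbrev Smoothing (d : ℕ) := Temp d →L[ℂ] Schw d

/-- The continuous operators from Schwartz functions to tempered distributions, with the topology
of uniform convergence on bounded sets. -/
abbrev Rough (d : ℕ) := Schw d →L[ℂ] Temp d

/-- Super operators: continuous linear maps which send smoothing operators to continuous operators
from Schwartz functions to tempered distributions. -/
abbrev SuperOp (d : ℕ) := Smoothing d →L[ℂ] Rough d

variable {d : ℕ}

/-! ### The magnetic field and its potential -/

/-- A regular magnetic field: a smooth closed 2-form on `ℝ^d` all of whose components are bounded
together with all their derivatives. `B x j k` is the component `B_{jk}(x)`. -/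
structure IsRegularMagneticField (B : Pos d → Fin d → Fin d → ℝ) : Prop where
  antisymm : ∀ x j k, B x j k = -B x k j
  smooth : ∀ j k, ContDiff ℝ ∞ (fun x => B x j k)
  bounded : ∀ j k (n : ℕ), ∃ C : ℝ, ∀ x, ‖iteratedFDeriv ℝ n (fun y => B y j k) x‖ ≤ C
  closed : ∀ x i j k,
    fderiv ℝ (fun y => B y j k) x (EuclideanSpace.single i 1)
      + fderiv ℝ (fun y => B y k i) x (EuclideanSpace.single j 1)
      + fderiv ℝ (fun y => B y i j) x (EuclideanSpace.single k 1) = 0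

/-- The magnetic potential in the transversal gauge,
`A_k(x) = ∑_j ∫_0^1 s x_j B_{jk}(s x) ds`. -/
def potential (B : Pos d → Fin d → Fin d → ℝ) (x : Pos d) (k : Fin d) : ℝ :=
  ∑ j, ∫ s in (0 : ℝ)..1, s * x j * B (s • x) j k

/-- The circulation `φ(x, y)` of the potential along the line segment from `y` to `x`. -/
def circulation (B : Pos d → Fin d → Fin d → ℝ) (x y : Pos d) : ℝ :=
  ∫ s in (0 : ℝ)..1, ∑ k, potential B (y + s • (x - y)) k * (x k - y k)

/-! ### Tempered weights and the Hörmander super classes -/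

/-- `⟨X⟩ = √(1 + ‖X‖²)` with the Euclidean norm of `ℝ^{4d}`. -/
def bracket (X : SuperPhase d) : ℝ :=
  Real.sqrt (1 + (‖X.1.1‖ ^ 2 + ‖X.1.2‖ ^ 2 + ‖X.2.1‖ ^ 2 + ‖X.2.2‖ ^ 2))

/-- Tempered weights on `ℝ^{4d}`. -/
structure IsTemperedWeight (M : SuperPhase d → ℝ) : Prop where
  pos : ∀ X, 0 < M X
  tempered : ∃ a C : ℝ, 0 < a ∧ 0 < C ∧ ∀ U V, M (U + V) ≤ C * M U * bracket V ^ a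

/-- The Hörmander super class `S_0(M)`: smooth functions on `ℝ^{4d}` all of whose derivatives are
bounded by a multiple of `M`. (All partial derivatives of order `n` are controlled if and only if
the `n`-th Fréchet derivative is; the choice of the norm on `ℝ^{4d}` only affects constants.) -/
def superClass (M : SuperPhase d → ℝ) : Set (SuperPhase d → ℂ) :=
  {Φ | ContDiff ℝ ∞ Φ ∧ ∀ n : ℕ, ∃ C : ℝ, ∀ X, ‖iteratedFDeriv ℝ n Φ X‖ ≤ C * M X}

/-! ### Magnetic super Weyl quantization -/

/-- The Dirac distribution at `y`, as an element of the strong dual. -/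
def dirac (y : Pos d) : Temp d :=
  (BoundedContinuousFunction.evalCLM ℂ y).comp
    (SchwartzMap.toBoundedContinuousFunctionCLM ℂ (Pos d) ℂ)

@[simp] lemma dirac_apply (y : Pos d) (f : Schw d) : dirac y f = f y := rfl

/-- The integral kernel `k(x, y) = (T δ_y)(x)` of a smoothing operator `T`, which is the function
with `(T u)(x) = ⟨u, k(x, ·)⟩` for every tempered distribution `u`. -/
def smoothingKernel (T : Smoothing d) (x y : Pos d) : ℂ := T (dirac y) x

/-- The transpose of the magnetic super Weyl transform `K^A`, applied to a Schwartz function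
`Ψ(x_L, x_R, y_L, y_R)`. The transform itself sends a Schwartz function `Φ` to
`(K^A Φ)(x_L, x_R, y_L, y_R) = (2π)^{-2d} ∫∫ exp(i[ξ_L·(x_L - y_L) - ξ_R·(x_R - y_R)])
  exp(i[φ(x_L, y_L) - φ(x_R, y_R)]) Φ((x_L + y_L)/2, ξ_L, (x_R + y_R)/2, ξ_R) dξ_L dξ_R`.
Integrating this against `Ψ` and substituting `x_L = q_L + v_L/2`, `y_L = q_L - v_L/2`,
`x_R = q_R + v_R/2`, `y_R = q_R - v_R/2` (Jacobian one) gives the integral of `Φ` against the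
function below. -/
def superWeylTranspose (B : Pos d → Fin d → Fin d → ℝ)
    (Ψ : Pos d → Pos d → Pos d → Pos d → ℂ) (X : SuperPhase d) : ℂ :=
  ((2 * Real.pi : ℂ) ^ (2 * d))⁻¹ *
    ∫ v : Pos d × Pos d,
      Complex.exp (Complex.I * ((inner ℝ X.1.2 v.1 - inner ℝ X.2.2 v.2 : ℝ) : ℂ)) *
      Complex.exp (Complex.I *
        ((circulation B (X.1.1 + (2⁻¹ : ℝ) • v.1) (X.1.1 - (2⁻¹ : ℝ) • v.1)
          - circulation B (X.2.1 + (2⁻¹ : ℝ) • v.2) (X.2.1 - (2⁻¹ : ℝ) • v.2) : ℝ) : ℂ)) *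
      Ψ (X.1.1 + (2⁻¹ : ℝ) • v.1) (X.2.1 + (2⁻¹ : ℝ) • v.2)
        (X.1.1 - (2⁻¹ : ℝ) • v.1) (X.2.1 - (2⁻¹ : ℝ) • v.2)

/-- The pairing `⟨K^A Φ, Ψ⟩` of the tempered distribution `K^A Φ` with a Schwartz function `Ψ`,
where `K^A` has been extended from Schwartz functions by duality and `Φ` is a smooth function in
some class `S_0(M)`. -/
def superWeylPairing (B : Pos d → Fin d → Fin d → ℝ) (Φ : SuperPhase d → ℂ)
    (Ψ : Pos d → Pos d → Pos d → Pos d → ℂ) : ℂ :=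
  ∫ X : SuperPhase d, Φ X * superWeylTranspose B Ψ X

/-- `IsSuperQuantization B Φ 𝔗` says that `𝔗 = Op^A(Φ)`, i.e. that `Φ` is the super symbol of `𝔗`:
for every smoothing operator `T` with kernel `k_T`, the distribution kernel of `𝔗 T` is the
distribution obtained by applying `K^A Φ` to `k_T` in the variables `(y_L, y_R)`. Here the operator
`R` with distribution kernel `κ` is the one with `⟨R f, g⟩ = ⟨κ, g ⊗ f⟩`. -/
def IsSuperQuantization (B : Pos d → Fin d → Fin d → ℝ) (Φ : SuperPhase d → ℂ)
    (𝔗 : SuperOp d) : Prop :=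
  ∀ (T : Smoothing d) (f g : Schw d),
    𝔗 T f g =
      superWeylPairing B Φ (fun xL xR yL yR => g xL * f xR * smoothingKernel T yL yR)

/-- A function is the super symbol of at most one super operator. -/
lemma IsSuperQuantization.unique {B : Pos d → Fin d → Fin d → ℝ} {Φ : SuperPhase d → ℂ}
    {𝔗 𝔗' : SuperOp d} (h : IsSuperQuantization B Φ 𝔗) (h' : IsSuperQuantization B Φ 𝔗') :
    𝔗 = 𝔗' :=
  ContinuousLinearMap.ext fun T => ContinuousLinearMap.ext fun f =>
    ContinuousLinearMap.ext fun g => (h T f g).trans (h' T f g).symm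

/-! ### Position and magnetic momentum operators, and commutators -/

/-- The basic observables: the position operators `Q_j` and the magnetic momentum operators
`P_j^A`. -/
inductive Observable (d : ℕ) : Type
  | position (j : Fin d)
  | momentum (j : Fin d)

/-- Multiplication of Schwartz functions by the coordinate `y_j`. -/
def coordMul (j : Fin d) : Schw d →L[ℂ] Schw d :=
  SchwartzMap.smulLeftCLM ℂ (fun y : Pos d => ((y j : ℝ) : ℂ))

/-- Multiplication of Schwartz functions by the component `A_j` of the potential (a smooth function
which is polynomially bounded together with its derivatives when the field is regular). -/
def potentialMul (B : Pos d → Fin d → Fin d → ℝ) (j : Fin d) : Schw d →L[ℂ] Schw d :=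
  SchwartzMap.smulLeftCLM ℂ (fun y : Pos d => ((potential B y j : ℝ) : ℂ))

/-- The partial derivative `∂_j` on Schwartz functions. -/
def partialDeriv (j : Fin d) : Schw d →L[ℂ] Schw d :=
  LineDeriv.lineDerivOpCLM ℂ (Schw d) (EuclideanSpace.single j (1 : ℝ))

/-- `(Q_j f)(y) = y_j f(y)` and `(P_j^A f)(y) = (-i∂_j - A_j(y)) f(y)` on Schwartz functions. -/
def Observable.onSchwartz (B : Pos d → Fin d → Fin d → ℝ) : Observable d → (Schw d →L[ℂ] Schw d)
  | .position j => coordMul j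
  | .momentum j => (-Complex.I) • partialDeriv j - potentialMul B j

/-- The transposes with respect to the bilinear pairing `∫ f g`: `Q_j` is its own transpose, and
that of `P_j^A` is `i∂_j - A_j`. -/
def Observable.transpose (B : Pos d → Fin d → Fin d → ℝ) : Observable d → (Schw d →L[ℂ] Schw d)
  | .position j => coordMul j
  | .momentum j => Complex.I • partialDeriv j - potentialMul B j

/-- The extension of `Q_j` and `P_j^A` to tempered distributions by duality. -/
def Observable.onTempered (B : Pos d → Fin d → Fin d → ℝ) (S : Observable d) :
    Temp d →L[ℂ] Temp d :=
  ContinuousLinearMap.precomp ℂ (S.transpose B)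

/-- The super operators `S ⊙ Id : T ↦ S T` and `Id ⊙ S : T ↦ T S`, for `S` one of the
observables. -/
inductive Generator (d : ℕ) : Type
  | left (S : Observable d)
  | right (S : Observable d)

/-- The action of `S ⊙ Id` and `Id ⊙ S` on smoothing operators. -/
def Generator.onSmoothing (B : Pos d → Fin d → Fin d → ℝ) :
    Generator d → (Smoothing d →L[ℂ] Smoothing d)
  | .left S => ContinuousLinearMap.postcomp (Temp d) (S.onSchwartz B)
  | .right S => ContinuousLinearMap.precomp (Schw d) (S.onTempered B)

/-- The action of `S ⊙ Id` and `Id ⊙ S` on operators from Schwartz functions to tempered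
distributions. -/
def Generator.onRough (B : Pos d → Fin d → Fin d → ℝ) :
    Generator d → (Rough d →L[ℂ] Rough d)
  | .left S => ContinuousLinearMap.postcomp (Schw d) (S.onTempered B)
  | .right S => ContinuousLinearMap.precomp (Temp d) (S.onSchwartz B)

/-- The commutator `[𝔖, 𝔗] = 𝔖 𝔗 - 𝔗 𝔖` of a generator with a super operator. -/
def commutator (B : Pos d → Fin d → Fin d → ℝ) (𝔖 : Generator d) (𝔗 : SuperOp d) : SuperOp d :=
  (𝔖.onRough B).comp 𝔗 - 𝔗.comp (𝔖.onSmoothing B)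

/-- The iterated commutator `[𝔖_n, [⋯ [𝔖_2, [𝔖_1, 𝔗]] ⋯ ]]` for the list `[𝔖_1, …, 𝔖_n]`; it is
`𝔗` itself for the empty list. -/
def iteratedCommutator (B : Pos d → Fin d → Fin d → ℝ) (l : List (Generator d)) (𝔗 : SuperOp d) :
    SuperOp d :=
  l.foldl (fun 𝔗' 𝔖 => commutator B 𝔖 𝔗') 𝔗

end

end MagneticSuper

open MagneticSuper

/-!
In midpoint coordinates `x = q + v/2`, `y = q - v/2` on the left and on the right, `Op^A(Φ)` is
the trilinear form `(T, f, g) ↦ (2π)^{-2d} ∫ Φ(q, ξ) F̂(q, ξ)`, where `F̂` is the Fourier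
transform in `v` (`fibreFourier`) of the Schwartz function `F = exp(i(φ(x_L, y_L) - φ(x_R, y_R)))
g(x_L) f(x_R) k_T(y_L, y_R)` (`testFunction`).

*Existence.* The pairing with a symbol of polynomial growth is a tempered distribution on
`ℝ^{4d}` (`PolyBounded.pairingCLM`), the magnetic phase and all its derivatives have polynomial
growth, and `T ↦ k_T` is continuous from the smoothing operators to the Schwartz functions on
`ℝ^{2d}` (`kernelCLM`). Currying the resulting distribution twice (`curryTensor`) gives a
continuous super operator.

*Commutators.* Passing from `Op^A(Φ)` to its commutator with a generator amounts to applying an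
operator `D` to `F` (`commutatorOp_testFunction`): multiplication by `v_{L,j}` or `v_{R,j}` for
the position operators, and `± i ∂_{q_j} + ∑_k v_k b_{jk}(q, v)` for the momentum operators,
where `b_{jk}(q, v) = ∫_0^1 B_{jk}(q + (s - 1/2) v) ds`. The potential itself drops out. Indeed,
`∂_{q_j} φ(q + v/2, q - v/2) = A_j(q + v/2) - A_j(q - v/2) + ∑_k v_k b_{jk}(q, v)`
(`fderiv_midCirculation`), because `dA = B` (`fderiv_potential_sub`).

*Symbols.* It remains to move `D` to the symbol without leaving `S_0(M)` (`ActsOnSymbols`). By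
integration by parts `∂_{q_j}` becomes `-∂_{q_j}`, and multiplication by a component of `v`
becomes a multiple of `∂_{ξ_j}`. The functions `b_{jk}` are bounded with all their derivatives,
but they depend on `v`, so multiplication by them is nonlocal in `ξ`; this is
`exists_symbol_of_bounded_mul`. There one writes `b F = c · ⟨v⟩^{2(d+1)} F` with `c = b
⟨v⟩^{-2(d+1)}`. The polynomial acts on the symbol as a power of `1 - Δ_ξ`. The function `c` and
its derivatives are integrable in `v`, so that its Fourier transform in `v` is rapidly
decreasing, and it acts on the symbol by convolution with this transform, which is harmless since
`M` is tempered. The theorem follows by induction on the number of commutators.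
-/

namespace MagneticSuper

open Filter Topology

noncomputable section

variable {d : ℕ}

/-! ### Symbol classes and their calculus -/

section Symbols

universe u

variable {E E' F F' G : Type*} [NormedAddCommGroup E] [NormedSpace ℝ E]
  [NormedAddCommGroup E'] [NormedSpace ℝ E'] [NormedAddCommGroup F] [NormedSpace ℝ F]
  [NormedAddCommGroup F'] [NormedSpace ℝ F'] [NormedAddCommGroup G] [NormedSpace ℝ G]

/-- `f` is smooth and each of its derivatives is bounded by a multiple of the weight `m`. For
complex functions on `ℝ^{4d}` this is membership in `superClass m`. -/
structure IsSymbol (m : E → ℝ) (f : E → F) : Prop where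
  contDiff : ContDiff ℝ ∞ f
  bound : ∀ n : ℕ, ∃ C : ℝ, ∀ x, ‖iteratedFDeriv ℝ n f x‖ ≤ C * m x

namespace IsSymbol

variable {m m' : E → ℝ} {f g : E → F}

lemma bound_pos (hm : ∀ x, 0 ≤ m x) (hf : IsSymbol m f) (n : ℕ) :
    ∃ C : ℝ, 0 ≤ C ∧ ∀ x, ‖iteratedFDeriv ℝ n f x‖ ≤ C * m x := by
  obtain ⟨C, hC⟩ := hf.bound n
  exact ⟨|C|, abs_nonneg _, fun x => (hC x).trans
    (mul_le_mul_of_nonneg_right (le_abs_self C) (hm x))⟩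

lemma norm_le (hm : ∀ x, 0 ≤ m x) (hf : IsSymbol m f) :
    ∃ C : ℝ, 0 ≤ C ∧ ∀ x, ‖f x‖ ≤ C * m x := by
  obtain ⟨C, h0, hC⟩ := hf.bound_pos hm 0
  exact ⟨C, h0, fun x => by simpa using hC x⟩

lemma differentiable (hf : IsSymbol m f) : Differentiable ℝ f :=
  hf.contDiff.differentiable (by simp)

lemma mono (hm : ∀ x, 0 ≤ m x) (hf : IsSymbol m f) {K : ℝ} (h : ∀ x, m x ≤ K * m' x) :
    IsSymbol m' f := by
  refine ⟨hf.contDiff, fun n => ?_⟩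
  obtain ⟨C, h0, hC⟩ := hf.bound_pos hm n
  refine ⟨C * K, fun x => (hC x).trans ?_⟩
  rw [mul_assoc]
  exact mul_le_mul_of_nonneg_left (h x) h0

lemma add (hf : IsSymbol m f) (hg : IsSymbol m g) : IsSymbol m (fun x => f x + g x) := by
  refine ⟨hf.contDiff.add hg.contDiff, fun n => ?_⟩
  obtain ⟨C, hC⟩ := hf.bound n
  obtain ⟨D, hD⟩ := hg.bound n
  refine ⟨C + D, fun x => ?_⟩
  have hn : ((n : ℕ) : WithTop ℕ∞) ≤ ∞ := by exact_mod_cast le_top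
  have : iteratedFDeriv ℝ n (fun x => f x + g x) x
      = iteratedFDeriv ℝ n f x + iteratedFDeriv ℝ n g x :=
    iteratedFDeriv_add_apply (hf.contDiff.of_le hn).contDiffAt (hg.contDiff.of_le hn).contDiffAt
  rw [this, add_mul]
  exact (norm_add_le _ _).trans (add_le_add (hC x) (hD x))

lemma clm_comp (L : F →L[ℝ] F') (hf : IsSymbol m f) : IsSymbol m (fun x => L (f x)) := by
  refine ⟨L.contDiff.comp hf.contDiff, fun n => ?_⟩
  obtain ⟨C, hC⟩ := hf.bound n
  refine ⟨‖L‖ * C, fun x => ?_⟩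
  rw [mul_assoc]
  refine (L.norm_iteratedFDeriv_comp_left (N := ∞) hf.contDiff.contDiffAt
    (by exact_mod_cast le_top)).trans ?_
  exact mul_le_mul_of_nonneg_left (hC x) (norm_nonneg _)

lemma neg (hf : IsSymbol m f) : IsSymbol m (fun x => - f x) :=
  hf.clm_comp (-ContinuousLinearMap.id ℝ F)

lemma sub (hf : IsSymbol m f) (hg : IsSymbol m g) : IsSymbol m (fun x => f x - g x) := by
  simpa [sub_eq_add_neg] using hf.add hg.neg

lemma zero : IsSymbol m (fun _ : E => (0 : F)) := by
  refine ⟨contDiff_const, fun n => ⟨0, fun x => ?_⟩⟩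
  have : iteratedFDeriv ℝ n (fun _ : E => (0 : F)) = 0 := iteratedFDeriv_fun_zero
  simp [this]

lemma const (c : F) : IsSymbol (fun _ : E => 1) (fun _ : E => c) := by
  refine ⟨contDiff_const, fun n => ?_⟩
  rcases n with _ | n
  · exact ⟨‖c‖, fun x => by simp⟩
  · refine ⟨0, fun x => ?_⟩
    rw [iteratedFDeriv_const_of_ne (by simp)]
    simp

lemma sum {ι : Type*} (s : Finset ι) {f : ι → E → F}
    (hf : ∀ i ∈ s, IsSymbol m (f i)) : IsSymbol m (fun x => ∑ i ∈ s, f i x) := by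
  classical
  induction s using Finset.induction_on with
  | empty => simpa using zero
  | insert a s ha ih =>
    simp only [Finset.sum_insert ha]
    exact (hf a (by simp)).add (ih fun i hi => hf i (by simp [hi]))

lemma bilin (B : F →L[ℝ] F' →L[ℝ] G) (hm : ∀ x, 0 ≤ m x) (hm' : ∀ x, 0 ≤ m' x)
    {f : E → F} {g : E → F'} (hf : IsSymbol m f) (hg : IsSymbol m' g) :
    IsSymbol (fun x => m x * m' x) (fun x => B (f x) (g x)) := by
  refine ⟨(B.contDiff.comp hf.contDiff).clm_apply hg.contDiff, fun n => ?_⟩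
  choose C hC0 hC using hf.bound_pos hm
  choose D hD0 hD using hg.bound_pos hm'
  refine ⟨‖B‖ * ∑ i ∈ Finset.range (n + 1), (n.choose i : ℝ) * C i * D (n - i), fun x => ?_⟩
  refine (B.norm_iteratedFDeriv_le_of_bilinear hf.contDiff hg.contDiff x
    (n := n) (by exact_mod_cast le_top)).trans ?_
  rw [mul_assoc, Finset.sum_mul]
  refine mul_le_mul_of_nonneg_left (Finset.sum_le_sum fun i _ => ?_) (norm_nonneg _)
  calc (n.choose i : ℝ) * ‖iteratedFDeriv ℝ i f x‖ * ‖iteratedFDeriv ℝ (n - i) g x‖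
      ≤ (n.choose i : ℝ) * (C i * m x) * (D (n - i) * m' x) := by
        have := hC0 i
        have := hm x
        gcongr
        · exact hC i x
        · exact hD _ x
    _ = _ := by ring

lemma mul {𝕜 : Type*} [NormedCommRing 𝕜] [NormedAlgebra ℝ 𝕜]
    (hm : ∀ x, 0 ≤ m x) (hm' : ∀ x, 0 ≤ m' x)
    {f g : E → 𝕜} (hf : IsSymbol m f) (hg : IsSymbol m' g) :
    IsSymbol (fun x => m x * m' x) (fun x => f x * g x) :=
  bilin (ContinuousLinearMap.mul ℝ 𝕜) hm hm' hf hg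

lemma fderiv (hf : IsSymbol m f) : IsSymbol m (fderiv ℝ f) := by
  refine ⟨hf.contDiff.fderiv_right (by simp), fun n => ?_⟩
  obtain ⟨C, hC⟩ := hf.bound (n + 1)
  exact ⟨C, fun x => by rw [norm_iteratedFDeriv_fderiv]; exact hC x⟩

lemma fderiv_apply (hf : IsSymbol m f) (e : E) : IsSymbol m (fun x => _root_.fderiv ℝ f x e) :=
  hf.fderiv.clm_comp (ContinuousLinearMap.apply ℝ F e)

lemma of_fderiv (hf : Differentiable ℝ f) {C : ℝ} (h : ∀ x, ‖f x‖ ≤ C * m x)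
    (h' : IsSymbol m (_root_.fderiv ℝ f)) : IsSymbol m f := by
  refine ⟨?_, fun n => ?_⟩
  · exact contDiff_infty_iff_fderiv.2 ⟨hf, h'.contDiff⟩
  · rcases n with _ | n
    · exact ⟨C, fun x => by simpa using h x⟩
    · obtain ⟨C, hC⟩ := h'.bound n
      exact ⟨C, fun x => by rw [← norm_iteratedFDeriv_fderiv]; exact hC x⟩

lemma comp_clm (L : E' →L[ℝ] E) (hf : IsSymbol m f) : IsSymbol (fun x => m (L x))
    (fun x => f (L x)) := by
  refine ⟨hf.contDiff.comp L.contDiff, fun n => ?_⟩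
  obtain ⟨C, hC⟩ := hf.bound n
  refine ⟨C * ‖L‖ ^ n, fun x => ?_⟩
  have h := L.iteratedFDeriv_comp_right hf.contDiff x (i := n) (by exact_mod_cast le_top)
  have h2 : iteratedFDeriv ℝ n (fun x => f (L x)) x
    = (iteratedFDeriv ℝ n f (L x)).compContinuousLinearMap fun _ => L := h
  rw [h2]
  refine (ContinuousMultilinearMap.norm_compContinuousLinearMap_le _ _).trans ?_
  simp only [Finset.prod_const, Finset.card_fin]
  calc _ ≤ C * m (L x) * ‖L‖ ^ n := mul_le_mul_of_nonneg_right (hC _) (by positivity)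
    _ = _ := by ring

lemma hasTemperateGrowth {k : ℕ} (hf : IsSymbol (fun x => (1 + ‖x‖) ^ k) f) :
    Function.HasTemperateGrowth f :=
  ⟨hf.contDiff, fun n => let ⟨C, hC⟩ := hf.bound n; ⟨k, C, hC⟩⟩

lemma of_clm (L : E →L[ℝ] F) : IsSymbol (fun x => 1 + ‖x‖) L := by
  refine of_fderiv L.differentiable (C := ‖L‖) (fun x => ?_) ?_
  · exact (L.le_opNorm x).trans (mul_le_mul_of_nonneg_left (by simp) (norm_nonneg _))
  · have : _root_.fderiv ℝ L = fun _ => L := by ext1 x; exact L.fderiv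
    rw [this]
    exact (const L).mono (K := 1) (by simp) (by simp)

end IsSymbol

/-- The reciprocal of a function `J` whose derivatives are bounded by multiples of `J` has
derivatives bounded by multiples of `J⁻¹`, because `D(J⁻¹) = -J⁻¹ • J⁻¹ • DJ`. -/
lemma IsSymbol.inv {J : E → ℝ} (hpos : ∀ x, 0 < J x) (hJ : IsSymbol J J) :
    IsSymbol (fun x => (J x)⁻¹) (fun x => (J x)⁻¹) := by
  have hsm : ContDiff ℝ ∞ (fun x => (J x)⁻¹) := hJ.contDiff.inv fun x => (hpos x).ne'
  refine ⟨hsm, fun n => ?_⟩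
  induction n using Nat.strong_induction_on with
  | _ n ih =>
  rcases n with _ | n
  · refine ⟨1, fun x => ?_⟩
    have := hpos x
    simp [abs_of_pos this]
  have hder : _root_.fderiv ℝ (fun x => (J x)⁻¹)
      = fun x => (-((J x)⁻¹ * (J x)⁻¹)) • _root_.fderiv ℝ J x := by
    ext1 x
    have h := (hasDerivAt_inv (hpos x).ne').comp_hasFDerivAt x
      (hJ.differentiable x).hasFDerivAt
    have h2 : HasFDerivAt (fun x => (J x)⁻¹) (-(J x ^ 2)⁻¹ • _root_.fderiv ℝ J x) x := h
    rw [h2.fderiv]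
    congr 2
    rw [pow_two, mul_inv]
  choose! C hC using ih
  obtain ⟨D, hD⟩ : ∃ D : ℕ → ℝ, ∀ i x, ‖iteratedFDeriv ℝ i (_root_.fderiv ℝ J) x‖ ≤ D i * J x := by
    choose D hD using hJ.fderiv.bound
    exact ⟨D, hD⟩
  have hC' : ∀ i ≤ n, ∀ x, ‖iteratedFDeriv ℝ i (fun x => (J x)⁻¹) x‖ ≤ |C i| * (J x)⁻¹ :=
    fun i hi x => (hC i (by omega) x).trans
      (mul_le_mul_of_nonneg_right (le_abs_self _) (inv_nonneg.2 (hpos x).le))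
  have hsq : ∀ i ≤ n, ∃ K : ℝ, 0 ≤ K ∧
      ∀ x, ‖iteratedFDeriv ℝ i (fun x => -((J x)⁻¹ * (J x)⁻¹)) x‖ ≤ K * ((J x)⁻¹ * (J x)⁻¹) := by
    intro i hi
    refine ⟨∑ k ∈ Finset.range (i + 1), (i.choose k : ℝ) * |C k| * |C (i - k)|,
      by positivity, fun x => ?_⟩
    have h1 : iteratedFDeriv ℝ i (fun x => -((J x)⁻¹ * (J x)⁻¹)) x
        = - iteratedFDeriv ℝ i (fun x => (J x)⁻¹ * (J x)⁻¹) x := iteratedFDeriv_neg_apply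
    rw [h1, norm_neg, Finset.sum_mul]
    refine (norm_iteratedFDeriv_mul_le hsm hsm x (n := i) (by exact_mod_cast le_top)).trans
      (Finset.sum_le_sum fun k hk => ?_)
    have hk' : k ≤ i := by simpa [Nat.lt_succ_iff] using hk
    calc _ ≤ (i.choose k : ℝ) * (|C k| * (J x)⁻¹) * (|C (i - k)| * (J x)⁻¹) := by
          have := hpos x
          gcongr
          · exact hC' k (by omega) x
          · exact hC' (i - k) (by omega) x
      _ = _ := by ring
  choose! K hK0 hK using hsq
  refine ⟨∑ k ∈ Finset.range (n + 1), (n.choose k : ℝ) * K k * |D (n - k)|, fun x => ?_⟩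
  rw [← norm_iteratedFDeriv_fderiv, hder]
  refine (norm_iteratedFDeriv_smul_le (𝕜 := ℝ) (N := ∞) (hsm.mul hsm).neg
    (hJ.fderiv.contDiff) x (n := n) (by exact_mod_cast le_top)).trans ?_
  rw [Finset.sum_mul]
  refine Finset.sum_le_sum fun k hk => ?_
  have hk' : k ≤ n := by simpa [Nat.lt_succ_iff] using hk
  have hJx := hpos x
  calc _ ≤ (n.choose k : ℝ) * (K k * ((J x)⁻¹ * (J x)⁻¹)) * (|D (n - k)| * J x) := by
        have := hK0 k hk'
        gcongr
        · exact hK k hk' x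
        · exact (hD _ x).trans (mul_le_mul_of_nonneg_right (le_abs_self _) hJx.le)
    _ = (n.choose k : ℝ) * K k * |D (n - k)| * ((J x)⁻¹ * ((J x)⁻¹ * J x)) := by ring
    _ = _ := by rw [inv_mul_cancel₀ hJx.ne', mul_one]

lemma IsSymbol.pow {J u : E → ℝ} (hpos : ∀ x, 0 ≤ J x) (hJ : IsSymbol J u) (N : ℕ) :
    IsSymbol (fun x => J x ^ N) (fun x => u x ^ N) := by
  induction N with
  | zero => simpa using IsSymbol.const (1 : ℝ)
  | succ N ih =>
    simpa only [pow_succ] using IsSymbol.mul (fun x => pow_nonneg (hpos x) N) hpos ih hJ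

end Symbols

/-! ### Integrals depending on a parameter -/

section Parametric

universe u

variable {S : Type*} [MeasurableSpace S] {μ : Measure S}
  {E F : Type u} [NormedAddCommGroup E] [NormedSpace ℝ E]
  [NormedAddCommGroup F] [NormedSpace ℝ F]

/-- A measurable family of smooth functions whose derivatives of order `n` are bounded by
`β s * m z` with `β` integrable in the parameter `s`. -/
structure IsIntegrableFamily (μ : Measure S) (m : E → ℝ) (G : S → E → F) : Prop where
  meas : ∀ z, AEStronglyMeasurable (fun s => G s z) μ
  contDiff : ∀ᵐ s ∂μ, ContDiff ℝ ∞ (G s)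
  bound : ∀ n : ℕ, ∃ β : S → ℝ, Integrable β μ ∧
    ∀ᵐ s ∂μ, ∀ z, ‖iteratedFDeriv ℝ n (G s) z‖ ≤ β s * m z

variable {m : E → ℝ} {G : S → E → F}

lemma IsIntegrableFamily.integrable (hG : IsIntegrableFamily μ m G) (z : E) :
    Integrable (fun s => G s z) μ := by
  obtain ⟨β, hβ, h⟩ := hG.bound 0
  refine (hβ.mul_const (m z)).mono' (hG.meas z) ?_
  filter_upwards [h] with s hs
  simpa using hs z

variable [FiniteDimensional ℝ E]

lemma IsIntegrableFamily.fderiv (hG : IsIntegrableFamily μ m G) :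
    IsIntegrableFamily μ m (fun s => fderiv ℝ (G s)) := by
  refine ⟨fun z => ?_, ?_, fun n => ?_⟩
  · have happ : ∀ e : E, AEStronglyMeasurable (fun s => _root_.fderiv ℝ (G s) z e) μ := by
      intro e
      refine aestronglyMeasurable_of_tendsto_ae (u := atTop)
        (f := fun (n : ℕ) s => (n : ℝ) • (G s (z + (n : ℝ)⁻¹ • e) - G s z))
        (fun n => ((hG.meas _).sub (hG.meas _)).const_smul _) ?_
      filter_upwards [hG.contDiff] with s hs
      refine HasFDerivAt.lim ((hs.differentiable (by simp)) z).hasFDerivAt e ?_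
      simpa using tendsto_natCast_atTop_atTop (R := ℝ)
    have hsum : (fun s => _root_.fderiv ℝ (G s) z) = fun s =>
        ∑ i, ContinuousLinearMap.smulRightL ℝ E F
          ((Module.finBasis ℝ E).coord i).toContinuousLinearMap
          (_root_.fderiv ℝ (G s) z (Module.finBasis ℝ E i)) := by
      ext s e
      conv_lhs => rw [← (Module.finBasis ℝ E).sum_repr e]
      simp only [map_sum, map_smul, sum_apply]
      rfl
    rw [hsum]
    exact Finset.aestronglyMeasurable_fun_sum _ fun i _ =>
      (ContinuousLinearMap.continuous _).comp_aestronglyMeasurable (happ _)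
  · filter_upwards [hG.contDiff] with s hs
    exact hs.fderiv_right (by simp)
  · obtain ⟨β, hβ, h⟩ := hG.bound (n + 1)
    refine ⟨β, hβ, ?_⟩
    filter_upwards [h] with s hs z
    rw [norm_iteratedFDeriv_fderiv]
    exact hs z

lemma IsIntegrableFamily.hasFDerivAt (hm : ∀ z, 0 ≤ m z)
    (hloc : ∀ z, ∃ C, ∀ᶠ z' in 𝓝 z, m z' ≤ C) (hG : IsIntegrableFamily μ m G) (z : E) :
    HasFDerivAt (fun z => ∫ s, G s z ∂μ) (∫ s, _root_.fderiv ℝ (G s) z ∂μ) z := by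
  obtain ⟨C, hC⟩ := hloc z
  obtain ⟨β, hβ, h⟩ := hG.bound 1
  refine hasFDerivAt_integral_of_dominated_of_fderiv_le
    (F' := fun z s => _root_.fderiv ℝ (G s) z) (bound := fun s => |β s| * C) hC
    (Eventually.of_forall hG.meas) (hG.integrable z) (hG.fderiv.meas z) ?_
    (hβ.abs.mul_const C) ?_
  · filter_upwards [h] with s hs z' hz'
    rw [← norm_iteratedFDeriv_one]
    refine (hs z').trans ?_
    calc β s * m z' ≤ |β s| * m z' := mul_le_mul_of_nonneg_right (le_abs_self _) (hm _)
      _ ≤ _ := mul_le_mul_of_nonneg_left hz' (abs_nonneg _)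
  · filter_upwards [hG.contDiff] with s hs z' _
    exact ((hs.differentiable (by simp)) z').hasFDerivAt

lemma IsIntegrableFamily.contDiff_integral_and_norm_le (hm : ∀ z, 0 ≤ m z)
    (hloc : ∀ z, ∃ C, ∀ᶠ z' in 𝓝 z, m z' ≤ C) (n : ℕ) (hG : IsIntegrableFamily μ m G) :
    ContDiff ℝ n (fun z => ∫ s, G s z ∂μ) ∧ ∀ β : S → ℝ, Integrable β μ →
      (∀ᵐ s ∂μ, ∀ z, ‖iteratedFDeriv ℝ n (G s) z‖ ≤ β s * m z) →
      ∀ z, ‖iteratedFDeriv ℝ n (fun z => ∫ s, G s z ∂μ) z‖ ≤ (∫ s, β s ∂μ) * m z := by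
  induction n generalizing F with
  | zero =>
    refine ⟨?_, fun β hβ h z => ?_⟩
    · rw [Nat.cast_zero, contDiff_zero]
      exact continuous_iff_continuousAt.2 fun z => (hG.hasFDerivAt hm hloc z).continuousAt
    · rw [norm_iteratedFDeriv_zero, ← integral_mul_const]
      refine norm_integral_le_of_norm_le (hβ.mul_const _) ?_
      filter_upwards [h] with s hs
      simpa using hs z
  | succ n ih =>
    have hfd : _root_.fderiv ℝ (fun z => ∫ s, G s z ∂μ)
        = fun z => ∫ s, _root_.fderiv ℝ (G s) z ∂μ := by
      ext1 z
      exact (hG.hasFDerivAt hm hloc z).fderiv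
    obtain ⟨h1, h2⟩ := ih hG.fderiv
    refine ⟨?_, fun β hβ h z => ?_⟩
    · rw [Nat.cast_succ, contDiff_succ_iff_fderiv]
      refine ⟨fun z => (hG.hasFDerivAt hm hloc z).differentiableAt, by simp, ?_⟩
      rw [hfd]
      exact h1
    · rw [← norm_iteratedFDeriv_fderiv, hfd]
      refine h2 β hβ ?_ z
      filter_upwards [h] with s hs z
      rw [norm_iteratedFDeriv_fderiv]
      exact hs z

lemma IsIntegrableFamily.isSymbol_integral (hm : ∀ z, 0 ≤ m z)
    (hloc : ∀ z, ∃ C, ∀ᶠ z' in 𝓝 z, m z' ≤ C) (hG : IsIntegrableFamily μ m G) :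
    IsSymbol m (fun z => ∫ s, G s z ∂μ) := by
  refine ⟨contDiff_infty.2 fun n => (hG.contDiff_integral_and_norm_le hm hloc n).1, fun n => ?_⟩
  obtain ⟨β, hβ, h⟩ := hG.bound n
  exact ⟨_, (hG.contDiff_integral_and_norm_le hm hloc n).2 β hβ h⟩

end Parametric

/-! ### Base and fibre coordinates, and the weights -/

/-- `ℝ^{2d}`, with points `(v_L, v_R)`. -/
abbrev PosPair (d : ℕ) := Pos d × Pos d

/-- The component `(x_L, x_R)` of `((x_L, ξ_L), (x_R, ξ_R))`. -/
def basePart : SuperPhase d →L[ℝ] PosPair d :=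
  ((ContinuousLinearMap.fst ℝ (Pos d) (Pos d)).comp (ContinuousLinearMap.fst ℝ _ _)).prod
    ((ContinuousLinearMap.fst ℝ (Pos d) (Pos d)).comp (ContinuousLinearMap.snd ℝ _ _))

/-- The component `(ξ_L, ξ_R)` of `((x_L, ξ_L), (x_R, ξ_R))`. -/
def fibrePart : SuperPhase d →L[ℝ] PosPair d :=
  ((ContinuousLinearMap.snd ℝ (Pos d) (Pos d)).comp (ContinuousLinearMap.fst ℝ _ _)).prod
    ((ContinuousLinearMap.snd ℝ (Pos d) (Pos d)).comp (ContinuousLinearMap.snd ℝ _ _))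

/-- The inclusion of `ℝ^{2d}` as the space of base components. -/
def baseEmb : PosPair d →L[ℝ] SuperPhase d :=
  ((ContinuousLinearMap.inl ℝ (Pos d) (Pos d)).comp (ContinuousLinearMap.fst ℝ _ _)).prod
    ((ContinuousLinearMap.inl ℝ (Pos d) (Pos d)).comp (ContinuousLinearMap.snd ℝ _ _))

/-- The inclusion of `ℝ^{2d}` as the space of fibre components. -/
def fibreEmb : PosPair d →L[ℝ] SuperPhase d :=
  ((ContinuousLinearMap.inr ℝ (Pos d) (Pos d)).comp (ContinuousLinearMap.fst ℝ _ _)).prod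
    ((ContinuousLinearMap.inr ℝ (Pos d) (Pos d)).comp (ContinuousLinearMap.snd ℝ _ _))

lemma basePart_apply (X : SuperPhase d) : basePart X = (X.1.1, X.2.1) := rfl
lemma fibrePart_apply (X : SuperPhase d) : fibrePart X = (X.1.2, X.2.2) := rfl
lemma baseEmb_apply (q : PosPair d) : baseEmb q = ((q.1, 0), (q.2, 0)) := rfl
lemma fibreEmb_apply (v : PosPair d) : fibreEmb v = ((0, v.1), (0, v.2)) := rfl

@[simp] lemma basePart_baseEmb (q : PosPair d) : basePart (baseEmb q) = q := rfl
@[simp] lemma basePart_fibreEmb (q : PosPair d) : basePart (fibreEmb q) = 0 := rfl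
@[simp] lemma fibrePart_baseEmb (q : PosPair d) : fibrePart (baseEmb q) = 0 := rfl
@[simp] lemma fibrePart_fibreEmb (q : PosPair d) : fibrePart (fibreEmb q) = q := rfl

/-- The point with base component `q` and fibre component `v`. -/
def assemble (q v : PosPair d) : SuperPhase d := ((q.1, v.1), (q.2, v.2))

lemma assemble_eq (q v : PosPair d) : assemble q v = baseEmb q + fibreEmb v := by
  simp [assemble, baseEmb_apply, fibreEmb_apply]

@[simp] lemma basePart_assemble (q v : PosPair d) : basePart (assemble q v) = q := rfl
@[simp] lemma fibrePart_assemble (q v : PosPair d) : fibrePart (assemble q v) = v := rfl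
@[fun_prop]
lemma continuous_assemble : Continuous (fun p : PosPair d × PosPair d => assemble p.1 p.2) := by
  unfold assemble; fun_prop

/-- The pairing `ξ_L · v_L - ξ_R · v_R` in the phase of the super Weyl transform. -/
def phasePairing (ξ v : PosPair d) : ℝ := inner ℝ ξ.1 v.1 - inner ℝ ξ.2 v.2

lemma phasePairing_add_left (ξ η v : PosPair d) :
    phasePairing (ξ + η) v = phasePairing ξ v + phasePairing η v := by
  simp only [phasePairing, Prod.fst_add, Prod.snd_add, inner_add_left]; ring

lemma phasePairing_smul_left (t : ℝ) (ξ v : PosPair d) :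
    phasePairing (t • ξ) v = t * phasePairing ξ v := by
  simp only [phasePairing, Prod.smul_fst, Prod.smul_snd, real_inner_smul_left]; ring

lemma phasePairing_add_right (ξ v w : PosPair d) :
    phasePairing ξ (v + w) = phasePairing ξ v + phasePairing ξ w := by
  simp only [phasePairing, Prod.fst_add, Prod.snd_add, inner_add_right]; ring

lemma phasePairing_smul_right (t : ℝ) (ξ v : PosPair d) :
    phasePairing ξ (t • v) = t * phasePairing ξ v := by
  simp only [phasePairing, Prod.smul_fst, Prod.smul_snd, real_inner_smul_right]; ring

/-- `ξ_L · v_L - ξ_R · v_R` as a linear form in `v`. -/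
def phaseForm (ξ : PosPair d) : PosPair d →L[ℝ] ℝ :=
  (innerSL ℝ ξ.1).comp (ContinuousLinearMap.fst ℝ _ _)
    - (innerSL ℝ ξ.2).comp (ContinuousLinearMap.snd ℝ _ _)

lemma phaseForm_apply (ξ v : PosPair d) : phaseForm ξ v = phasePairing ξ v := rfl

/-- `1 + |v_L|² + |v_R|²`. -/
def japaneseSq (v : PosPair d) : ℝ := 1 + (‖v.1‖ ^ 2 + ‖v.2‖ ^ 2)

lemma one_le_japaneseSq (v : PosPair d) : 1 ≤ japaneseSq v := by
  unfold japaneseSq; nlinarith [sq_nonneg ‖v.1‖, sq_nonneg ‖v.2‖]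

lemma japaneseSq_pos (v : PosPair d) : 0 < japaneseSq v :=
  zero_lt_one.trans_le (one_le_japaneseSq v)

@[fun_prop]
lemma continuous_japaneseSq : Continuous (japaneseSq (d := d)) := by
  unfold japaneseSq; fun_prop

lemma one_add_norm_sq_le_japaneseSq (v : PosPair d) : (1 + ‖v‖) ^ 2 ≤ 2 * japaneseSq v := by
  unfold japaneseSq
  rcases max_cases ‖v.1‖ ‖v.2‖ with h | h <;> rw [Prod.norm_def, h.1] <;>
    nlinarith [sq_nonneg (‖v.1‖ - 1), sq_nonneg (‖v.2‖ - 1), sq_nonneg ‖v.1‖, sq_nonneg ‖v.2‖]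

lemma japaneseSq_le (v : PosPair d) : japaneseSq v ≤ 2 * (1 + ‖v‖) ^ 2 := by
  unfold japaneseSq
  have h1 := norm_fst_le v
  have h2 := norm_snd_le v
  have h3 := norm_nonneg v
  nlinarith [norm_nonneg v.1, norm_nonneg v.2, mul_self_le_mul_self (norm_nonneg v.1) h1,
    mul_self_le_mul_self (norm_nonneg v.2) h2]

instance isAddHaarMeasure_volume_posPair : (volume : Measure (PosPair d)).IsAddHaarMeasure :=
  Measure.prod.instIsAddHaarMeasure _ _

instance isAddHaarMeasure_volume_superPhase :
    (volume : Measure (SuperPhase d)).IsAddHaarMeasure :=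
  Measure.prod.instIsAddHaarMeasure _ _

/-- A continuous function bounded below by a multiple of `(1 + ‖x‖)²` has an integrable reciprocal
power as soon as the exponent exceeds half the dimension. -/
lemma integrable_inv_pow {E : Type*} [NormedAddCommGroup E] [NormedSpace ℝ E]
    [FiniteDimensional ℝ E] [MeasurableSpace E] [BorelSpace E] {μ : Measure E}
    [μ.IsAddHaarMeasure] {J : E → ℝ} (hJ : Continuous J) (h : ∀ x, (1 + ‖x‖) ^ 2 ≤ 2 * J x)
    {N : ℕ} (hN : Module.finrank ℝ E < 2 * N) : Integrable (fun x => (J x ^ N)⁻¹) μ := by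
  have hpos : ∀ x, 0 < J x := fun x => by
    have := h x
    have : 0 < (1 + ‖x‖) ^ 2 := by positivity
    linarith
  have hi := (integrable_one_add_norm (E := E) (μ := μ) (r := ((2 * N : ℕ) : ℝ))
    (by exact_mod_cast hN)).const_mul (2 ^ N)
  refine hi.mono' ((hJ.pow N).inv₀ fun x => (pow_pos (hpos x) N).ne').aestronglyMeasurable ?_
  refine Eventually.of_forall fun x => ?_
  have hx := hpos x
  rw [Real.norm_of_nonneg (by positivity), Real.rpow_neg (by positivity), Real.rpow_natCast,
    pow_mul, ← div_eq_mul_inv, inv_eq_one_div, div_le_div_iff₀ (by positivity) (by positivity),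
    one_mul, ← mul_pow]
  exact pow_le_pow_left₀ (by positivity) (h x) N

lemma integrable_inv_japaneseSq_pow :
    Integrable (fun v : PosPair d => (japaneseSq v ^ (d + 1))⁻¹) :=
  integrable_inv_pow continuous_japaneseSq one_add_norm_sq_le_japaneseSq (by simp; omega)

lemma integrable_inv_japaneseSq_mul_pow :
    Integrable (fun X : SuperPhase d =>
      ((japaneseSq (basePart X) * japaneseSq (fibrePart X)) ^ (2 * d + 1))⁻¹) := by
  refine integrable_inv_pow (by fun_prop) (fun X => ?_) (by simp; omega)
  have h1 := one_le_japaneseSq (basePart X)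
  have h2 := one_le_japaneseSq (fibrePart X)
  have h3 := one_add_norm_sq_le_japaneseSq (basePart X)
  have h4 := one_add_norm_sq_le_japaneseSq (fibrePart X)
  have h5 : japaneseSq (basePart X) ≤ japaneseSq (basePart X) * japaneseSq (fibrePart X) :=
    le_mul_of_one_le_right (by linarith) h2
  have h6 : japaneseSq (fibrePart X) ≤ japaneseSq (basePart X) * japaneseSq (fibrePart X) :=
    le_mul_of_one_le_left (by linarith) h1
  have h7 : ‖X‖ = max ‖basePart X‖ ‖fibrePart X‖ := by
    simp only [Prod.norm_def, basePart_apply, fibrePart_apply]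
    exact max_max_max_comm _ _ _ _
  rcases max_cases ‖basePart X‖ ‖fibrePart X‖ with h | h <;> rw [h7, h.1] <;> linarith

lemma isSymbol_japaneseSq : IsSymbol (japaneseSq (d := d)) (japaneseSq (d := d)) := by
  have hw : ∀ v : PosPair d, 0 ≤ 1 + ‖v‖ := fun v => by positivity
  have h1 : IsSymbol (fun v : PosPair d => (1 + ‖v‖) * (1 + ‖v‖)) (fun v => ‖v.1‖ ^ 2) := by
    simp only [← real_inner_self_eq_norm_sq]
    exact IsSymbol.bilin (innerSL ℝ) hw hw
      (IsSymbol.of_clm (ContinuousLinearMap.fst ℝ (Pos d) (Pos d)))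
      (IsSymbol.of_clm (ContinuousLinearMap.fst ℝ (Pos d) (Pos d)))
  have h2 : IsSymbol (fun v : PosPair d => (1 + ‖v‖) * (1 + ‖v‖)) (fun v => ‖v.2‖ ^ 2) := by
    simp only [← real_inner_self_eq_norm_sq]
    exact IsSymbol.bilin (innerSL ℝ) hw hw
      (IsSymbol.of_clm (ContinuousLinearMap.snd ℝ (Pos d) (Pos d)))
      (IsSymbol.of_clm (ContinuousLinearMap.snd ℝ (Pos d) (Pos d)))
  have h3 : IsSymbol (fun v : PosPair d => (1 + ‖v‖) * (1 + ‖v‖)) (fun _ => (1 : ℝ)) :=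
    (IsSymbol.const (1 : ℝ)).mono (K := 1) (by simp)
      (fun v => by nlinarith [norm_nonneg v])
  exact (h3.add (h1.add h2)).mono (K := 2) (fun v => by positivity)
    (fun v => by nlinarith [one_add_norm_sq_le_japaneseSq v])

lemma isSymbol_inv_japaneseSq_pow (N : ℕ) :
    IsSymbol (fun X : SuperPhase d => (japaneseSq (fibrePart X) ^ N)⁻¹)
      (fun X => (japaneseSq (fibrePart X) ^ N)⁻¹) := by
  have h := ((IsSymbol.inv japaneseSq_pos isSymbol_japaneseSq).pow
    (fun v => inv_nonneg.2 (japaneseSq_pos v).le) N).comp_clm (fibrePart (d := d))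
  simpa only [inv_pow] using h

lemma hasTemperateGrowth_japaneseSq : Function.HasTemperateGrowth (japaneseSq (d := d)) := by
  refine IsSymbol.hasTemperateGrowth (k := 2) (isSymbol_japaneseSq.mono (K := 2)
    (fun v => (japaneseSq_pos v).le) japaneseSq_le)

/-! ### The partial Fourier transform in the fibre variables -/

/-- `∫ exp(i(ξ_L · v_L - ξ_R · v_R)) F(q, v) dv` as a function of `(q, ξ)`. -/
def fibreFourier (F : SuperPhase d → ℂ) (X : SuperPhase d) : ℂ :=
  ∫ v : PosPair d, Complex.exp (Complex.I * (phasePairing (fibrePart X) v : ℝ)) *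
    F (assemble (basePart X) v)

lemma norm_exp_I_mul (t : ℝ) : ‖Complex.exp (Complex.I * (t : ℂ))‖ = 1 := by
  rw [mul_comm]; exact Complex.norm_exp_ofReal_mul_I t

/-- The weight `⟨v⟩^{-2(d+1)}`, integrable in the fibre variables. -/
def fibreWeight (X : SuperPhase d) : ℝ := (japaneseSq (fibrePart X) ^ (d + 1))⁻¹

lemma fibreWeight_nonneg (X : SuperPhase d) : 0 ≤ fibreWeight X :=
  inv_nonneg.2 (pow_nonneg (japaneseSq_pos _).le _)

lemma integrable_fibreWeight (q : PosPair d) :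
    Integrable (fun v => fibreWeight (assemble q v)) := integrable_inv_japaneseSq_pow

/-- The integral of the weight `⟨v⟩^{-2(d+1)}` over a fibre. -/
def fibreMass (d : ℕ) : ℝ := ∫ v : PosPair d, (japaneseSq v ^ (d + 1))⁻¹

lemma fibreMass_nonneg : 0 ≤ fibreMass d :=
  integral_nonneg fun v => inv_nonneg.2 (pow_nonneg (japaneseSq_pos v).le _)

/-- Continuous functions of order `O(⟨v⟩^{-2(d+1)})`, to which the partial Fourier transform
applies. -/
structure FibreIntegrable (F : SuperPhase d → ℂ) : Prop where
  continuous : Continuous F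
  bound : ∃ C : ℝ, 0 ≤ C ∧ ∀ X, ‖F X‖ ≤ C * fibreWeight X

lemma IsSymbol.fibreIntegrable {F : SuperPhase d → ℂ} (hF : IsSymbol fibreWeight F) :
    FibreIntegrable F :=
  ⟨hF.contDiff.continuous, hF.norm_le fibreWeight_nonneg⟩

namespace FibreIntegrable

variable {F G : SuperPhase d → ℂ}

lemma integrable_mul (hF : FibreIntegrable F) (q ξ : PosPair d) :
    Integrable (fun v => Complex.exp (Complex.I * (phasePairing ξ v : ℝ)) * F (assemble q v)) := by
  obtain ⟨C, -, hC⟩ := hF.bound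
  have := hF.continuous
  refine ((integrable_fibreWeight q).const_mul C).mono'
    (Continuous.aestronglyMeasurable (by unfold assemble phasePairing; fun_prop))
    (Eventually.of_forall fun v => ?_)
  rw [norm_mul, norm_exp_I_mul, one_mul]
  exact hC _

lemma integrable (hF : FibreIntegrable F) (q : PosPair d) :
    Integrable (fun v => F (assemble q v)) := by
  simpa [phasePairing] using hF.integrable_mul q 0

lemma norm_fibreFourier_le {C : ℝ} (hC : ∀ X, ‖F X‖ ≤ C * fibreWeight X) (X : SuperPhase d) :
    ‖fibreFourier F X‖ ≤ C * fibreMass d := by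
  rw [fibreMass, ← integral_const_mul]
  refine norm_integral_le_of_norm_le (integrable_inv_japaneseSq_pow.const_mul C)
    (Eventually.of_forall fun v => ?_)
  rw [norm_mul, norm_exp_I_mul, one_mul]
  exact hC _

lemma continuous_fibreFourier (hF : FibreIntegrable F) : Continuous (fibreFourier F) := by
  obtain ⟨C, -, hC⟩ := hF.bound
  have := hF.continuous
  refine MeasureTheory.continuous_of_dominated
    (bound := fun v => C * (japaneseSq v ^ (d + 1))⁻¹)
    (fun X => (hF.integrable_mul _ _).aestronglyMeasurable)
    (fun X => Eventually.of_forall fun v => ?_) (integrable_inv_japaneseSq_pow.const_mul C)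
    (Eventually.of_forall fun v => ?_)
  · rw [norm_mul, norm_exp_I_mul, one_mul]
    exact hC _
  · unfold assemble phasePairing; fun_prop

lemma fibreFourier_add (hF : FibreIntegrable F) (hG : FibreIntegrable G) (X : SuperPhase d) :
    fibreFourier (fun Y => F Y + G Y) X = fibreFourier F X + fibreFourier G X := by
  unfold fibreFourier
  rw [← integral_add (hF.integrable_mul _ _) (hG.integrable_mul _ _)]
  simp only [mul_add]

lemma fibreFourier_sub (hF : FibreIntegrable F) (hG : FibreIntegrable G) (X : SuperPhase d) :
    fibreFourier (fun Y => F Y - G Y) X = fibreFourier F X - fibreFourier G X := by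
  unfold fibreFourier
  rw [← integral_sub (hF.integrable_mul _ _) (hG.integrable_mul _ _)]
  simp only [mul_sub]

lemma fibreFourier_sum {ι : Type*} (s : Finset ι) {F : ι → SuperPhase d → ℂ}
    (hF : ∀ i ∈ s, FibreIntegrable (F i)) (X : SuperPhase d) :
    fibreFourier (fun Y => ∑ i ∈ s, F i Y) X = ∑ i ∈ s, fibreFourier (F i) X := by
  unfold fibreFourier
  rw [← integral_finsetSum s fun i hi => (hF i hi).integrable_mul _ _]
  simp only [Finset.mul_sum]

end FibreIntegrable

/-- A factor depending only on the base variables can be taken out of the partial Fourier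
transform. -/
lemma fibreFourier_base_mul (g : PosPair d → ℂ) (F : SuperPhase d → ℂ) (X : SuperPhase d) :
    fibreFourier (fun Y => g (basePart Y) * F Y) X = g (basePart X) * fibreFourier F X := by
  unfold fibreFourier
  rw [← integral_const_mul]
  refine integral_congr_ae (Eventually.of_forall fun v => ?_)
  simp only [basePart_assemble]
  ring

lemma hasDerivAt_exp_I_mul {f : ℝ → ℝ} {f' t : ℝ} (hf : HasDerivAt f f' t) :
    HasDerivAt (fun s => Complex.exp (Complex.I * (f s : ℂ)))
      (Complex.exp (Complex.I * (f t : ℂ)) * (Complex.I * (f' : ℂ))) t :=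
  (hf.ofReal_comp.const_mul Complex.I).cexp

/-- Integration by parts in the fibre: a fibre derivative becomes multiplication by a linear form
in the dual variable. -/
lemma IsSymbol.fibreFourier_fderiv {F : SuperPhase d → ℂ} (hF : IsSymbol fibreWeight F)
    (e : PosPair d) (X : SuperPhase d) :
    fibreFourier (fun Y => _root_.fderiv ℝ F Y (fibreEmb e)) X
      = -(Complex.I * (phasePairing (fibrePart X) e : ℝ)) * fibreFourier F X := by
  have hF' := hF.fderiv_apply (fibreEmb e)
  have hline : ∀ v, HasLineDerivAt ℝ (fun v => F (assemble (basePart X) v))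
      (_root_.fderiv ℝ F (assemble (basePart X) v) (fibreEmb e)) v e := by
    intro v
    have h := ((hF.differentiable (assemble (basePart X) v)).hasFDerivAt).hasLineDerivAt
      (fibreEmb e)
    have heq : ∀ t : ℝ, assemble (basePart X) v + t • fibreEmb e
        = assemble (basePart X) (v + t • e) := fun t => by
      simp only [assemble_eq, map_add, map_smul, add_assoc]
    simpa only [HasLineDerivAt, heq] using h
  have hexp : ∀ v, HasLineDerivAt ℝ
      (fun v => Complex.exp (Complex.I * (phasePairing (fibrePart X) v : ℝ)))
      (Complex.exp (Complex.I * (phasePairing (fibrePart X) v : ℝ)) *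
        (Complex.I * (phasePairing (fibrePart X) e : ℝ))) v e := by
    intro v
    have h : HasDerivAt (fun t : ℝ => phasePairing (fibrePart X) (v + t • e))
        (phasePairing (fibrePart X) e) 0 := by
      simp only [phasePairing_add_right, phasePairing_smul_right]
      simpa using ((hasDerivAt_id (0 : ℝ)).mul_const
        (phasePairing (fibrePart X) e)).const_add (phasePairing (fibrePart X) v)
    have := hasDerivAt_exp_I_mul h
    simpa only [HasLineDerivAt, zero_smul, add_zero] using this
  have hint := hF.fibreIntegrable.integrable_mul (basePart X) (fibrePart X)
  have := integral_bilinear_hasLineDerivAt_right_eq_neg_left_of_integrable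
    (μ := (volume : Measure (PosPair d))) (B := ContinuousLinearMap.mul ℝ ℂ)
    (f := fun v => Complex.exp (Complex.I * (phasePairing (fibrePart X) v : ℝ)))
    (g := fun v => F (assemble (basePart X) v)) (v := e)
    (by
      refine (hint.const_mul (Complex.I * (phasePairing (fibrePart X) e : ℝ))).congr
        (Eventually.of_forall fun v => ?_)
      simp only [ContinuousLinearMap.mul_apply']
      ring)
    (by simpa using hF'.fibreIntegrable.integrable_mul (basePart X) (fibrePart X))
    (by simpa using hint) (fun v _ => hexp v) (fun v _ => hline v)
  simp only [ContinuousLinearMap.mul_apply'] at this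
  unfold fibreFourier
  rw [this, neg_mul, ← integral_const_mul]
  congr 1
  refine integral_congr_ae (Eventually.of_forall fun v => ?_)
  ring

/-- The standard orthonormal basis of `ℝ^{2d}`. -/
def pairBasis : Fin d ⊕ Fin d → PosPair d :=
  Sum.elim (fun j => (EuclideanSpace.single j 1, 0)) (fun j => (0, EuclideanSpace.single j 1))

lemma sum_phasePairing_pairBasis_sq (ξ : PosPair d) :
    ∑ i, phasePairing ξ (pairBasis i) ^ 2 = ‖ξ.1‖ ^ 2 + ‖ξ.2‖ ^ 2 := by
  simp [phasePairing, pairBasis, EuclideanSpace.inner_single_right, EuclideanSpace.norm_sq_eq]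

lemma sum_phasePairing_pairBasis_sq' (v : PosPair d) :
    ∑ i, phasePairing (pairBasis i) v ^ 2 = ‖v.1‖ ^ 2 + ‖v.2‖ ^ 2 := by
  simp [phasePairing, pairBasis, EuclideanSpace.inner_single_left, EuclideanSpace.norm_sq_eq]

/-- The operator `1 - Δ` in the fibre variables. -/
def fibreLap (F : SuperPhase d → ℂ) (X : SuperPhase d) : ℂ :=
  F X - ∑ i, fderiv ℝ (fun Y => fderiv ℝ F Y (fibreEmb (pairBasis i))) X (fibreEmb (pairBasis i))

lemma IsSymbol.fibreLap {m : SuperPhase d → ℝ} {F : SuperPhase d → ℂ} (hF : IsSymbol m F) :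
    IsSymbol m (fibreLap F) :=
  hF.sub (IsSymbol.sum _ fun _ _ => (hF.fderiv_apply _).fderiv_apply _)

lemma IsSymbol.fibreLap_iterate {m : SuperPhase d → ℝ} {F : SuperPhase d → ℂ} (hF : IsSymbol m F)
    (K : ℕ) : IsSymbol m (MagneticSuper.fibreLap^[K] F) := by
  induction K with
  | zero => exact hF
  | succ K ih => rw [Function.iterate_succ_apply']; exact ih.fibreLap

lemma IsSymbol.fibreFourier_fibreLap {F : SuperPhase d → ℂ} (hF : IsSymbol fibreWeight F)
    (X : SuperPhase d) :
    fibreFourier (MagneticSuper.fibreLap F) X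
      = (japaneseSq (fibrePart X) : ℂ) * fibreFourier F X := by
  have h2 : ∀ i, IsSymbol fibreWeight (fun Y => _root_.fderiv ℝ (fun Y => _root_.fderiv ℝ F Y
      (fibreEmb (pairBasis i))) Y (fibreEmb (pairBasis i))) :=
    fun i => (hF.fderiv_apply _).fderiv_apply _
  unfold MagneticSuper.fibreLap
  rw [FibreIntegrable.fibreFourier_sub hF.fibreIntegrable
    (IsSymbol.sum _ fun i _ => h2 i).fibreIntegrable,
    FibreIntegrable.fibreFourier_sum _ fun i _ => (h2 i).fibreIntegrable]
  have h3 : ∀ i, fibreFourier (fun Y => _root_.fderiv ℝ (fun Y => _root_.fderiv ℝ F Y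
      (fibreEmb (pairBasis i))) Y (fibreEmb (pairBasis i))) X
      = -((phasePairing (fibrePart X) (pairBasis i) ^ 2 : ℝ) : ℂ) * fibreFourier F X := by
    intro i
    rw [(hF.fderiv_apply (fibreEmb (pairBasis i))).fibreFourier_fderiv,
      hF.fibreFourier_fderiv, ← mul_assoc]
    congr 1
    push_cast
    linear_combination (phasePairing (fibrePart X) (pairBasis i) : ℂ) ^ 2 * Complex.I_sq
  rw [Finset.sum_congr rfl fun i _ => h3 i, ← Finset.sum_mul, Finset.sum_neg_distrib,
    ← Complex.ofReal_sum, sum_phasePairing_pairBasis_sq]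
  unfold japaneseSq
  push_cast
  ring

lemma IsSymbol.fibreFourier_fibreLap_iterate {F : SuperPhase d → ℂ} (hF : IsSymbol fibreWeight F)
    (K : ℕ) (X : SuperPhase d) :
    fibreFourier (MagneticSuper.fibreLap^[K] F) X
      = (japaneseSq (fibrePart X) : ℂ) ^ K * fibreFourier F X := by
  induction K with
  | zero => simp
  | succ K ih =>
    rw [Function.iterate_succ_apply', (hF.fibreLap_iterate K).fibreFourier_fibreLap, ih, pow_succ]
    ring

/-! ### Tempered weights -/

/-- `⟨(x_L, x_R)⟩² ⟨(ξ_L, ξ_R)⟩²`, a convenient majorant of `⟨X⟩²`. -/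
def superSq (X : SuperPhase d) : ℝ := japaneseSq (basePart X) * japaneseSq (fibrePart X)

lemma one_le_superSq (X : SuperPhase d) : 1 ≤ superSq X :=
  one_le_mul_of_one_le_of_one_le (one_le_japaneseSq _) (one_le_japaneseSq _)

lemma superSq_pos (X : SuperPhase d) : 0 < superSq X := zero_lt_one.trans_le (one_le_superSq X)

@[fun_prop]
lemma continuous_superSq : Continuous (superSq (d := d)) := by
  unfold superSq; fun_prop

lemma bracket_rpow_le {a : ℝ} (ha : 0 < a) (X : SuperPhase d) :
    bracket X ^ a ≤ superSq X ^ ⌈a⌉₊ := by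
  have h1 : bracket X ≤ superSq X := by
    refine Real.sqrt_le_iff.2 ⟨(superSq_pos X).le, ?_⟩
    have h : 1 + (‖X.1.1‖ ^ 2 + ‖X.1.2‖ ^ 2 + ‖X.2.1‖ ^ 2 + ‖X.2.2‖ ^ 2) ≤ superSq X := by
      simp only [superSq, japaneseSq, basePart_apply, fibrePart_apply]
      nlinarith [mul_nonneg (add_nonneg (sq_nonneg ‖X.1.1‖) (sq_nonneg ‖X.2.1‖))
        (add_nonneg (sq_nonneg ‖X.1.2‖) (sq_nonneg ‖X.2.2‖))]
    nlinarith [one_le_superSq X]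
  calc bracket X ^ a ≤ superSq X ^ a := Real.rpow_le_rpow (Real.sqrt_nonneg _) h1 ha.le
    _ ≤ superSq X ^ (⌈a⌉₊ : ℝ) :=
      Real.rpow_le_rpow_of_exponent_le (one_le_superSq X) (Nat.le_ceil a)
    _ = _ := Real.rpow_natCast _ _

namespace IsTemperedWeight

variable {M : SuperPhase d → ℝ}

lemma nonneg (hM : IsTemperedWeight M) (X : SuperPhase d) : 0 ≤ M X := (hM.pos X).le

lemma exists_le_superSq (hM : IsTemperedWeight M) :
    ∃ (A : ℕ) (C : ℝ), 0 ≤ C ∧ ∀ U V, M (U + V) ≤ C * M U * superSq V ^ A := by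
  obtain ⟨a, C, ha, hC, h⟩ := hM.tempered
  refine ⟨⌈a⌉₊, C, hC.le, fun U V => (h U V).trans ?_⟩
  exact mul_le_mul_of_nonneg_left (bracket_rpow_le ha V) (mul_nonneg hC.le (hM.nonneg U))

lemma locally_bounded (hM : IsTemperedWeight M) (X : SuperPhase d) :
    ∃ C, ∀ᶠ Y in 𝓝 X, M Y ≤ C := by
  obtain ⟨A, C, hC, h⟩ := hM.exists_le_superSq
  have hcont : Continuous (fun Y => C * M X * superSq (Y - X) ^ A) := by fun_prop
  refine ⟨C * M X * superSq (X - X) ^ A + 1, ?_⟩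
  filter_upwards [hcont.continuousAt.eventually_lt_const (lt_add_one _)] with Y hY
  have := h X (Y - X)
  rw [add_sub_cancel] at this
  linarith

end IsTemperedWeight

/-- Continuous functions on `ℝ^{4d}` of polynomial growth. -/
structure PolyBounded (Φ : SuperPhase d → ℂ) : Prop where
  continuous : Continuous Φ
  bound : ∃ (A : ℕ) (C : ℝ), 0 ≤ C ∧ ∀ X, ‖Φ X‖ ≤ C * superSq X ^ A

lemma IsSymbol.polyBounded {M : SuperPhase d → ℝ} (hM : IsTemperedWeight M)
    {Φ : SuperPhase d → ℂ} (hΦ : IsSymbol M Φ) : PolyBounded Φ := by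
  obtain ⟨A, C, hC, h⟩ := hM.exists_le_superSq
  obtain ⟨D, hD, h'⟩ := hΦ.norm_le hM.nonneg
  refine ⟨hΦ.contDiff.continuous, A, D * (C * M 0), ?_, fun X => (h' X).trans ?_⟩
  · have := hM.nonneg 0
    positivity
  · rw [mul_assoc]
    refine mul_le_mul_of_nonneg_left ?_ hD
    simpa using h 0 X

/-! ### Schwartz functions on `ℝ^{4d}` and the decay of their partial Fourier transform -/

/-- The Schwartz functions on `ℝ^{4d}`. -/
abbrev SuperSchw (d : ℕ) := 𝓢(SuperPhase d, ℂ)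

lemma isSymbol_schwartz (F : SuperSchw d) : IsSymbol fibreWeight F := by
  refine ⟨F.smooth _, fun n => ?_⟩
  refine ⟨2 ^ (d + 1) * (2 ^ (2 * (d + 1)) * ((Finset.Iic (2 * (d + 1), n)).sup fun m =>
    SchwartzMap.seminorm ℝ m.1 m.2) F), fun X => ?_⟩
  have h := SchwartzMap.one_add_le_sup_seminorm_apply (𝕜 := ℝ) (m := (2 * (d + 1), n))
    le_rfl le_rfl F X
  have hJ : japaneseSq (fibrePart X) ≤ 2 * (1 + ‖X‖) ^ 2 := by
    refine (japaneseSq_le _).trans ?_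
    have : ‖fibrePart X‖ ≤ ‖X‖ :=
      max_le_max (norm_snd_le X.1) (norm_snd_le X.2)
    gcongr
  have hpos := pow_pos (japaneseSq_pos (fibrePart X)) (d + 1)
  unfold fibreWeight
  rw [← div_eq_mul_inv, le_div_iff₀ hpos]
  calc ‖iteratedFDeriv ℝ n F X‖ * japaneseSq (fibrePart X) ^ (d + 1)
      ≤ ‖iteratedFDeriv ℝ n F X‖ * (2 * (1 + ‖X‖) ^ 2) ^ (d + 1) := by
        have := (japaneseSq_pos (fibrePart X)).le
        gcongr
    _ = 2 ^ (d + 1) * ((1 + ‖X‖) ^ (2 * (d + 1)) * ‖iteratedFDeriv ℝ n F X‖) := by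
        rw [mul_pow, ← pow_mul]; ring
    _ ≤ _ := by gcongr

/-- The operator `1 - Δ` in the fibre variables, on Schwartz functions. -/
def fibreLapCLM (d : ℕ) : SuperSchw d →L[ℂ] SuperSchw d :=
  ContinuousLinearMap.id ℂ _ - ∑ i : Fin d ⊕ Fin d,
    (LineDeriv.lineDerivOpCLM ℂ (SuperSchw d) (fibreEmb (pairBasis i))).comp
      (LineDeriv.lineDerivOpCLM ℂ (SuperSchw d) (fibreEmb (pairBasis i)))

lemma coe_lineDerivOp (e : SuperPhase d) (F : SuperSchw d) :
    ⇑(∂_{e} F : SuperSchw d) = fun X => fderiv ℝ F X e :=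
  funext fun X => SchwartzMap.lineDerivOp_apply_eq_fderiv e F X

lemma coe_fibreLapCLM (F : SuperSchw d) : ⇑(fibreLapCLM d F) = fibreLap F := by
  ext X
  have : fibreLapCLM d F = F - ∑ i : Fin d ⊕ Fin d,
    (∂_{fibreEmb (pairBasis i)} (∂_{fibreEmb (pairBasis i)} F : SuperSchw d) : SuperSchw d) := by
    simp [fibreLapCLM, sum_apply]
  rw [this]
  simp only [fibreLap, sub_apply, sum_apply, coe_lineDerivOp]

lemma coe_fibreLapCLM_pow (F : SuperSchw d) (K : ℕ) :
    ⇑((fibreLapCLM d ^ K) F) = fibreLap^[K] F := by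
  induction K with
  | zero => simp
  | succ K ih =>
    rw [Function.iterate_succ_apply', pow_succ', ← ih, ← coe_fibreLapCLM]; rfl

lemma hasTemperateGrowth_ofReal_comp {E : Type*} [NormedAddCommGroup E] [NormedSpace ℝ E]
    {f : E → ℝ} (hf : Function.HasTemperateGrowth f) :
    Function.HasTemperateGrowth (fun x => (f x : ℂ)) :=
  Function.HasTemperateGrowth.comp Function.Complex.hasTemperateGrowth_ofReal hf

lemma hasTemperateGrowth_basePart_pow (K : ℕ) : Function.HasTemperateGrowth
    (fun X : SuperPhase d => ((japaneseSq (basePart X) ^ K : ℝ) : ℂ)) :=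
  hasTemperateGrowth_ofReal_comp
    ((hasTemperateGrowth_japaneseSq.comp basePart.hasTemperateGrowth).pow K)

lemma hasTemperateGrowth_fibrePart_pow (K : ℕ) : Function.HasTemperateGrowth
    (fun X : SuperPhase d => ((japaneseSq (fibrePart X) ^ K : ℝ) : ℂ)) :=
  hasTemperateGrowth_ofReal_comp
    ((hasTemperateGrowth_japaneseSq.comp fibrePart.hasTemperateGrowth).pow K)

/-- The partial Fourier transform of a Schwartz function decays faster than any power, with
constants controlled by continuous seminorms. -/
lemma exists_norm_fibreFourier_le (K : ℕ) : ∃ T : SuperSchw d →L[ℂ] SuperSchw d,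
    ∀ (F : SuperSchw d) X, ‖fibreFourier F X‖ ≤
      SchwartzMap.seminorm ℂ 0 0 (T F) * fibreMass d * (superSq X ^ K)⁻¹ := by
  let mb : SuperSchw d →L[ℂ] SuperSchw d :=
    SchwartzMap.smulLeftCLM ℂ (fun X => ((japaneseSq (basePart X) ^ K : ℝ) : ℂ))
  let mf : SuperSchw d →L[ℂ] SuperSchw d :=
    SchwartzMap.smulLeftCLM ℂ (fun X => ((japaneseSq (fibrePart X) ^ (d + 1) : ℝ) : ℂ))
  refine ⟨mf.comp ((fibreLapCLM d ^ K).comp mb), fun F X => ?_⟩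
  have hpos := pow_pos (superSq_pos X) K
  rw [← div_eq_mul_inv, le_div_iff₀ hpos]
  have hG : fibreFourier ((fibreLapCLM d ^ K) (mb F)) X = (superSq X : ℂ) ^ K *
      fibreFourier F X := by
    have hmb : ⇑(mb F) = fun Y => ((japaneseSq (basePart Y) ^ K : ℝ) : ℂ) * F Y := by
      ext Y
      exact SchwartzMap.smulLeftCLM_apply_apply (hasTemperateGrowth_basePart_pow K) F Y
    rw [coe_fibreLapCLM_pow, (isSymbol_schwartz _).fibreFourier_fibreLap_iterate, hmb,
      fibreFourier_base_mul (fun q => ((japaneseSq q ^ K : ℝ) : ℂ)), superSq]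
    push_cast
    ring
  have hb : ∀ Y, ‖(fibreLapCLM d ^ K) (mb F) Y‖ ≤
      SchwartzMap.seminorm ℂ 0 0 ((mf.comp ((fibreLapCLM d ^ K).comp mb)) F) * fibreWeight Y := by
    intro Y
    have h := SchwartzMap.norm_le_seminorm ℂ ((mf.comp ((fibreLapCLM d ^ K).comp mb)) F) Y
    have hval : ((mf.comp ((fibreLapCLM d ^ K).comp mb)) F) Y
        = ((japaneseSq (fibrePart Y) ^ (d + 1) : ℝ) : ℂ) * (fibreLapCLM d ^ K) (mb F) Y :=
      SchwartzMap.smulLeftCLM_apply_apply (hasTemperateGrowth_fibrePart_pow (d + 1)) _ Y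
    have hp := pow_pos (japaneseSq_pos (fibrePart Y)) (d + 1)
    rw [hval, norm_mul, Complex.norm_real, Real.norm_of_nonneg hp.le] at h
    unfold fibreWeight
    rw [← div_eq_mul_inv, le_div_iff₀ hp, mul_comm]
    exact h
  have := FibreIntegrable.norm_fibreFourier_le hb X
  rw [hG, norm_mul, norm_pow, Complex.norm_real, Real.norm_of_nonneg (superSq_pos X).le] at this
  rw [mul_comm]
  exact this

/-! ### The pairing of symbols with Schwartz functions -/

/-- The pairing `∫ Φ(q, ξ) F̂(q, ξ) dq dξ` of a symbol with the partial Fourier transform of `F`. -/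
def superPairing (Φ F : SuperPhase d → ℂ) : ℂ := ∫ X, Φ X * fibreFourier F X

lemma continuous_fibreFourier (F : SuperSchw d) : Continuous (fibreFourier F) :=
  (isSymbol_schwartz F).fibreIntegrable.continuous_fibreFourier

namespace PolyBounded

variable {Φ Ψ : SuperPhase d → ℂ}

/-- The pairing with `Φ` is absolutely convergent, and continuous on Schwartz functions. -/
lemma exists_norm_le (hΦ : PolyBounded Φ) : ∃ T : SuperSchw d →L[ℂ] SuperSchw d, ∃ C : ℝ, 0 ≤ C ∧
    ∀ (F : SuperSchw d) X, ‖Φ X * fibreFourier F X‖ ≤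
      C * SchwartzMap.seminorm ℂ 0 0 (T F) * (superSq X ^ (2 * d + 1))⁻¹ := by
  obtain ⟨A, C, hC, h⟩ := hΦ.bound
  obtain ⟨T, hT⟩ := exists_norm_fibreFourier_le (d := d) (A + (2 * d + 1))
  refine ⟨T, C * fibreMass d, mul_nonneg hC fibreMass_nonneg, fun F X => ?_⟩
  rw [norm_mul]
  have hp := superSq_pos X
  calc ‖Φ X‖ * ‖fibreFourier F X‖ ≤ (C * superSq X ^ A) *
        (SchwartzMap.seminorm ℂ 0 0 (T F) * fibreMass d * (superSq X ^ (A + (2 * d + 1)))⁻¹) := by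
        gcongr
        · exact h X
        · exact hT F X
    _ = C * fibreMass d * SchwartzMap.seminorm ℂ 0 0 (T F) *
        ((superSq X ^ A * (superSq X ^ A)⁻¹) * (superSq X ^ (2 * d + 1))⁻¹) := by
        rw [pow_add, mul_inv]; ring
    _ = _ := by rw [mul_inv_cancel₀ (pow_pos hp A).ne', one_mul]

lemma integrable_mul (hΦ : PolyBounded Φ) (F : SuperSchw d) :
    Integrable (fun X => Φ X * fibreFourier F X) := by
  obtain ⟨T, C, -, hT⟩ := hΦ.exists_norm_le
  exact (integrable_inv_japaneseSq_mul_pow.const_mul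
    (C * SchwartzMap.seminorm ℂ 0 0 (T F))).mono'
    (hΦ.continuous.mul (continuous_fibreFourier F)).aestronglyMeasurable
    (Eventually.of_forall (hT F))

lemma superPairing_add_right (hΦ : PolyBounded Φ) (F G : SuperSchw d) :
    superPairing Φ (F + G) = superPairing Φ F + superPairing Φ G := by
  unfold superPairing
  rw [← integral_add (hΦ.integrable_mul F) (hΦ.integrable_mul G)]
  refine integral_congr_ae (Eventually.of_forall fun X => ?_)
  simp only [← mul_add]
  congr 1
  exact FibreIntegrable.fibreFourier_add (isSymbol_schwartz F).fibreIntegrable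
    (isSymbol_schwartz G).fibreIntegrable X

lemma superPairing_add_left (hΦ : PolyBounded Φ) (hΨ : PolyBounded Ψ) (F : SuperSchw d) :
    superPairing (fun X => Φ X + Ψ X) F = superPairing Φ F + superPairing Ψ F := by
  unfold superPairing
  rw [← integral_add (hΦ.integrable_mul F) (hΨ.integrable_mul F)]
  simp only [add_mul]

end PolyBounded

lemma superPairing_smul_left (c : ℂ) (Φ F : SuperPhase d → ℂ) :
    superPairing (fun X => c * Φ X) F = c * superPairing Φ F := by
  unfold superPairing
  simp only [mul_assoc, integral_const_mul]

lemma fibreFourier_const_mul (c : ℂ) (F : SuperPhase d → ℂ) (X : SuperPhase d) :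
    fibreFourier (fun Y => c * F Y) X = c * fibreFourier F X :=
  fibreFourier_base_mul (fun _ => c) F X

lemma superPairing_smul_right (c : ℂ) (Φ F : SuperPhase d → ℂ) :
    superPairing Φ (fun X => c * F X) = c * superPairing Φ F := by
  unfold superPairing
  simp only [fibreFourier_const_mul, mul_left_comm _ c, integral_const_mul]

/-- The pairing with a symbol, as a tempered distribution on `ℝ^{4d}`. -/
def PolyBounded.pairingCLM {Φ : SuperPhase d → ℂ} (hΦ : PolyBounded Φ) : SuperSchw d →L[ℂ] ℂ where
  toFun F := superPairing Φ F
  map_add' := hΦ.superPairing_add_right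
  map_smul' c F := superPairing_smul_right c Φ F
  cont := by
    let ℓ : SuperSchw d →ₗ[ℂ] ℂ :=
      { toFun := fun F => superPairing Φ F
        map_add' := hΦ.superPairing_add_right
        map_smul' := fun c F => superPairing_smul_right c Φ F }
    obtain ⟨T, C, hC, hT⟩ := hΦ.exists_norm_le
    set I : ℝ := ∫ X : SuperPhase d, (superSq X ^ (2 * d + 1))⁻¹
    have hb : ∀ F, ‖ℓ F‖ ≤ C * I * SchwartzMap.seminorm ℂ 0 0 (T F) := fun F => by
      have : ‖ℓ F‖ ≤ ∫ X : SuperPhase d,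
          C * SchwartzMap.seminorm ℂ 0 0 (T F) * (superSq X ^ (2 * d + 1))⁻¹ :=
        norm_integral_le_of_norm_le (integrable_inv_japaneseSq_mul_pow.const_mul _)
          (Eventually.of_forall (hT F))
      rw [integral_const_mul] at this
      linarith
    have hcont : Continuous fun F : SuperSchw d => SchwartzMap.seminorm ℂ 0 0 (T F) :=
      ((schwartz_withSeminorms ℂ (SuperPhase d) ℂ).continuous_seminorm (0, 0)).comp T.continuous
    change Continuous ℓ
    refine continuous_of_continuousAt_zero ℓ ?_
    rw [ContinuousAt, map_zero]
    refine squeeze_zero_norm hb ?_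
    have := (hcont.const_mul (C * I)).tendsto 0
    simpa using this

/-! ### Derivatives and linear multipliers under the pairing -/

/-- The directional derivative of the partial Fourier transform, along a base direction and a fibre
direction at once. -/
lemma hasLineDerivAt_fibreFourier (F G : SuperSchw d) (e : SuperPhase d)
    (hG : ∀ X, G X = fderiv ℝ F X (baseEmb (basePart e))
      + Complex.I * (phasePairing (fibrePart e) (fibrePart X) : ℝ) * F X) (X : SuperPhase d) :
    HasLineDerivAt ℝ (fibreFourier F) (fibreFourier G X) X e := by
  obtain ⟨C, -, hC⟩ := (isSymbol_schwartz G).fibreIntegrable.bound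
  have hF := (isSymbol_schwartz F).fibreIntegrable
  have hG' := (isSymbol_schwartz G).fibreIntegrable
  have := hasDerivAt_integral_of_dominated_loc_of_deriv_le (𝕜 := ℝ)
    (μ := (volume : Measure (PosPair d))) (x₀ := (0 : ℝ)) (s := Set.univ) univ_mem
    (F := fun t v => Complex.exp (Complex.I * (phasePairing (fibrePart (X + t • e)) v : ℝ)) *
      F (assemble (basePart (X + t • e)) v))
    (F' := fun t v => Complex.exp (Complex.I * (phasePairing (fibrePart (X + t • e)) v : ℝ)) *
      G (assemble (basePart (X + t • e)) v))
    (bound := fun v => C * (japaneseSq v ^ (d + 1))⁻¹)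
    (Eventually.of_forall fun t => (hF.integrable_mul _ _).aestronglyMeasurable)
    (hF.integrable_mul _ _) (hG'.integrable_mul _ _).aestronglyMeasurable
    (Eventually.of_forall fun v t _ => by
      rw [norm_mul, norm_exp_I_mul, one_mul]
      exact hC _)
    (integrable_inv_japaneseSq_pow.const_mul C)
    (Eventually.of_forall fun v t _ => by
      have h1 : HasDerivAt (fun t : ℝ => phasePairing (fibrePart (X + t • e)) v)
          (phasePairing (fibrePart e) v) t := by
        simp only [map_add, map_smul, phasePairing_add_left, phasePairing_smul_left]
        simpa using ((hasDerivAt_id t).mul_const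
          (phasePairing (fibrePart e) v)).const_add (phasePairing (fibrePart X) v)
      have h2 : HasDerivAt (fun t : ℝ => assemble (basePart (X + t • e)) v)
          (baseEmb (basePart e)) t := by
        simp only [map_add, map_smul, assemble_eq]
        simpa using (((hasDerivAt_id t).smul_const
          (baseEmb (basePart e))).const_add (baseEmb (basePart X))).add_const (fibreEmb v)
      have h3 := ((isSymbol_schwartz F).differentiable
        (assemble (basePart (X + t • e)) v)).hasFDerivAt.comp_hasDerivAt t h2
      refine ((hasDerivAt_exp_I_mul h1).mul h3).congr_deriv ?_
      rw [hG]
      simp only [fibrePart_assemble, Function.comp]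
      ring)
  simpa [HasLineDerivAt, fibreFourier] using this.2

/-- Integration by parts in `ℝ^{4d}`: a derivative in the base variables together with a linear
multiplier in the fibre variables moves to a derivative of the symbol. -/
lemma superPairing_fderiv {M : SuperPhase d → ℝ} (hM : IsTemperedWeight M)
    {Φ : SuperPhase d → ℂ} (hΦ : IsSymbol M Φ) (F G : SuperSchw d) (e : SuperPhase d)
    (hG : ∀ X, G X = fderiv ℝ F X (baseEmb (basePart e))
      + Complex.I * (phasePairing (fibrePart e) (fibrePart X) : ℝ) * F X) :
    superPairing Φ G = -superPairing (fun X => fderiv ℝ Φ X e) F := by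
  have hP := hΦ.polyBounded hM
  have hP' := (hΦ.fderiv_apply e).polyBounded hM
  exact integral_bilinear_hasLineDerivAt_right_eq_neg_left_of_integrable
    (μ := (volume : Measure (SuperPhase d))) (B := ContinuousLinearMap.mul ℝ ℂ)
    (f := Φ) (g := fibreFourier F) (v := e) (hP'.integrable_mul F) (hP.integrable_mul G)
    (hP.integrable_mul F)
    (fun X _ => (hΦ.differentiable X).hasFDerivAt.hasLineDerivAt e)
    (fun X _ => hasLineDerivAt_fibreFourier F G e hG X)

lemma superPairing_base_fderiv {M : SuperPhase d → ℝ} (hM : IsTemperedWeight M)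
    {Φ : SuperPhase d → ℂ} (hΦ : IsSymbol M Φ) (F : SuperSchw d) (q : PosPair d) :
    superPairing Φ (fun X => fderiv ℝ F X (baseEmb q))
      = -superPairing (fun X => fderiv ℝ Φ X (baseEmb q)) F := by
  rw [← superPairing_fderiv hM hΦ F (∂_{baseEmb q} F : SuperSchw d) (baseEmb q) fun X => ?_,
    coe_lineDerivOp]
  simp [coe_lineDerivOp, phasePairing]

lemma hasTemperateGrowth_phasePairing (e : PosPair d) : Function.HasTemperateGrowth
    (fun X : SuperPhase d => Complex.I * (phasePairing e (fibrePart X) : ℝ)) := by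
  have h := hasTemperateGrowth_ofReal_comp
    (((phaseForm e).comp (fibrePart (d := d))).hasTemperateGrowth)
  exact (Function.HasTemperateGrowth.const Complex.I).mul h

lemma superPairing_phase_mul {M : SuperPhase d → ℝ} (hM : IsTemperedWeight M)
    {Φ : SuperPhase d → ℂ} (hΦ : IsSymbol M Φ) (F : SuperSchw d) (v : PosPair d) :
    superPairing Φ (fun X => Complex.I * (phasePairing v (fibrePart X) : ℝ) * F X)
      = -superPairing (fun X => fderiv ℝ Φ X (fibreEmb v)) F := by
  have hG : ⇑(SchwartzMap.smulLeftCLM ℂ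
      (fun X : SuperPhase d => Complex.I * (phasePairing v (fibrePart X) : ℝ)) F)
      = fun X => Complex.I * (phasePairing v (fibrePart X) : ℝ) * F X := by
    ext X
    exact SchwartzMap.smulLeftCLM_apply_apply (hasTemperateGrowth_phasePairing v) F X
  rw [← hG]
  refine superPairing_fderiv hM hΦ F _ (fibreEmb v) fun X => ?_
  rw [hG]
  simp

/-! ### Fourier inversion in the fibre -/

/-- The map `w ↦ 2π(-w_L, w_R)`, which turns the pairing of the super Weyl transform into the
phase of Mathlib's Fourier transform. -/
def dualPoint : PosPair d →L[ℝ] PosPair d :=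
  ((-(2 * Real.pi)) • ContinuousLinearMap.fst ℝ (Pos d) (Pos d)).prod
    ((2 * Real.pi) • ContinuousLinearMap.snd ℝ (Pos d) (Pos d))

lemma phasePairing_dualPoint (w v : PosPair d) :
    phasePairing (dualPoint w) v = -2 * Real.pi * (inner ℝ v.1 w.1 + inner ℝ v.2 w.2) := by
  have h : phasePairing (dualPoint w) v
      = inner ℝ ((-(2 * Real.pi)) • w.1) v.1 - inner ℝ ((2 * Real.pi) • w.2) v.2 := rfl
  rw [h, real_inner_smul_left, real_inner_smul_left, real_inner_comm v.1, real_inner_comm v.2]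
  ring

lemma japaneseSq_le_dualPoint (w : PosPair d) : japaneseSq w ≤ japaneseSq (dualPoint w) := by
  have h1 : (dualPoint w).1 = (-(2 * Real.pi)) • w.1 := rfl
  have h2 : (dualPoint w).2 = (2 * Real.pi) • w.2 := rfl
  unfold japaneseSq
  rw [h1, h2, norm_smul, norm_smul, mul_pow, mul_pow, norm_neg, Real.norm_eq_abs, sq_abs]
  have : (1 : ℝ) ≤ (2 * Real.pi) ^ 2 := by nlinarith [Real.pi_gt_three]
  nlinarith [sq_nonneg ‖w.1‖, sq_nonneg ‖w.2‖]

/-- Fourier inversion on `ℝ^{2d}`, in terms of the pairing of the super Weyl transform. -/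
lemma fourier_inversion_phasePairing {c : PosPair d → ℂ} (hc : Continuous c) (hi : Integrable c)
    (hi' : Integrable fun w : PosPair d =>
      ∫ u, Complex.exp (Complex.I * (phasePairing (dualPoint w) u : ℝ)) * c u) (v : PosPair d) :
    ∫ w : PosPair d, Complex.exp (Complex.I * ((-phasePairing (dualPoint w) v : ℝ) : ℂ)) *
      ∫ u, Complex.exp (Complex.I * (phasePairing (dualPoint w) u : ℝ)) * c u = c v := by
  let f : WithLp 2 (PosPair d) → ℂ := fun x => c (WithLp.ofLp x)
  have hmp := WithLp.volume_preserving_ofLp (Pos d) (Pos d)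
  have hme : MeasurableEmbedding (@WithLp.ofLp 2 (PosPair d)) :=
    (MeasurableEquiv.toLp 2 (PosPair d)).symm.measurableEmbedding
  have hinner : ∀ x y : WithLp 2 (PosPair d), inner ℝ x y
      = inner ℝ (WithLp.ofLp x).1 (WithLp.ofLp y).1
        + inner ℝ (WithLp.ofLp x).2 (WithLp.ofLp y).2 := fun x y => rfl
  have hF : ∀ w : WithLp 2 (PosPair d), FourierTransform.fourier f w
      = ∫ u, Complex.exp (Complex.I * (phasePairing (dualPoint (WithLp.ofLp w)) u : ℝ)) * c u := by
    intro w
    rw [Real.fourier_eq', ← hmp.integral_comp hme]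
    refine integral_congr_ae (Eventually.of_forall fun x => ?_)
    simp only [phasePairing_dualPoint, smul_eq_mul, f, hinner]
    rw [mul_comm Complex.I]
  have hfc : Continuous f := hc.comp (WithLp.prod_continuous_ofLp 2 _ _)
  have hfi : Integrable f := hmp.integrable_comp_of_integrable hi
  have hfi' : Integrable (FourierTransform.fourier f) := by
    have := hmp.integrable_comp_of_integrable hi'
    exact this.congr (Eventually.of_forall fun w => (hF w).symm)
  have key := congrFun (hfc.fourierInv_fourier_eq hfi hfi') (WithLp.toLp 2 v)
  rw [Real.fourierInv_eq'] at key
  rw [← hmp.integral_comp hme]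
  refine Eq.trans (integral_congr_ae (Eventually.of_forall fun w => ?_)) key
  simp only [smul_eq_mul, hF, phasePairing_dualPoint, hinner]
  congr 2
  rw [mul_comm Complex.I]
  congr 2
  rw [real_inner_comm v.1, real_inner_comm v.2]
  ring

/-! ### Fibre multipliers -/

lemma norm_iteratedFDeriv_comp_affine_le {E E' F : Type*} [NormedAddCommGroup E] [NormedSpace ℝ E]
    [NormedAddCommGroup E'] [NormedSpace ℝ E'] [NormedAddCommGroup F] [NormedSpace ℝ F]
    {f : E → F} (hf : ContDiff ℝ ∞ f) (L : E' →L[ℝ] E) (a : E) (n : ℕ) (x : E') :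
    ‖iteratedFDeriv ℝ n (fun x => f (L x + a)) x‖
      ≤ ‖iteratedFDeriv ℝ n f (L x + a)‖ * ‖L‖ ^ n := by
  have hg : ContDiff ℝ ∞ (fun y => f (y + a)) := hf.comp (contDiff_id.add contDiff_const)
  have h : iteratedFDeriv ℝ n (fun x => f (L x + a)) x
      = (iteratedFDeriv ℝ n (fun y => f (y + a)) (L x)).compContinuousLinearMap fun _ => L :=
    L.iteratedFDeriv_comp_right hg x (i := n) (by exact_mod_cast le_top)
  rw [h, iteratedFDeriv_comp_add_right]
  refine (ContinuousMultilinearMap.norm_compContinuousLinearMap_le _ _).trans ?_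
  simp

lemma norm_iteratedFDeriv_const_mul_le {E : Type*} [NormedAddCommGroup E] [NormedSpace ℝ E]
    {f : E → ℂ} (hf : ContDiff ℝ ∞ f) (z : ℂ) (n : ℕ) (x : E) :
    ‖iteratedFDeriv ℝ n (fun x => z * f x) x‖ ≤ ‖z‖ * ‖iteratedFDeriv ℝ n f x‖ := by
  have h := (ContinuousLinearMap.mul ℝ ℂ z).norm_iteratedFDeriv_comp_left (N := ∞) (n := n)
    (hf.contDiffAt (x := x)) (by exact_mod_cast le_top)
  refine h.trans (mul_le_mul_of_nonneg_right ?_ (norm_nonneg _))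
  exact ContinuousLinearMap.opNorm_mul_apply_le ℝ ℂ z

/-- The partial Fourier transform is smooth in the base variables, with bounds uniform in the dual
fibre variable. -/
lemma IsSymbol.fibreFourier_base {c : SuperPhase d → ℂ} (hc : IsSymbol fibreWeight c) :
    (∀ η, ContDiff ℝ ∞ (fun X => fibreFourier c (assemble (basePart X) η))) ∧
    ∀ n : ℕ, ∃ C : ℝ, 0 ≤ C ∧ ∀ η X,
      ‖iteratedFDeriv ℝ n (fun X => fibreFourier c (assemble (basePart X) η)) X‖ ≤ C := by
  choose C hC0 hC using hc.bound_pos fibreWeight_nonneg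
  set P : SuperPhase d →L[ℝ] SuperPhase d := baseEmb.comp basePart
  have hass : ∀ (v : PosPair d) (X : SuperPhase d),
      assemble (basePart X) v = P X + fibreEmb v := fun v X => assemble_eq _ _
  have hsm : ∀ v : PosPair d, ContDiff ℝ ∞ (fun X => c (assemble (basePart X) v)) := by
    intro v
    simp only [hass]
    exact hc.contDiff.comp (P.contDiff.add contDiff_const)
  have hb : ∀ (η : PosPair d) (n : ℕ) (v : PosPair d) (X : SuperPhase d),
      ‖iteratedFDeriv ℝ n (fun X => Complex.exp (Complex.I * (phasePairing η v : ℝ)) *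
        c (assemble (basePart X) v)) X‖ ≤
      C n * ‖P‖ ^ n * (japaneseSq v ^ (d + 1))⁻¹ * (fun _ : SuperPhase d => (1 : ℝ)) X := by
    intro η n v X
    refine (norm_iteratedFDeriv_const_mul_le (hsm v) _ n X).trans ?_
    rw [norm_exp_I_mul, one_mul, mul_one]
    simp only [hass]
    refine (norm_iteratedFDeriv_comp_affine_le hc.contDiff P (fibreEmb v) n X).trans ?_
    have h := hC n (P X + fibreEmb v)
    have hw : fibreWeight (P X + fibreEmb v) = (japaneseSq v ^ (d + 1))⁻¹ := by
      rw [← hass]; rfl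
    rw [hw] at h
    calc _ ≤ C n * (japaneseSq v ^ (d + 1))⁻¹ * ‖P‖ ^ n := by gcongr
      _ = _ := by ring
  have hfam : ∀ η : PosPair d, IsIntegrableFamily (volume : Measure (PosPair d)) (fun _ => 1)
      (fun v X => Complex.exp (Complex.I * (phasePairing η v : ℝ)) *
        c (assemble (basePart X) v)) := by
    intro η
    refine ⟨fun X => (hc.fibreIntegrable.integrable_mul _ η).aestronglyMeasurable,
      Eventually.of_forall fun v => contDiff_const.mul (hsm v), fun n => ?_⟩
    exact ⟨_, integrable_inv_japaneseSq_pow.const_mul (C n * ‖P‖ ^ n),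
      Eventually.of_forall fun v X => hb η n v X⟩
  have hloc : ∀ z : SuperPhase d, ∃ K : ℝ, ∀ᶠ z' in 𝓝 z, (fun _ => (1 : ℝ)) z' ≤ K :=
    fun z => ⟨1, by simp⟩
  refine ⟨fun η => ((hfam η).isSymbol_integral (by simp) hloc).contDiff, fun n => ?_⟩
  refine ⟨C n * ‖P‖ ^ n * fibreMass d, ?_, fun η X => ?_⟩
  · have := hC0 n
    have := fibreMass_nonneg (d := d)
    positivity
  · have := ((hfam η).contDiff_integral_and_norm_le (by simp) hloc n).2 _
      (integrable_inv_japaneseSq_pow.const_mul (C n * ‖P‖ ^ n))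
      (Eventually.of_forall fun v X => hb η n v X) X
    rw [integral_const_mul, mul_one] at this
    exact this

/-- The partial Fourier transform of a function of class `⟨v⟩^{-2(d+1)}` decays faster than any
power in the dual fibre variable, together with its derivatives in the base variables. -/
lemma IsSymbol.norm_iteratedFDeriv_fibreFourier_base_le {c : SuperPhase d → ℂ}
    (hc : IsSymbol fibreWeight c) (K n : ℕ) : ∃ C : ℝ, 0 ≤ C ∧ ∀ η X,
      ‖iteratedFDeriv ℝ n (fun X => fibreFourier c (assemble (basePart X) η)) X‖
        ≤ C * (japaneseSq η ^ K)⁻¹ := by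
  have hK := hc.fibreLap_iterate K
  obtain ⟨hsm, hb⟩ := hK.fibreFourier_base
  obtain ⟨C, hC0, hC⟩ := hb n
  refine ⟨C, hC0, fun η X => ?_⟩
  have hp := pow_pos (japaneseSq_pos η) K
  have heq : (fun X => fibreFourier c (assemble (basePart X) η)) = fun X : SuperPhase d =>
      (((japaneseSq η ^ K)⁻¹ : ℝ) : ℂ) *
        fibreFourier (MagneticSuper.fibreLap^[K] c) (assemble (basePart X) η) := by
    ext X
    rw [hc.fibreFourier_fibreLap_iterate, fibrePart_assemble, ← mul_assoc]
    have : ((japaneseSq η ^ K : ℝ) : ℂ) ≠ 0 := by exact_mod_cast hp.ne'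
    push_cast at this ⊢
    rw [inv_mul_cancel₀ this, one_mul]
  rw [heq]
  refine (norm_iteratedFDeriv_const_mul_le (hsm η) _ n X).trans ?_
  rw [Complex.norm_real, Real.norm_of_nonneg (inv_nonneg.2 hp.le), mul_comm]
  exact mul_le_mul_of_nonneg_right (hC η X) (inv_nonneg.2 hp.le)

lemma IsSymbol.norm_fibreFourier_base_le {c : SuperPhase d → ℂ}
    (hc : IsSymbol fibreWeight c) (K : ℕ) : ∃ C : ℝ, 0 ≤ C ∧ ∀ q η,
      ‖fibreFourier c (assemble q η)‖ ≤ C * (japaneseSq η ^ K)⁻¹ := by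
  obtain ⟨C, hC0, hC⟩ := hc.norm_iteratedFDeriv_fibreFourier_base_le K 0
  exact ⟨C, hC0, fun q η => by simpa using hC η (baseEmb q)⟩

lemma inv_japaneseSq_dualPoint_pow_le (w : PosPair d) (K : ℕ) :
    (japaneseSq (dualPoint w) ^ K)⁻¹ ≤ (japaneseSq w ^ K)⁻¹ :=
  inv_anti₀ (pow_pos (japaneseSq_pos w) K)
    (pow_le_pow_left₀ (japaneseSq_pos w).le (japaneseSq_le_dualPoint w) K)

lemma continuous_assemble_dualPoint :
    Continuous (fun p : SuperPhase d × PosPair d => assemble (basePart p.1) (dualPoint p.2)) := by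
  unfold assemble; fun_prop

lemma IsSymbol.integrable_fibreFourier_dualPoint {c : SuperPhase d → ℂ}
    (hc : IsSymbol fibreWeight c) (q : PosPair d) :
    Integrable (fun w => fibreFourier c (assemble q (dualPoint w))) := by
  obtain ⟨C, hC0, hC⟩ := hc.norm_fibreFourier_base_le (d + 1)
  refine (integrable_inv_japaneseSq_pow.const_mul C).mono'
    (hc.fibreIntegrable.continuous_fibreFourier.comp
      (continuous_assemble_dualPoint.comp
        (Continuous.prodMk_right (baseEmb q)))).aestronglyMeasurable
    (Eventually.of_forall fun w => (hC q _).trans ?_)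
  exact mul_le_mul_of_nonneg_left (inv_japaneseSq_dualPoint_pow_le w _) hC0

/-- The partial Fourier transform turns a product into a convolution. -/
lemma IsSymbol.fibreFourier_mul {c : SuperPhase d → ℂ} (hc : IsSymbol fibreWeight c)
    (F : SuperSchw d) (X : SuperPhase d) :
    fibreFourier (fun Y => c Y * F Y) X = ∫ w, fibreFourier c (assemble (basePart X) (dualPoint w))
      * fibreFourier F (X - fibreEmb (dualPoint w)) := by
  have hF := (isSymbol_schwartz F).fibreIntegrable
  have hinv : ∀ v, ∫ w, Complex.exp (Complex.I * ((-phasePairing (dualPoint w) v : ℝ) : ℂ)) *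
      fibreFourier c (assemble (basePart X) (dualPoint w)) = c (assemble (basePart X) v) := by
    intro v
    refine fourier_inversion_phasePairing (c := fun v => c (assemble (basePart X) v)) ?_
      (hc.fibreIntegrable.integrable _) (hc.integrable_fibreFourier_dualPoint (basePart X)) v
    exact hc.contDiff.continuous.comp
      (continuous_assemble.comp (Continuous.prodMk_right (basePart X)))
  have hshift : ∀ w v, Complex.exp (Complex.I * (phasePairing (fibrePart X) v : ℝ)) *
      Complex.exp (Complex.I * ((-phasePairing (dualPoint w) v : ℝ) : ℂ))
      = Complex.exp (Complex.I *
        (phasePairing (fibrePart (X - fibreEmb (dualPoint w))) v : ℝ)) := by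
    intro w v
    have : phasePairing (fibrePart X - dualPoint w) v
        = phasePairing (fibrePart X) v + -phasePairing (dualPoint w) v := by
      rw [sub_eq_add_neg, phasePairing_add_left, ← neg_one_smul ℝ, phasePairing_smul_left]
      ring
    rw [map_sub, fibrePart_fibreEmb, this, ← Complex.exp_add]
    congr 1
    push_cast
    ring
  have hint : Integrable (fun p : PosPair d × PosPair d =>
      Complex.exp (Complex.I * (phasePairing (fibrePart (X - fibreEmb (dualPoint p.2))) p.1 : ℝ)) *
        F (assemble (basePart X) p.1) * fibreFourier c (assemble (basePart X) (dualPoint p.2)))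
      (volume.prod volume) := by
    refine ((hF.integrable (basePart X)).norm.mul_prod
      (hc.integrable_fibreFourier_dualPoint (basePart X)).norm).mono' ?_
      (Eventually.of_forall fun p => ?_)
    · have h1 := F.continuous
      have h2 := hc.fibreIntegrable.continuous_fibreFourier
      refine Continuous.aestronglyMeasurable ?_
      unfold assemble phasePairing
      fun_prop
    · rw [norm_mul, norm_mul, norm_exp_I_mul, one_mul]
  calc fibreFourier (fun Y => c Y * F Y) X
      = ∫ v, ∫ w, Complex.exp (Complex.I *
          (phasePairing (fibrePart (X - fibreEmb (dualPoint w))) v : ℝ)) *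
          F (assemble (basePart X) v) * fibreFourier c (assemble (basePart X) (dualPoint w)) := by
        refine integral_congr_ae (Eventually.of_forall fun v => ?_)
        simp only
        rw [← hinv v, ← integral_mul_const, ← integral_const_mul]
        refine integral_congr_ae (Eventually.of_forall fun w => ?_)
        simp only [← hshift w v]
        ring
    _ = ∫ w, ∫ v, Complex.exp (Complex.I *
          (phasePairing (fibrePart (X - fibreEmb (dualPoint w))) v : ℝ)) *
          F (assemble (basePart X) v) * fibreFourier c (assemble (basePart X) (dualPoint w)) :=
        integral_integral_swap hint
    _ = _ := by
        refine integral_congr_ae (Eventually.of_forall fun w => ?_)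
        simp only
        rw [integral_mul_const, mul_comm]
        simp only [fibreFourier, map_sub, basePart_fibreEmb, sub_zero]

lemma superSq_fibreEmb (v : PosPair d) : superSq (fibreEmb v) = japaneseSq v := by
  simp [superSq, japaneseSq]

/-- Multiplying the Schwartz functions by a function of class `⟨v⟩^{-2(d+1)}` amounts to convolving
the symbol with a rapidly decreasing kernel in the fibre variables, which preserves the symbol
class of any tempered weight. -/
lemma exists_symbol_of_fibreWeight_mul {M : SuperPhase d → ℝ} (hM : IsTemperedWeight M)
    {Φ : SuperPhase d → ℂ} (hΦ : IsSymbol M Φ) {c : SuperPhase d → ℂ}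
    (hc : IsSymbol fibreWeight c) : ∃ Ψ : SuperPhase d → ℂ, IsSymbol M Ψ ∧
      ∀ F : SuperSchw d, superPairing Φ (fun X => c X * F X) = superPairing Ψ F := by
  obtain ⟨A, K, hK0, hK⟩ := hM.exists_le_superSq
  have hK' : ∀ X (v : PosPair d), M (X + fibreEmb v) ≤ K * M X * japaneseSq v ^ A := by
    intro X v
    simpa only [superSq_fibreEmb] using hK X (fibreEmb v)
  have hcc := hc.fibreIntegrable.continuous_fibreFourier
  have hΦc := hΦ.contDiff.continuous
  let k : PosPair d → SuperPhase d → ℂ :=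
    fun w X => fibreFourier c (assemble (basePart X) (dualPoint w))
  have hk : Continuous (fun p : SuperPhase d × PosPair d => k p.2 p.1) :=
    hcc.comp continuous_assemble_dualPoint
  have hksm : ∀ w, ContDiff ℝ ∞ (k w) := fun w => hc.fibreFourier_base.1 (dualPoint w)
  let G : PosPair d → SuperPhase d → ℂ := fun w X => k w X * Φ (X + fibreEmb (dualPoint w))
  have hΦsm : ∀ w : PosPair d, ContDiff ℝ ∞ (fun X => Φ (X + fibreEmb (dualPoint w))) :=
    fun w => hΦ.contDiff.comp (contDiff_id.add contDiff_const)
  -- The power `A` absorbs the growth of the weight, and `d + 1` makes the bound integrable.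
  choose C hC0 hC using hc.norm_iteratedFDeriv_fibreFourier_base_le (A + (d + 1))
  choose D hD0 hD using hΦ.bound_pos hM.nonneg
  have hprod : ∀ (a b : ℝ) (w : PosPair d) (X : SuperPhase d), 0 ≤ a → 0 ≤ b →
      a * (japaneseSq (dualPoint w) ^ (A + (d + 1)))⁻¹ * (b * M (X + fibreEmb (dualPoint w)))
        ≤ a * b * K * (japaneseSq w ^ (d + 1))⁻¹ * M X := by
    intro a b w X ha hb
    have hp := japaneseSq_pos (dualPoint w)
    have hMX := hM.nonneg X
    calc a * (japaneseSq (dualPoint w) ^ (A + (d + 1)))⁻¹ * (b * M (X + fibreEmb (dualPoint w)))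
        ≤ a * (japaneseSq (dualPoint w) ^ (A + (d + 1)))⁻¹ *
          (b * (K * M X * japaneseSq (dualPoint w) ^ A)) := by
          gcongr
          exact hK' X _
      _ = a * b * K * M X * (japaneseSq (dualPoint w) ^ (d + 1))⁻¹ *
          ((japaneseSq (dualPoint w) ^ A)⁻¹ * japaneseSq (dualPoint w) ^ A) := by
          rw [pow_add, mul_inv]; ring
      _ = a * b * K * M X * (japaneseSq (dualPoint w) ^ (d + 1))⁻¹ := by
          rw [inv_mul_cancel₀ (pow_pos hp A).ne', mul_one]
      _ ≤ a * b * K * M X * (japaneseSq w ^ (d + 1))⁻¹ := by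
          gcongr ?_ * ?_
          exact inv_japaneseSq_dualPoint_pow_le w _
      _ = _ := by ring
  have hfam : IsIntegrableFamily (volume : Measure (PosPair d)) M G := by
    refine ⟨fun X => ?_, Eventually.of_forall fun w => (hksm w).mul (hΦsm w), fun n => ?_⟩
    · refine Continuous.aestronglyMeasurable ?_
      exact (hk.comp (Continuous.prodMk_right X)).mul (hΦc.comp (by fun_prop))
    · refine ⟨fun w => (∑ i ∈ Finset.range (n + 1), (n.choose i : ℝ) * (C i * D (n - i) * K)) *
        (japaneseSq w ^ (d + 1))⁻¹, integrable_inv_japaneseSq_pow.const_mul _,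
        Eventually.of_forall fun w X => ?_⟩
      refine (norm_iteratedFDeriv_mul_le (hksm w) (hΦsm w) X (n := n)
        (by exact_mod_cast le_top)).trans ?_
      beta_reduce
      rw [Finset.sum_mul, Finset.sum_mul]
      refine Finset.sum_le_sum fun i _ => ?_
      have h1 := hC i (dualPoint w) X
      have h2 : ‖iteratedFDeriv ℝ (n - i) (fun X => Φ (X + fibreEmb (dualPoint w))) X‖
          ≤ D (n - i) * M (X + fibreEmb (dualPoint w)) := by
        rw [iteratedFDeriv_comp_add_right]
        exact hD _ _
      calc _ ≤ (n.choose i : ℝ) * (C i * (japaneseSq (dualPoint w) ^ (A + (d + 1)))⁻¹ *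
              (D (n - i) * M (X + fibreEmb (dualPoint w)))) := by
            rw [mul_assoc]
            have := hC0 i
            have := (japaneseSq_pos (dualPoint w)).le
            gcongr
        _ ≤ (n.choose i : ℝ) * (C i * D (n - i) * K * (japaneseSq w ^ (d + 1))⁻¹ * M X) := by
            exact mul_le_mul_of_nonneg_left (hprod _ _ w X (hC0 i) (hD0 _)) (Nat.cast_nonneg _)
        _ = _ := by ring
  refine ⟨fun X => ∫ w, G w X, hfam.isSymbol_integral hM.nonneg hM.locally_bounded, fun F => ?_⟩
  have hFc := continuous_fibreFourier F
  let H₁ : SuperPhase d × PosPair d → ℂ := fun p =>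
    Φ p.1 * (k p.2 p.1 * fibreFourier F (p.1 - fibreEmb (dualPoint p.2)))
  let H₂ : SuperPhase d × PosPair d → ℂ := fun p => G p.2 p.1 * fibreFourier F p.1
  have hH₁c : Continuous H₁ := by fun_prop
  have hH₂c : Continuous H₂ := by fun_prop
  have hshift : ∀ w X, H₁ (X + fibreEmb (dualPoint w), w) = H₂ (X, w) := by
    intro w X
    simp only [H₁, H₂, G, k, map_add, basePart_fibreEmb, add_zero, add_sub_cancel_right]
    ring
  have hH₂ : Integrable H₂ (volume.prod volume) := by
    obtain ⟨T, hT⟩ := exists_norm_fibreFourier_le (d := d) (A + (2 * d + 1))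
    set S : ℝ := SchwartzMap.seminorm ℂ 0 0 (T F) * fibreMass d
    have hS : 0 ≤ S := mul_nonneg (apply_nonneg _ _) fibreMass_nonneg
    refine ((integrable_inv_japaneseSq_mul_pow.const_mul (C 0 * D 0 * K * (K * M 0) * S)).mul_prod
      integrable_inv_japaneseSq_pow).mono' hH₂c.aestronglyMeasurable
      (Eventually.of_forall fun p => ?_)
    obtain ⟨X, w⟩ := p
    have hp := superSq_pos X
    have hM0 : M X ≤ K * M 0 * superSq X ^ A := by simpa using hK 0 X
    have h1 : ‖G w X‖ ≤ C 0 * D 0 * K * (japaneseSq w ^ (d + 1))⁻¹ * M X := by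
      refine le_trans ?_ (hprod _ _ w X (hC0 0) (hD0 0))
      rw [norm_mul]
      have h3 : ‖k w X‖ ≤ C 0 * (japaneseSq (dualPoint w) ^ (A + (d + 1)))⁻¹ := by
        simpa using hC 0 (dualPoint w) X
      have h4 : ‖Φ (X + fibreEmb (dualPoint w))‖ ≤ D 0 * M (X + fibreEmb (dualPoint w)) := by
        simpa using hD 0 (X + fibreEmb (dualPoint w))
      have := hC0 0
      have := (japaneseSq_pos (dualPoint w)).le
      gcongr
    have hC00 := hC0 0
    have hD00 := hD0 0
    have hJ := (japaneseSq_pos w).le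
    calc ‖H₂ (X, w)‖ = ‖G w X‖ * ‖fibreFourier F X‖ := norm_mul _ _
      _ ≤ (C 0 * D 0 * K * (japaneseSq w ^ (d + 1))⁻¹ * (K * M 0 * superSq X ^ A)) *
          (S * (superSq X ^ (A + (2 * d + 1)))⁻¹) := by
          have := hM.nonneg 0
          exact mul_le_mul (h1.trans (by gcongr)) (hT F X) (norm_nonneg _) (by positivity)
      _ = C 0 * D 0 * K * (K * M 0) * S * (superSq X ^ (2 * d + 1))⁻¹ *
          (japaneseSq w ^ (d + 1))⁻¹ * (superSq X ^ A * (superSq X ^ A)⁻¹) := by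
          rw [pow_add (superSq X), mul_inv]; ring
      _ = _ := by rw [mul_inv_cancel₀ (pow_pos hp A).ne', mul_one]; rfl
  have hH₁ : Integrable H₁ (volume.prod volume) := by
    rw [integrable_prod_iff' hH₁c.aestronglyMeasurable]
    obtain ⟨h1, h2⟩ := (integrable_prod_iff' hH₂c.aestronglyMeasurable).1 hH₂
    constructor
    · filter_upwards [h1] with w hw
      have : Integrable (fun X => H₁ (X + fibreEmb (dualPoint w), w)) := by
        simpa only [hshift] using hw
      simpa using this.comp_sub_right (fibreEmb (dualPoint w))
    · refine h2.congr (Eventually.of_forall fun w => ?_)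
      simp only [← hshift]
      exact integral_add_right_eq_self (fun X => ‖H₁ (X, w)‖) (fibreEmb (dualPoint w))
  calc superPairing Φ (fun X => c X * F X) = ∫ X, ∫ w, H₁ (X, w) := by
        refine integral_congr_ae (Eventually.of_forall fun X => ?_)
        simp only [H₁]
        rw [hc.fibreFourier_mul F X, integral_const_mul]
    _ = ∫ w, ∫ X, H₁ (X, w) := integral_integral_swap hH₁
    _ = ∫ w, ∫ X, H₂ (X, w) := by
        refine integral_congr_ae (Eventually.of_forall fun w => ?_)
        simp only [← hshift]
        exact (integral_add_right_eq_self (fun X => H₁ (X, w)) (fibreEmb (dualPoint w))).symm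
    _ = ∫ X, ∫ w, H₂ (X, w) := (integral_integral_swap hH₂).symm
    _ = _ := by
        refine integral_congr_ae (Eventually.of_forall fun X => ?_)
        simp only [H₂]
        rw [integral_mul_const]

/-- Multiplication by `1 + |v|²` corresponds to `1 - Δ` in the fibre variables of the symbol. -/
lemma superPairing_japaneseSq_mul {M : SuperPhase d → ℝ} (hM : IsTemperedWeight M)
    {Φ : SuperPhase d → ℂ} (hΦ : IsSymbol M Φ) (F : SuperSchw d) :
    superPairing Φ (fun X => (japaneseSq (fibrePart X) : ℝ) * F X)
      = superPairing (fibreLap Φ) F := by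
  let m : PosPair d → SuperSchw d →L[ℂ] SuperSchw d := fun e => SchwartzMap.smulLeftCLM ℂ
    (fun X : SuperPhase d => Complex.I * (phasePairing e (fibrePart X) : ℝ))
  have hm : ∀ e (F : SuperSchw d), ⇑(m e F)
      = fun X => Complex.I * (phasePairing e (fibrePart X) : ℝ) * F X := fun e F =>
    funext fun X => SchwartzMap.smulLeftCLM_apply_apply (hasTemperateGrowth_phasePairing e) F X
  let e : Fin d ⊕ Fin d → SuperPhase d := fun i => fibreEmb (pairBasis i)
  have hP := hΦ.polyBounded hM
  have h2 : ∀ i, superPairing Φ (m (pairBasis i) (m (pairBasis i) F))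
      = superPairing (fun X => fderiv ℝ (fun Y => fderiv ℝ Φ Y (e i)) X (e i)) F := by
    intro i
    rw [hm, superPairing_phase_mul hM hΦ, hm,
      superPairing_phase_mul hM (hΦ.fderiv_apply _), neg_neg]
  have hJ : (fun X => (japaneseSq (fibrePart X) : ℝ) * F X)
      = ⇑(F - ∑ i, m (pairBasis i) (m (pairBasis i) F)) := by
    ext X
    have : ∀ i, (m (pairBasis i) (m (pairBasis i) F)) X
        = -((phasePairing (pairBasis i) (fibrePart X) ^ 2 : ℝ) : ℂ) * F X := fun i => by
      rw [hm, hm]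
      push_cast
      linear_combination (phasePairing (pairBasis i) (fibrePart X) : ℂ) ^ 2 * F X * Complex.I_sq
    rw [sub_apply, sum_apply, Finset.sum_congr rfl fun i _ => this i, ← Finset.sum_mul,
      Finset.sum_neg_distrib, ← Complex.ofReal_sum, sum_phasePairing_pairBasis_sq', japaneseSq]
    push_cast
    ring
  have hint : ∀ i ∈ Finset.univ, Integrable (fun X =>
      fderiv ℝ (fun Y => fderiv ℝ Φ Y (e i)) X (e i) * fibreFourier F X) :=
    fun i _ => (((hΦ.fderiv_apply (e i)).fderiv_apply (e i)).polyBounded hM).integrable_mul F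
  rw [hJ]
  change hP.pairingCLM _ = _
  rw [map_sub, map_sum]
  have hR : superPairing (fibreLap Φ) F = superPairing Φ F
      - ∑ i, superPairing (fun X => fderiv ℝ (fun Y => fderiv ℝ Φ Y (e i)) X (e i)) F := by
    unfold superPairing fibreLap
    rw [← integral_finsetSum _ hint, ← integral_sub (hP.integrable_mul F)
      (integrable_finsetSum _ hint)]
    simp only [sub_mul, Finset.sum_mul, e]
  rw [hR, ← Finset.sum_congr rfl fun i _ => h2 i]
  rfl

lemma superPairing_japaneseSq_pow_mul {M : SuperPhase d → ℝ} (hM : IsTemperedWeight M)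
    {Φ : SuperPhase d → ℂ} (hΦ : IsSymbol M Φ) (F : SuperSchw d) (N : ℕ) :
    superPairing Φ (fun X => ((japaneseSq (fibrePart X) ^ N : ℝ) : ℂ) * F X)
      = superPairing (fibreLap^[N] Φ) F := by
  induction N generalizing Φ with
  | zero => simp
  | succ N ih =>
    rw [Function.iterate_succ_apply, ← ih hΦ.fibreLap]
    let G : SuperSchw d := SchwartzMap.smulLeftCLM ℂ
      (fun X => ((japaneseSq (fibrePart X) ^ N : ℝ) : ℂ)) F
    have hG : ⇑G = fun X => ((japaneseSq (fibrePart X) ^ N : ℝ) : ℂ) * F X := funext fun X =>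
      SchwartzMap.smulLeftCLM_apply_apply (hasTemperateGrowth_fibrePart_pow N) F X
    rw [← hG, ← superPairing_japaneseSq_mul hM hΦ G, hG]
    congr 1
    ext X
    push_cast
    ring

/-- Multiplying the Schwartz functions by a function all of whose derivatives are bounded
corresponds to an operator on symbols which preserves the class of any tempered weight. -/
lemma exists_symbol_of_bounded_mul {M : SuperPhase d → ℝ} (hM : IsTemperedWeight M)
    {Φ : SuperPhase d → ℂ} (hΦ : IsSymbol M Φ) {b : SuperPhase d → ℂ}
    (hb : IsSymbol (fun _ => 1) b) : ∃ Ψ : SuperPhase d → ℂ, IsSymbol M Ψ ∧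
      ∀ F : SuperSchw d, superPairing Φ (fun X => b X * F X) = superPairing Ψ F := by
  have hc : IsSymbol fibreWeight
      (fun X : SuperPhase d => b X * (((japaneseSq (fibrePart X) ^ (d + 1))⁻¹ : ℝ) : ℂ)) := by
    have h := IsSymbol.mul (fun _ => zero_le_one) fibreWeight_nonneg hb
      ((isSymbol_inv_japaneseSq_pow (d := d) (d + 1)).clm_comp Complex.ofRealCLM)
    simpa using h
  -- `b F = c G` with `c = b ⟨v⟩^{-2(d+1)}` and `G = ⟨v⟩^{2(d+1)} F`; the factor `c` acts on the
  -- symbol by a convolution, and the polynomial in `G` by a power of `1 - Δ`.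
  obtain ⟨Ψ, hΨ, h⟩ := exists_symbol_of_fibreWeight_mul hM hΦ hc
  refine ⟨fibreLap^[d + 1] Ψ, hΨ.fibreLap_iterate _, fun F => ?_⟩
  let G : SuperSchw d := SchwartzMap.smulLeftCLM ℂ
    (fun X => ((japaneseSq (fibrePart X) ^ (d + 1) : ℝ) : ℂ)) F
  have hG : ⇑G = fun X => ((japaneseSq (fibrePart X) ^ (d + 1) : ℝ) : ℂ) * F X := funext fun X =>
    SchwartzMap.smulLeftCLM_apply_apply (hasTemperateGrowth_fibrePart_pow (d + 1)) F X
  rw [← superPairing_japaneseSq_pow_mul hM hΨ F, ← hG, ← h G, hG]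
  congr 1
  ext X
  have : ((japaneseSq (fibrePart X) ^ (d + 1) : ℝ) : ℂ) ≠ 0 := by
    exact_mod_cast (pow_pos (japaneseSq_pos (fibrePart X)) _).ne'
  rw [mul_assoc, ← mul_assoc _ _ (F X), Complex.ofReal_inv, inv_mul_cancel₀ this, one_mul]

/-! ### Tensor products of Schwartz functions -/

lemma norm_pow_le_add {E F : Type*} [SeminormedAddCommGroup E] [SeminormedAddCommGroup F]
    (k : ℕ) (z : E × F) : ‖z‖ ^ k ≤ ‖z.1‖ ^ k + ‖z.2‖ ^ k := by
  have h1 : 0 ≤ ‖z.1‖ ^ k := by positivity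
  have h2 : 0 ≤ ‖z.2‖ ^ k := by positivity
  rcases max_cases ‖z.1‖ ‖z.2‖ with h | h <;> rw [Prod.norm_def, h.1] <;> linarith

section Tensor

variable {E F : Type*} [NormedAddCommGroup E] [NormedSpace ℝ E]
  [NormedAddCommGroup F] [NormedSpace ℝ F]

/-- A bound for the seminorms of `f ⊗ g`. -/
def tensorBound (k n : ℕ) (f : 𝓢(E, ℂ)) (g : 𝓢(F, ℂ)) : ℝ :=
  ∑ i ∈ Finset.range (n + 1), (n.choose i : ℝ) *
    (SchwartzMap.seminorm ℂ k i f * SchwartzMap.seminorm ℂ 0 (n - i) g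
      + SchwartzMap.seminorm ℂ 0 i f * SchwartzMap.seminorm ℂ k (n - i) g)

lemma norm_iteratedFDeriv_comp_contraction_le {G : Type*} [NormedAddCommGroup G] [NormedSpace ℝ G]
    {f : E → ℂ} (hf : ContDiff ℝ ∞ f) (L : G →L[ℝ] E) (hL : ‖L‖ ≤ 1) (n : ℕ) (x : G) :
    ‖iteratedFDeriv ℝ n (fun x => f (L x)) x‖ ≤ ‖iteratedFDeriv ℝ n f (L x)‖ := by
  have h := norm_iteratedFDeriv_comp_affine_le hf L 0 n x
  simp only [add_zero] at h
  refine h.trans (mul_le_of_le_one_right (norm_nonneg _) (pow_le_one₀ (norm_nonneg _) hL))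

lemma tensor_decay (f : 𝓢(E, ℂ)) (g : 𝓢(F, ℂ)) (k n : ℕ) (z : E × F) :
    ‖z‖ ^ k * ‖iteratedFDeriv ℝ n (fun z : E × F => f z.1 * g z.2) z‖ ≤ tensorBound k n f g := by
  have hf : ContDiff ℝ ∞ (fun z : E × F => f z.1) := (f.smooth ⊤).comp contDiff_fst
  have hg : ContDiff ℝ ∞ (fun z : E × F => g z.2) := (g.smooth ⊤).comp contDiff_snd
  have h := norm_iteratedFDeriv_mul_le hf hg z (n := n) (by exact_mod_cast le_top)
  refine (mul_le_mul_of_nonneg_left h (by positivity)).trans ?_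
  rw [Finset.mul_sum, tensorBound]
  refine Finset.sum_le_sum fun i _ => ?_
  have h1 : ‖iteratedFDeriv ℝ i (fun z : E × F => f z.1) z‖ ≤ ‖iteratedFDeriv ℝ i f z.1‖ :=
    norm_iteratedFDeriv_comp_contraction_le (f.smooth ⊤) (ContinuousLinearMap.fst ℝ E F)
      (ContinuousLinearMap.norm_fst_le ℝ E F) i z
  have h2 : ‖iteratedFDeriv ℝ (n - i) (fun z : E × F => g z.2) z‖
      ≤ ‖iteratedFDeriv ℝ (n - i) g z.2‖ :=
    norm_iteratedFDeriv_comp_contraction_le (g.smooth ⊤) (ContinuousLinearMap.snd ℝ E F)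
      (ContinuousLinearMap.norm_snd_le ℝ E F) (n - i) z
  calc ‖z‖ ^ k * ((n.choose i : ℝ) * ‖iteratedFDeriv ℝ i (fun z : E × F => f z.1) z‖ *
        ‖iteratedFDeriv ℝ (n - i) (fun z : E × F => g z.2) z‖)
      ≤ (‖z.1‖ ^ k + ‖z.2‖ ^ k) * ((n.choose i : ℝ) * ‖iteratedFDeriv ℝ i f z.1‖ *
        ‖iteratedFDeriv ℝ (n - i) g z.2‖) := by
        gcongr
        exact norm_pow_le_add k z
    _ = (n.choose i : ℝ) * ((‖z.1‖ ^ k * ‖iteratedFDeriv ℝ i f z.1‖) *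
          ‖iteratedFDeriv ℝ (n - i) g z.2‖ + ‖iteratedFDeriv ℝ i f z.1‖ *
          (‖z.2‖ ^ k * ‖iteratedFDeriv ℝ (n - i) g z.2‖)) := by ring
    _ ≤ _ := by
        gcongr
        · exact SchwartzMap.le_seminorm ℂ k i f z.1
        · exact SchwartzMap.norm_iteratedFDeriv_le_seminorm ℂ g (n - i) z.2
        · exact SchwartzMap.norm_iteratedFDeriv_le_seminorm ℂ f i z.1
        · exact SchwartzMap.le_seminorm ℂ k (n - i) g z.2

/-- The tensor product `(f ⊗ g)(x, y) = f(x) g(y)` of Schwartz functions. -/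
def tensor (f : 𝓢(E, ℂ)) (g : 𝓢(F, ℂ)) : 𝓢(E × F, ℂ) where
  toFun z := f z.1 * g z.2
  smooth' := ((f.smooth ⊤).comp contDiff_fst).mul ((g.smooth ⊤).comp contDiff_snd)
  decay' k n := ⟨tensorBound k n f g, tensor_decay f g k n⟩

@[simp] lemma tensor_apply (f : 𝓢(E, ℂ)) (g : 𝓢(F, ℂ)) (z : E × F) :
    tensor f g z = f z.1 * g z.2 := rfl

lemma tensorBound_nonneg (k n : ℕ) (f : 𝓢(E, ℂ)) (g : 𝓢(F, ℂ)) : 0 ≤ tensorBound k n f g := by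
  unfold tensorBound; positivity

lemma seminorm_tensor_le (k n : ℕ) (f : 𝓢(E, ℂ)) (g : 𝓢(F, ℂ)) :
    SchwartzMap.seminorm ℂ k n (tensor f g) ≤ tensorBound k n f g :=
  SchwartzMap.seminorm_le_bound ℂ k n _ (tensorBound_nonneg k n f g) (tensor_decay f g k n)

lemma continuous_schwartz_seminorm (k n : ℕ) :
    Continuous (fun f : 𝓢(E, ℂ) => SchwartzMap.seminorm ℂ k n f) :=
  (schwartz_withSeminorms ℂ E ℂ).continuous_seminorm (k, n)

lemma continuous_tensorBound {X : Type*} [TopologicalSpace X] {f : X → 𝓢(E, ℂ)} {g : X → 𝓢(F, ℂ)}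
    (hf : Continuous f) (hg : Continuous g) (k n : ℕ) :
    Continuous (fun x => tensorBound k n (f x) (g x)) := by
  have hE := fun k i => (continuous_schwartz_seminorm (E := E) k i).comp hf
  have hF := fun k i => (continuous_schwartz_seminorm (E := F) k i).comp hg
  refine continuous_finsetSum _ fun i _ => continuous_const.mul ?_
  exact ((hE k i).mul (hF 0 (n - i))).add ((hE 0 i).mul (hF k (n - i)))

lemma tensorBound_zero_left (k n : ℕ) (g : 𝓢(F, ℂ)) : tensorBound k n (0 : 𝓢(E, ℂ)) g = 0 := by
  simp only [tensorBound, map_zero, zero_mul, add_zero, mul_zero, Finset.sum_const_zero]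

lemma tensorBound_zero_right (k n : ℕ) (f : 𝓢(E, ℂ)) : tensorBound k n f (0 : 𝓢(F, ℂ)) = 0 := by
  simp only [tensorBound, map_zero, add_zero, mul_zero, Finset.sum_const_zero]

lemma seminorm_tensor_sub_le (k n : ℕ) (f f₀ : 𝓢(E, ℂ)) (g g₀ : 𝓢(F, ℂ)) :
    SchwartzMap.seminorm ℂ k n (tensor f g - tensor f₀ g₀)
      ≤ tensorBound k n (f - f₀) g + tensorBound k n f₀ (g - g₀) := by
  have hsplit : tensor f g - tensor f₀ g₀ = tensor (f - f₀) g + tensor f₀ (g - g₀) := by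
    ext z
    simp only [sub_apply, add_apply, tensor_apply]
    ring
  rw [hsplit]
  exact (map_add_le_add _ _ _).trans
    (add_le_add (seminorm_tensor_le _ _ _ _) (seminorm_tensor_le _ _ _ _))

lemma tendsto_tensorBound (k n : ℕ) (p₀ : 𝓢(E, ℂ) × 𝓢(F, ℂ)) :
    Tendsto (fun p : 𝓢(E, ℂ) × 𝓢(F, ℂ) =>
      tensorBound k n (p.1 - p₀.1) p.2 + tensorBound k n p₀.1 (p.2 - p₀.2)) (𝓝 p₀) (𝓝 0) := by
  have h1 := continuous_tensorBound (E := E) (F := F) (f := fun p : 𝓢(E, ℂ) × 𝓢(F, ℂ) => p.1 - p₀.1)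
    (g := fun p => p.2) (continuous_fst.sub continuous_const) continuous_snd k n
  have h2 := continuous_tensorBound (E := E) (F := F) (f := fun _ : 𝓢(E, ℂ) × 𝓢(F, ℂ) => p₀.1)
    (g := fun p => p.2 - p₀.2) continuous_const (continuous_snd.sub continuous_const) k n
  have h0 : tensorBound k n (p₀.1 - p₀.1) p₀.2 + tensorBound k n p₀.1 (p₀.2 - p₀.2) = 0 := by
    rw [sub_self, sub_self, tensorBound_zero_left, tensorBound_zero_right, add_zero]
  rw [← h0]
  exact (h1.tendsto p₀).add (h2.tendsto p₀)

lemma continuous_tensor : Continuous (fun p : 𝓢(E, ℂ) × 𝓢(F, ℂ) => tensor p.1 p.2) := by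
  refine continuous_iff_continuousAt.2 fun p₀ => ?_
  refine ((schwartz_withSeminorms ℂ (E × F) ℂ).tendsto_nhds _ _).2 fun i ε hε => ?_
  exact ((tendsto_tensorBound i.1 i.2 p₀).eventually_lt_const hε).mono fun p hp =>
    (seminorm_tensor_sub_le i.1 i.2 p.1 p₀.1 p.2 p₀.2).trans_lt hp

variable {G : Type*} [AddCommGroup G] [Module ℂ G] [TopologicalSpace G] [IsTopologicalAddGroup G]
  [ContinuousSMul ℂ G]

/-- A continuous linear map on Schwartz functions of two variables, as a continuous linear map from
the Schwartz functions of the second variable to the operators on those of the first, the latter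
with the topology of uniform convergence on bounded sets. -/
def curryTensor (Λ : 𝓢(E × F, ℂ) →L[ℂ] G) : 𝓢(F, ℂ) →L[ℂ] (𝓢(E, ℂ) →L[ℂ] G) :=
  let B : 𝓢(F, ℂ) →ₗ[ℂ] (𝓢(E, ℂ) →L[ℂ] G) :=
    { toFun := fun g =>
        { toFun := fun f => Λ (tensor f g)
          map_add' := fun f f' => by
            rw [← map_add]; congr 1; ext z; simp [add_mul]
          map_smul' := fun c f => by
            rw [RingHom.id_apply, ← map_smul]; congr 1; ext z; simp [mul_assoc]
          cont := Λ.continuous.comp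
            (continuous_tensor.comp (continuous_id.prodMk continuous_const)) }
      map_add' := fun g g' => by
        ext f
        change Λ _ = Λ _ + Λ _
        rw [← map_add]; congr 1; ext z; simp [mul_add]
      map_smul' := fun c g => by
        ext f
        change Λ _ = c • Λ _
        rw [← map_smul]; congr 1; ext z; simp [mul_left_comm] }
  { toLinearMap := B
    cont := ContinuousLinearMap.continuous_of_continuous_uncurry B
      (Λ.continuous.comp (continuous_tensor.comp continuous_swap)) }

end Tensor

/-! ### The kernels of smoothing operators -/

/-- Tempered distributions uniformly of finite order form a bounded set in the strong dual. -/
lemma isVonNBounded_range_temp {ι : Type*} (u : ι → Temp d) (k n : ℕ) (C : ℝ)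
    (h : ∀ i f, ‖u i f‖ ≤ C * SchwartzMap.seminorm ℂ k n f) :
    Bornology.IsVonNBounded ℂ (Set.range u) := by
  rw [ContinuousLinearMap.isVonNBounded_iff]
  intro s hs
  obtain ⟨r, hr, hsr⟩ := ((schwartz_withSeminorms ℂ (Pos d) ℂ).isVonNBounded_iff_seminorm_bounded.1
    hs) (k, n)
  rw [NormedSpace.isVonNBounded_iff']
  refine ⟨|C| * r, ?_⟩
  rintro _ ⟨_, ⟨i, rfl⟩, f, hf, rfl⟩
  refine (h i f).trans ?_
  calc C * SchwartzMap.seminorm ℂ k n f ≤ |C| * SchwartzMap.seminorm ℂ k n f :=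
        mul_le_mul_of_nonneg_right (le_abs_self _) (apply_nonneg _ _)
    _ ≤ _ := mul_le_mul_of_nonneg_left (hsr f hf).le (abs_nonneg _)

/-- A smoothing operator is bounded on each set of distributions uniformly of finite order. -/
lemma exists_seminorm_smoothing_le {ι : Type*} (T : Smoothing d) (u : ι → Temp d) (k n : ℕ) (C : ℝ)
    (h : ∀ i f, ‖u i f‖ ≤ C * SchwartzMap.seminorm ℂ k n f) (l m : ℕ) :
    ∃ r : ℝ, 0 < r ∧ ∀ i, SchwartzMap.seminorm ℂ l m (T (u i)) ≤ r := by
  have hb := (isVonNBounded_range_temp u k n C h).image T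
  obtain ⟨r, hr, hsr⟩ := ((schwartz_withSeminorms ℂ (Pos d) ℂ).isVonNBounded_iff_seminorm_bounded.1
    hb) (l, m)
  exact ⟨r, hr, fun i => (hsr _ ⟨u i, ⟨i, rfl⟩, rfl⟩).le⟩

/-- Smoothing operators close to zero are small on each set of distributions uniformly of finite
order. -/
lemma eventually_seminorm_smoothing_lt {ι : Type*} (u : ι → Temp d) (k n : ℕ) (C : ℝ)
    (h : ∀ i f, ‖u i f‖ ≤ C * SchwartzMap.seminorm ℂ k n f) (l m : ℕ) {ε : ℝ} (hε : 0 < ε) :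
    ∀ᶠ T : Smoothing d in 𝓝 0, ∀ i, SchwartzMap.seminorm ℂ l m (T (u i)) < ε := by
  have hU : {f : Schw d | SchwartzMap.seminorm ℂ l m f < ε} ∈ 𝓝 (0 : Schw d) :=
    (continuous_schwartz_seminorm l m).continuousAt.eventually_lt_const (by simpa using hε)
  filter_upwards [ContinuousLinearMap.eventually_nhds_zero_mapsTo
    (isVonNBounded_range_temp u k n C h) hU] with T hT i
  exact hT ⟨i, rfl⟩

lemma norm_fderiv_sub_le_seminorm (f : Schw d) (x y : Pos d) :
    ‖fderiv ℝ f x - fderiv ℝ f y‖ ≤ SchwartzMap.seminorm ℂ 0 2 f * ‖x - y‖ := by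
  refine Convex.norm_image_sub_le_of_norm_fderiv_le (𝕜 := ℝ) (s := Set.univ) (fun z _ => ?_)
    (fun z _ => ?_) convex_univ (Set.mem_univ _) (Set.mem_univ _)
  · exact (((f.smooth 2).fderiv_right (m := 1) (by norm_num)).differentiable (by simp)) z
  · rw [← norm_iteratedFDeriv_one, norm_iteratedFDeriv_fderiv]
    exact SchwartzMap.norm_iteratedFDeriv_le_seminorm ℂ f 2 z

lemma norm_taylor_le_seminorm (f : Schw d) (y h : Pos d) :
    ‖f (y + h) - f y - fderiv ℝ f y h‖ ≤ SchwartzMap.seminorm ℂ 0 2 f * ‖h‖ ^ 2 := by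
  have key := Convex.norm_image_sub_le_of_norm_fderiv_le' (𝕜 := ℝ) (f := f)
    (φ := fderiv ℝ f y) (s := Metric.closedBall y ‖h‖)
    (C := SchwartzMap.seminorm ℂ 0 2 f * ‖h‖) (x := y) (y := y + h)
    (fun z _ => f.differentiableAt)
    (fun z hz => (norm_fderiv_sub_le_seminorm f z y).trans
      (mul_le_mul_of_nonneg_left (by simpa [dist_eq_norm] using hz) (apply_nonneg _ _)))
    (convex_closedBall _ _) (by simp) (by simp)
  simpa [pow_two, mul_assoc] using key

lemma norm_sub_le_seminorm (f : Schw d) (x y : Pos d) :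
    ‖f x - f y‖ ≤ SchwartzMap.seminorm ℂ 0 1 f * ‖x - y‖ := by
  refine Convex.norm_image_sub_le_of_norm_fderiv_le (𝕜 := ℝ) (s := Set.univ) (fun z _ => ?_)
    (fun z _ => ?_) convex_univ (Set.mem_univ _) (Set.mem_univ _)
  · exact f.differentiableAt
  · rw [← norm_iteratedFDeriv_one]
    exact SchwartzMap.norm_iteratedFDeriv_le_seminorm ℂ f 1 z

/-- The distribution `f ↦ (∂_j f)(y)`. -/
def diracDeriv (j : Fin d) (y : Pos d) : Temp d := (dirac y).comp (partialDeriv j)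

lemma partialDeriv_apply (j : Fin d) (f : Schw d) (y : Pos d) :
    partialDeriv j f y = fderiv ℝ f y (EuclideanSpace.single j 1) :=
  SchwartzMap.lineDerivOp_apply_eq_fderiv _ f y

lemma sum_partialDeriv (f : Schw d) (y h : Pos d) :
    ∑ j, (h j : ℂ) * partialDeriv j f y = fderiv ℝ f y h := by
  simp only [partialDeriv_apply]
  have hh : h = ∑ j, h j • EuclideanSpace.single j (1 : ℝ) := by
    ext i
    simp [Finset.sum_apply, Pi.single_apply]
  conv_rhs => rw [hh]
  simp only [map_sum, map_smul, Complex.real_smul]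

/-- The kernel of a smoothing operator, as a function on `ℝ^{2d}`. -/
def pairKernel (T : Smoothing d) (z : PosPair d) : ℂ := smoothingKernel T z.1 z.2

/-- The kernel is Lipschitz in the second variable: the difference quotients of Dirac distributions
are uniformly of order one. -/
lemma exists_norm_pairKernel_sub_le (T : Smoothing d) : ∃ r : ℝ, 0 < r ∧ ∀ x y y',
    ‖pairKernel T (x, y') - pairKernel T (x, y)‖ ≤ r * ‖y' - y‖ := by
  obtain ⟨r, hr, h⟩ := exists_seminorm_smoothing_le T
    (fun p : Pos d × Pos d => ((‖p.1 - p.2‖⁻¹ : ℝ) : ℂ) • (dirac p.1 - dirac p.2)) 0 1 1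
    (fun p f => by
      rw [smul_apply, sub_apply, dirac_apply, dirac_apply, norm_smul,
        Complex.norm_real, norm_inv, norm_norm, one_mul]
      rcases eq_or_ne (p.1 - p.2) 0 with h | h
      · simp [h]
      · rw [inv_mul_le_iff₀ (norm_pos_iff.2 h), mul_comm]
        exact norm_sub_le_seminorm f p.1 p.2) 0 0
  refine ⟨r, hr, fun x y y' => ?_⟩
  rcases eq_or_ne y' y with rfl | hne
  · simp
  have hpos : 0 < ‖y' - y‖ := norm_pos_iff.2 (sub_ne_zero.2 hne)
  have h1 := (SchwartzMap.norm_le_seminorm ℂ _ x).trans (h (y', y))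
  rw [map_smul, map_sub, smul_apply, sub_apply, norm_smul, Complex.norm_real, norm_inv,
    norm_norm, inv_mul_le_iff₀ hpos, mul_comm] at h1
  exact h1

lemma continuous_pairKernel (T : Smoothing d) : Continuous (pairKernel T) := by
  obtain ⟨r, hr, h⟩ := exists_norm_pairKernel_sub_le T
  rw [continuous_iff_continuousAt]
  rintro ⟨x₀, y₀⟩
  rw [ContinuousAt, tendsto_iff_norm_sub_tendsto_zero]
  have hc : Continuous (fun z : PosPair d => r * ‖z.2 - y₀‖
      + ‖T (dirac y₀) z.1 - T (dirac y₀) x₀‖) := by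
    have := (T (dirac y₀)).continuous
    fun_prop
  refine squeeze_zero (fun _ => norm_nonneg _) (fun z => ?_)
    (by simpa using hc.tendsto (x₀, y₀))
  calc ‖pairKernel T z - pairKernel T (x₀, y₀)‖
      = ‖(pairKernel T (z.1, z.2) - pairKernel T (z.1, y₀))
        + (T (dirac y₀) z.1 - T (dirac y₀) x₀)‖ := by
        congr 1
        change T (dirac z.2) z.1 - T (dirac y₀) x₀ = (T (dirac z.2) z.1 - T (dirac y₀) z.1)
          + (T (dirac y₀) z.1 - T (dirac y₀) x₀)
        ring
    _ ≤ _ := (norm_add_le _ _).trans (add_le_add (h _ _ _) le_rfl)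

/-- The maps `T ↦ ∂_j T` and `T ↦ T ∂_jᵗ` on smoothing operators; on kernels they are the partial
derivatives. -/
def kernelDeriv : Fin d ⊕ Fin d → (Smoothing d →L[ℂ] Smoothing d) :=
  Sum.elim (fun j => ContinuousLinearMap.postcomp (Temp d) (partialDeriv j))
    (fun j => ContinuousLinearMap.precomp (Schw d) (ContinuousLinearMap.precomp ℂ (partialDeriv j)))

lemma pairKernel_kernelDeriv_inl (j : Fin d) (T : Smoothing d) (z : PosPair d) :
    pairKernel (kernelDeriv (.inl j) T) z = partialDeriv j (T (dirac z.2)) z.1 := rfl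

lemma pairKernel_kernelDeriv_inr (j : Fin d) (T : Smoothing d) (z : PosPair d) :
    pairKernel (kernelDeriv (.inr j) T) z = T (diracDeriv j z.2) z.1 := rfl

/-- The coordinate forms on `ℝ^{2d}`. -/
def pairCoord : Fin d ⊕ Fin d → (PosPair d →L[ℝ] ℝ) :=
  Sum.elim (fun j => (EuclideanSpace.proj j).comp (ContinuousLinearMap.fst ℝ _ _))
    (fun j => (EuclideanSpace.proj j).comp (ContinuousLinearMap.snd ℝ _ _))

/-- The kernel is differentiable in the second variable: the remainders in the first order Taylor
expansion of Dirac distributions, divided by `‖h‖²`, are uniformly of order two. -/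
lemma hasFDerivAt_pairKernel_snd (T : Smoothing d) (x y : Pos d) :
    HasFDerivAt (fun y => pairKernel T (x, y))
      (∑ j, (EuclideanSpace.proj j : Pos d →L[ℝ] ℝ).smulRight
        (pairKernel (kernelDeriv (.inr j) T) (x, y))) y := by
  obtain ⟨r, hr, h⟩ := exists_seminorm_smoothing_le T
    (fun p : Pos d × Pos d => (((‖p.2‖ ^ 2)⁻¹ : ℝ) : ℂ) •
      (dirac (p.1 + p.2) - dirac p.1 - ∑ j, (p.2 j : ℂ) • diracDeriv j p.1)) 0 2 1
    (fun p f => by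
      have hs : (∑ j, (p.2 j : ℂ) • diracDeriv j p.1) f = fderiv ℝ f p.1 p.2 := by
        rw [← sum_partialDeriv, sum_apply]; rfl
      rw [smul_apply, sub_apply, sub_apply, hs, dirac_apply, dirac_apply, norm_smul,
        Complex.norm_real, norm_inv, norm_pow, norm_norm, one_mul]
      rcases eq_or_ne p.2 0 with h | h
      · simp [h]
      · rw [inv_mul_le_iff₀ (pow_pos (norm_pos_iff.2 h) 2), mul_comm]
        exact norm_taylor_le_seminorm f p.1 p.2) 0 0
  have hbound : ∀ h', ‖pairKernel T (x, y + h') - pairKernel T (x, y) -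
      (∑ j, (EuclideanSpace.proj j : Pos d →L[ℝ] ℝ).smulRight
        (pairKernel (kernelDeriv (.inr j) T) (x, y))) h'‖ ≤ r * ‖h'‖ ^ 2 := by
    intro h'
    rcases eq_or_ne h' 0 with rfl | hne
    · simp
    have h1 := (SchwartzMap.norm_le_seminorm ℂ _ x).trans (h (y, h'))
    have hs : (∑ j, (h' j : ℂ) • T (diracDeriv j y)) x
        = (∑ j, (EuclideanSpace.proj j : Pos d →L[ℝ] ℝ).smulRight
        (pairKernel (kernelDeriv (.inr j) T) (x, y))) h' := by
      rw [sum_apply, sum_apply]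
      refine Finset.sum_congr rfl fun j _ => ?_
      rw [pairKernel_kernelDeriv_inr, smul_apply, ContinuousLinearMap.smulRight_apply,
        Complex.real_smul, smul_eq_mul]
      rfl
    simp only [map_smul, map_sub, map_sum] at h1
    rw [smul_apply, sub_apply, sub_apply, hs, norm_smul, Complex.norm_real, norm_inv, norm_pow,
      norm_norm, inv_mul_le_iff₀ (pow_pos (norm_pos_iff.2 hne) 2), mul_comm] at h1
    exact h1
  rw [hasFDerivAt_iff_isLittleO_nhds_zero]
  refine Asymptotics.IsBigO.trans_isLittleO (g := fun h : Pos d => ‖h‖ ^ 2) ?_ ?_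
  · exact Asymptotics.IsBigO.of_bound r (Eventually.of_forall fun h' => by
      simpa using hbound h')
  · exact Asymptotics.isLittleO_norm_pow_id one_lt_two

lemma hasFDerivAt_pairKernel_fst (T : Smoothing d) (x y : Pos d) :
    HasFDerivAt (fun x => pairKernel T (x, y))
      (∑ j, (EuclideanSpace.proj j : Pos d →L[ℝ] ℝ).smulRight
        (pairKernel (kernelDeriv (.inl j) T) (x, y))) x := by
  refine (SchwartzMap.hasFDerivAt (T (dirac y)) x).congr_fderiv ?_
  ext h
  rw [← sum_partialDeriv, sum_apply]
  rfl

lemma hasFDerivAt_pairKernel (T : Smoothing d) (z : PosPair d) :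
    HasFDerivAt (pairKernel T)
      (∑ i, (pairCoord i).smulRight (pairKernel (kernelDeriv i T) z)) z := by
  have hc : ∀ i : Fin d × (Fin d ⊕ Fin d), Continuous (fun z : PosPair d =>
      (EuclideanSpace.proj i.1 : Pos d →L[ℝ] ℝ).smulRight
        (pairKernel (kernelDeriv i.2 T) z)) := fun i =>
    (ContinuousLinearMap.smulRightL ℝ (Pos d) ℂ (EuclideanSpace.proj i.1)).continuous.comp
      (continuous_pairKernel _)
  have h := hasStrictFDerivAt_uncurry_coprod (𝕜 := ℝ) (u := z)
    (f := fun x y => pairKernel T (x, y))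
    (f₁ := fun x y => ∑ j, (EuclideanSpace.proj j : Pos d →L[ℝ] ℝ).smulRight
        (pairKernel (kernelDeriv (.inl j) T) (x, y)))
    (f₂ := fun x y => ∑ j, (EuclideanSpace.proj j : Pos d →L[ℝ] ℝ).smulRight
        (pairKernel (kernelDeriv (.inr j) T) (x, y)))
    (Eventually.of_forall fun v => hasFDerivAt_pairKernel_fst T v.1 v.2)
    (Eventually.of_forall fun v => hasFDerivAt_pairKernel_snd T v.1 v.2)
    (continuous_finsetSum Finset.univ fun j _ => hc (j, .inl j)).continuousAt
    (continuous_finsetSum Finset.univ fun j _ => hc (j, .inr j)).continuousAt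
  refine h.hasFDerivAt.congr_fderiv ?_
  ext w
  · simp [pairCoord, Function.HasUncurry.uncurry, sum_apply]
  · simp [pairCoord, Function.HasUncurry.uncurry, sum_apply]

lemma fderiv_pairKernel (T : Smoothing d) : fderiv ℝ (pairKernel T) = fun z =>
    ∑ i, ContinuousLinearMap.smulRightL ℝ (PosPair d) ℂ (pairCoord i)
      (pairKernel (kernelDeriv i T) z) :=
  funext fun z => (hasFDerivAt_pairKernel T z).fderiv

lemma contDiff_pairKernel (T : Smoothing d) : ContDiff ℝ ∞ (pairKernel T) := by
  rw [contDiff_infty]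
  intro n
  induction n generalizing T with
  | zero => exact contDiff_zero.2 (continuous_pairKernel T)
  | succ n ih =>
    rw [Nat.cast_succ, contDiff_succ_iff_fderiv]
    refine ⟨fun z => (hasFDerivAt_pairKernel T z).differentiableAt, by simp, ?_⟩
    rw [fderiv_pairKernel]
    exact ContDiff.sum fun i _ => (ContinuousLinearMap.contDiff _).comp (ih _)

/-- The kernels of smoothing operators close to zero are small in each Schwartz seminorm. -/
lemma eventually_pairKernel_decay (k n : ℕ) {ε : ℝ} (hε : 0 < ε) :
    ∀ᶠ T : Smoothing d in 𝓝 0, ∀ z, ‖z‖ ^ k * ‖iteratedFDeriv ℝ n (pairKernel T) z‖ ≤ ε := by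
  induction n generalizing ε with
  | zero =>
    have h1 := eventually_seminorm_smoothing_lt (dirac (d := d)) 0 0 1
      (fun y f => by rw [one_mul]; exact SchwartzMap.norm_le_seminorm ℂ f y) k 0 (half_pos hε)
    have h2 := eventually_seminorm_smoothing_lt
      (fun y : Pos d => ((‖y‖ ^ k : ℝ) : ℂ) • dirac y) k 0 1
      (fun y f => by
        rw [one_mul, smul_apply, norm_smul, Complex.norm_real, norm_pow, norm_norm]
        exact SchwartzMap.norm_pow_mul_le_seminorm ℂ f k y) 0 0 (half_pos hε)
    filter_upwards [h1, h2] with T hT1 hT2 z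
    have hz1 : ‖z.1‖ ^ k * ‖pairKernel T z‖ ≤ ε / 2 :=
      (SchwartzMap.norm_pow_mul_le_seminorm ℂ (T (dirac z.2)) k z.1).trans (hT1 z.2).le
    have hz2 : ‖z.2‖ ^ k * ‖pairKernel T z‖ ≤ ε / 2 := by
      have h := (SchwartzMap.norm_le_seminorm ℂ _ z.1).trans (hT2 z.2).le
      rw [map_smul, smul_apply, norm_smul, Complex.norm_real, norm_pow, norm_norm] at h
      exact h
    rw [norm_iteratedFDeriv_zero]
    have := mul_le_mul_of_nonneg_right (norm_pow_le_add k z) (norm_nonneg (pairKernel T z))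
    linarith
  | succ n ih =>
    let c : Fin d ⊕ Fin d → (ℂ →L[ℝ] (PosPair d →L[ℝ] ℂ)) := fun i =>
      ContinuousLinearMap.smulRightL ℝ (PosPair d) ℂ (pairCoord i)
    set S : ℝ := ∑ i, ‖c i‖ with hS
    have hS0 : 0 ≤ S := Finset.sum_nonneg fun i _ => norm_nonneg _
    have hev : ∀ᶠ T : Smoothing d in 𝓝 0, ∀ i, ∀ z,
        ‖z‖ ^ k * ‖iteratedFDeriv ℝ n (pairKernel (kernelDeriv i T)) z‖ ≤ ε / (S + 1) := by
      rw [eventually_all]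
      intro i
      have ht : Tendsto (kernelDeriv i) (𝓝 (0 : Smoothing d)) (𝓝 0) := by
        simpa using (kernelDeriv i).continuous.tendsto 0
      exact ht.eventually (ih (by positivity))
    filter_upwards [hev] with T hT z
    rw [← norm_iteratedFDeriv_fderiv, fderiv_pairKernel]
    have hsum : iteratedFDeriv ℝ n (fun z => ∑ i, c i (pairKernel (kernelDeriv i T) z)) z
        = ∑ i, iteratedFDeriv ℝ n (fun z => c i (pairKernel (kernelDeriv i T) z)) z :=
      iteratedFDeriv_fun_sum_apply fun i _ => ((c i).contDiff.comp
        ((contDiff_pairKernel _).of_le (by exact_mod_cast le_top))).contDiffAt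
    rw [hsum]
    calc ‖z‖ ^ k * ‖∑ i, iteratedFDeriv ℝ n (fun z => c i (pairKernel (kernelDeriv i T) z)) z‖
        ≤ ‖z‖ ^ k * ∑ i, ‖c i‖ * ‖iteratedFDeriv ℝ n (pairKernel (kernelDeriv i T)) z‖ := by
          gcongr
          refine norm_sum_le_of_le _ fun i _ => ?_
          exact (c i).norm_iteratedFDeriv_comp_left (N := ∞)
            (contDiff_pairKernel (kernelDeriv i T)).contDiffAt (by exact_mod_cast le_top)
      _ = ∑ i, ‖c i‖ * (‖z‖ ^ k * ‖iteratedFDeriv ℝ n (pairKernel (kernelDeriv i T)) z‖) := by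
          rw [Finset.mul_sum]
          exact Finset.sum_congr rfl fun i _ => by ring
      _ ≤ ∑ i, ‖c i‖ * (ε / (S + 1)) :=
          Finset.sum_le_sum fun i _ => mul_le_mul_of_nonneg_left (hT i z) (norm_nonneg _)
      _ = S / (S + 1) * ε := by rw [← Finset.sum_mul, ← hS]; ring
      _ ≤ ε := mul_le_of_le_one_left hε.le (by rw [div_le_one (by positivity)]; linarith)

lemma pairKernel_smul (c : ℂ) (T : Smoothing d) :
    pairKernel (c • T) = fun z => c * pairKernel T z := rfl

lemma pairKernel_decay (T : Smoothing d) (k n : ℕ) :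
    ∃ C : ℝ, ∀ z, ‖z‖ ^ k * ‖iteratedFDeriv ℝ n (pairKernel T) z‖ ≤ C := by
  -- Some nonzero multiple of `T` lies in the neighbourhood of zero where the seminorm is below one.
  have ht : Tendsto (fun c : ℂ => c • T) (𝓝[≠] 0) (𝓝 0) := by
    have : Continuous (fun c : ℂ => c • T) := continuous_id.smul continuous_const
    simpa using (this.tendsto 0).mono_left nhdsWithin_le_nhds
  obtain ⟨c, hc, hc0⟩ := ((ht.eventually (eventually_pairKernel_decay k n one_pos)).and
    self_mem_nhdsWithin).exists
  refine ⟨‖c⁻¹‖, fun z => ?_⟩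
  have hT : pairKernel T = fun z => c⁻¹ * pairKernel (c • T) z := by
    ext z
    rw [pairKernel_smul, ← mul_assoc, inv_mul_cancel₀ hc0, one_mul]
  rw [hT]
  calc _ ≤ ‖z‖ ^ k * (‖c⁻¹‖ * ‖iteratedFDeriv ℝ n (pairKernel (c • T)) z‖) := by
        gcongr
        exact norm_iteratedFDeriv_const_mul_le (contDiff_pairKernel _) _ n z
    _ = ‖c⁻¹‖ * (‖z‖ ^ k * ‖iteratedFDeriv ℝ n (pairKernel (c • T)) z‖) := by ring
    _ ≤ ‖c⁻¹‖ := mul_le_of_le_one_right (norm_nonneg _) (hc z)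

/-- The kernel of a smoothing operator is a Schwartz function on `ℝ^{2d}` and depends continuously
on the operator. -/
def kernelCLM (d : ℕ) : Smoothing d →L[ℂ] 𝓢(PosPair d, ℂ) :=
  let K : Smoothing d →ₗ[ℂ] 𝓢(PosPair d, ℂ) :=
    { toFun := fun T => ⟨pairKernel T, contDiff_pairKernel T, pairKernel_decay T⟩
      map_add' := fun _ _ => rfl
      map_smul' := fun _ _ => rfl }
  { toLinearMap := K
    cont := by
      refine continuous_of_continuousAt_zero K ?_
      rw [ContinuousAt, map_zero]
      refine ((schwartz_withSeminorms ℂ (PosPair d) ℂ).tendsto_nhds _ _).2 fun ⟨k, n⟩ ε hε => ?_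
      filter_upwards [eventually_pairKernel_decay k n (half_pos hε)] with T hT
      rw [sub_zero]
      exact (SchwartzMap.seminorm_le_bound ℂ k n (K T) (half_pos hε).le hT).trans_lt
        (half_lt_self hε) }

@[simp] lemma kernelCLM_apply (T : Smoothing d) (z : PosPair d) :
    kernelCLM d T z = smoothingKernel T z.1 z.2 := rfl

/-! ### Averages along line segments -/

section Average

variable {E G : Type} [NormedAddCommGroup E] [NormedSpace ℝ E] [NormedAddCommGroup G]
  [NormedSpace ℝ G]

/-- The weighted average `∫_0^1 p(s) f(L_s z) ds` of a function along a family of linear maps. -/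
def average (p : ℝ → ℝ) (L : ℝ → G →L[ℝ] E) (f : E → ℝ) (z : G) : ℝ :=
  ∫ s in (0 : ℝ)..1, p s * f (L s z)

variable {p : ℝ → ℝ} {L : ℝ → G →L[ℝ] E} {f : E → ℝ} {k : ℕ}

lemma isIntegrableFamily_average (hp : Continuous p) (hL : Continuous L)
    (hf : IsSymbol (fun x => (1 + ‖x‖) ^ k) f) :
    IsIntegrableFamily (volume.restrict (Set.Ioc (0 : ℝ) 1)) (fun z : G => (1 + ‖z‖) ^ k)
      (fun s z => p s * f (L s z)) := by
  obtain ⟨R₁, hR₁⟩ := isCompact_Icc.exists_bound_of_continuousOn (s := Set.Icc (0 : ℝ) 1)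
    hp.continuousOn
  obtain ⟨R₂, hR₂⟩ := isCompact_Icc.exists_bound_of_continuousOn (s := Set.Icc (0 : ℝ) 1)
    hL.continuousOn
  set R : ℝ := max 1 R₂ with hR
  have hRpos : 0 ≤ R := zero_le_one.trans (le_max_left _ _)
  refine ⟨fun z => ?_, Eventually.of_forall fun s => ?_, fun n => ?_⟩
  · have hc := hf.contDiff.continuous
    have : Continuous (fun s => p s * f (L s z)) :=
      hp.mul (hc.comp (hL.clm_apply continuous_const))
    exact this.aestronglyMeasurable
  · exact contDiff_const.mul (hf.contDiff.comp (L s).contDiff)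
  · obtain ⟨C, hC0, hC⟩ := hf.bound_pos (fun x => by positivity) n
    refine ⟨fun _ => |R₁| * (C * R ^ k * R ^ n), integrable_const _, ?_⟩
    filter_upwards [ae_restrict_mem measurableSet_Ioc] with s hs z
    have hs' : s ∈ Set.Icc (0 : ℝ) 1 := ⟨hs.1.le, hs.2⟩
    have hLs : ‖L s‖ ≤ R := (hR₂ s hs').trans (le_max_right _ _)
    have hcd : ContDiff ℝ ∞ (fun z => f (L s z)) := hf.contDiff.comp (L s).contDiff
    have h1 : iteratedFDeriv ℝ n (fun z => p s * f (L s z)) z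
        = p s • iteratedFDeriv ℝ n (fun z => f (L s z)) z :=
      iteratedFDeriv_const_smul_apply (a := p s)
        (hcd.of_le (by exact_mod_cast le_top)).contDiffAt
    have h2 := norm_iteratedFDeriv_comp_affine_le hf.contDiff (L s) 0 n z
    simp only [add_zero] at h2
    have h3 : 1 + ‖L s z‖ ≤ R * (1 + ‖z‖) := by
      have := ((L s).le_opNorm z).trans (mul_le_mul_of_nonneg_right hLs (norm_nonneg z))
      have := le_max_left 1 R₂
      linarith
    rw [h1, norm_smul]
    calc ‖p s‖ * ‖iteratedFDeriv ℝ n (fun z => f (L s z)) z‖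
        ≤ |R₁| * ((C * (1 + ‖L s z‖) ^ k) * ‖L s‖ ^ n) := by
          refine mul_le_mul ((hR₁ s hs').trans (le_abs_self _)) (h2.trans ?_) (norm_nonneg _)
            (abs_nonneg _)
          exact mul_le_mul_of_nonneg_right (hC _) (by positivity)
      _ ≤ |R₁| * ((C * (R * (1 + ‖z‖)) ^ k) * R ^ n) := by gcongr
      _ = |R₁| * (C * R ^ k * R ^ n) * (1 + ‖z‖) ^ k := by rw [mul_pow]; ring

lemma eventually_weight_le {G : Type*} [SeminormedAddCommGroup G] (k : ℕ) (z : G) :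
    ∃ C : ℝ, ∀ᶠ z' in 𝓝 z, (1 + ‖z'‖) ^ k ≤ C := by
  have h : Continuous (fun z : G => (1 + ‖z‖) ^ k) := by fun_prop
  exact ⟨_, (h.tendsto z).eventually_le_const (lt_add_one _)⟩

lemma average_eq (p : ℝ → ℝ) (L : ℝ → G →L[ℝ] E) (f : E → ℝ) :
    average p L f = fun z => ∫ s in Set.Ioc (0 : ℝ) 1, p s * f (L s z) :=
  funext fun _ => intervalIntegral.integral_of_le zero_le_one

variable [FiniteDimensional ℝ G]

lemma isSymbol_average (hp : Continuous p) (hL : Continuous L)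
    (hf : IsSymbol (fun x => (1 + ‖x‖) ^ k) f) :
    IsSymbol (fun z : G => (1 + ‖z‖) ^ k) (average p L f) := by
  rw [average_eq]
  exact (isIntegrableFamily_average hp hL hf).isSymbol_integral (fun z => by positivity)
    (eventually_weight_le k)

lemma fderiv_average (hp : Continuous p) (hL : Continuous L)
    (hf : IsSymbol (fun x => (1 + ‖x‖) ^ k) f) (z e : G) :
    fderiv ℝ (average p L f) z e = ∫ s in (0 : ℝ)..1, p s * fderiv ℝ f (L s z) (L s e) := by
  have hG := isIntegrableFamily_average hp hL hf
  rw [average_eq, (hG.hasFDerivAt (fun z => by positivity) (eventually_weight_le k) z).fderiv,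
    ContinuousLinearMap.integral_apply (hG.fderiv.integrable z),
    intervalIntegral.integral_of_le zero_le_one]
  congr 1
  ext s
  have h1 : HasFDerivAt (fun z => p s * f (L s z)) (p s • (fderiv ℝ f (L s z)).comp (L s)) z :=
    (((hf.differentiable (L s z)).hasFDerivAt).comp z (L s).hasFDerivAt).const_mul (p s)
  rw [h1.fderiv]
  rfl

end Average

/-! ### The magnetic potential -/

section Magnetic

variable {B : Pos d → Fin d → Fin d → ℝ}

lemma IsRegularMagneticField.isSymbol (hB : IsRegularMagneticField B) (j k : Fin d) :
    IsSymbol (fun x => (1 + ‖x‖) ^ 0) (fun x => B x j k) :=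
  ⟨hB.smooth j k, fun n => by simpa using hB.bounded j k n⟩

/-- The scaling maps `x ↦ s x`. -/
def scaling (d : ℕ) (s : ℝ) : Pos d →L[ℝ] Pos d := s • ContinuousLinearMap.id ℝ (Pos d)

lemma scaling_apply (s : ℝ) (x : Pos d) : scaling d s x = s • x := rfl

lemma continuous_scaling : Continuous (scaling d) := continuous_id.smul continuous_const

lemma potential_eq (B : Pos d → Fin d → Fin d → ℝ) (k : Fin d) :
    (fun x => potential B x k)
      = fun x => ∑ j, x j * average id (scaling d) (fun x => B x j k) x := by
  ext x
  refine Finset.sum_congr rfl fun j _ => ?_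
  rw [average, ← intervalIntegral.integral_const_mul]
  refine intervalIntegral.integral_congr fun s _ => ?_
  simp only [id, scaling_apply]
  ring

lemma isSymbol_coord (j : Fin d) : IsSymbol (fun x : Pos d => 1 + ‖x‖) (fun x : Pos d => x j) :=
  IsSymbol.of_clm (EuclideanSpace.proj j : Pos d →L[ℝ] ℝ)

lemma IsRegularMagneticField.isSymbol_potential (hB : IsRegularMagneticField B) (k : Fin d) :
    IsSymbol (fun x => (1 + ‖x‖) ^ 1) (fun x => potential B x k) := by
  rw [potential_eq]
  refine IsSymbol.sum _ fun j _ => ?_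
  have h := (isSymbol_coord j).mul (fun x => by positivity) (fun x => by positivity)
    (isSymbol_average continuous_id continuous_scaling (hB.isSymbol j k))
  simpa using h

lemma IsRegularMagneticField.fderiv_potential (hB : IsRegularMagneticField B) (k : Fin d)
    (x e : Pos d) :
    fderiv ℝ (fun x => potential B x k) x e
      = ∑ j, (e j * average id (scaling d) (fun x => B x j k) x
        + x j * ∫ s in (0 : ℝ)..1, s ^ 2 * fderiv ℝ (fun x => B x j k) (s • x) e) := by
  have h : ∀ j, HasFDerivAt (fun x : Pos d => x j * average id (scaling d) (fun x => B x j k) x)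
      (x j • fderiv ℝ (average id (scaling d) (fun x => B x j k)) x
        + average id (scaling d) (fun x => B x j k) x •
          (EuclideanSpace.proj j : Pos d →L[ℝ] ℝ)) x :=
    fun j => (EuclideanSpace.proj j : Pos d →L[ℝ] ℝ).hasFDerivAt.mul
      ((isSymbol_average continuous_id continuous_scaling (hB.isSymbol j k)).differentiable
        x).hasFDerivAt
  rw [potential_eq, (HasFDerivAt.fun_sum fun j _ => h j).fderiv, sum_apply]
  refine Finset.sum_congr rfl fun j _ => ?_
  rw [add_apply, smul_apply, smul_apply,
    fderiv_average continuous_id continuous_scaling (hB.isSymbol j k)]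
  have : ∀ s : ℝ, id s * fderiv ℝ (fun x => B x j k) (scaling d s x) (scaling d s e)
      = s ^ 2 * fderiv ℝ (fun x => B x j k) (s • x) e := by
    intro s
    rw [scaling_apply, scaling_apply, map_smul, smul_eq_mul, id]
    ring
  simp only [this, smul_eq_mul]
  change _ + _ * e j = _
  ring

/-- The potential in the transversal gauge is a primitive of the magnetic field. By closedness the
exterior derivative of the potential at `x` is `∫_0^1 (d/ds) (s² B(s x)) ds`. -/
lemma IsRegularMagneticField.fderiv_potential_sub (hB : IsRegularMagneticField B) (i k : Fin d)
    (x : Pos d) :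
    fderiv ℝ (fun x => potential B x k) x (EuclideanSpace.single i 1)
      - fderiv ℝ (fun x => potential B x i) x (EuclideanSpace.single k 1) = B x i k := by
  have hcont : ∀ (j l : Fin d) (e : Pos d), Continuous (fun s : ℝ =>
      fderiv ℝ (fun x => B x j l) (s • x) e) := fun j l e =>
    (((hB.isSymbol j l).fderiv_apply e).contDiff.continuous).comp
      (continuous_id.smul continuous_const)
  have hB' : Continuous (fun s : ℝ => B (s • x) i k) :=
    (hB.smooth i k).continuous.comp (continuous_id.smul continuous_const)
  have hB2 : IntervalIntegrable (fun s : ℝ => 2 * s * B (s • x) i k) volume 0 1 :=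
    ((continuous_const.mul continuous_id).mul hB').intervalIntegrable _ _
  have hftc : ∫ s in (0 : ℝ)..1, (2 * s * B (s • x) i k
      + s ^ 2 * fderiv ℝ (fun x => B x i k) (s • x) x) = B x i k := by
    have hd : ∀ s : ℝ, HasDerivAt (fun s : ℝ => s ^ 2 * B (s • x) i k)
        (2 * s * B (s • x) i k + s ^ 2 * fderiv ℝ (fun x => B x i k) (s • x) x) s := by
      intro s
      have h1 : HasDerivAt (fun s : ℝ => B (s • x) i k)
          (fderiv ℝ (fun x => B x i k) (s • x) x) s := by
        have := ((hB.isSymbol i k).differentiable (s • x)).hasFDerivAt.comp_hasDerivAt s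
          ((hasDerivAt_id s).smul_const x)
        exact this.congr_deriv (by rw [one_smul])
      exact ((hasDerivAt_pow 2 s).mul h1).congr_deriv (by simp)
    rw [intervalIntegral.integral_eq_sub_of_hasDerivAt (fun s _ => hd s)
      ((((continuous_const.mul continuous_id).mul hB').add
        ((continuous_pow 2).mul (hcont i k x))).intervalIntegrable _ _)]
    simp
  rw [hB.fderiv_potential, hB.fderiv_potential, ← Finset.sum_sub_distrib, ← hftc]
  have hsum : ∀ s : ℝ, fderiv ℝ (fun x => B x i k) (s • x) x
      = ∑ j, x j * (fderiv ℝ (fun x => B x j k) (s • x) (EuclideanSpace.single i 1)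
        - fderiv ℝ (fun x => B x j i) (s • x) (EuclideanSpace.single k 1)) := by
    intro s
    have hx : x = ∑ j, x j • EuclideanSpace.single j (1 : ℝ) := by
      ext l
      simp [Finset.sum_apply, Pi.single_apply]
    have hanti : ∀ j l, (fun x => B x j l) = fun x => -B x l j :=
      fun j l => funext fun x => hB.antisymm x j l
    conv_lhs => rw [hx, map_sum]
    refine Finset.sum_congr rfl fun j _ => ?_
    rw [map_smul, smul_eq_mul]
    congr 1
    have h := hB.closed (s • x) i j k
    rw [hanti k i, hanti i j, fderiv_fun_neg, fderiv_fun_neg, neg_apply, neg_apply] at h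
    rw [← hx]
    linarith
  have hi : ∀ j, IntervalIntegrable (fun s : ℝ => s ^ 2 * (x j * (
      fderiv ℝ (fun x => B x j k) (s • x) (EuclideanSpace.single i 1)
        - fderiv ℝ (fun x => B x j i) (s • x) (EuclideanSpace.single k 1)))) volume 0 1 := fun j =>
    Continuous.intervalIntegrable (by
      have := hcont j k (EuclideanSpace.single i 1)
      have := hcont j i (EuclideanSpace.single k 1)
      fun_prop) _ _
  have hi2 : ∀ (j l : Fin d) (e : Pos d), IntervalIntegrable (fun s : ℝ =>
      s ^ 2 * fderiv ℝ (fun x => B x j l) (s • x) e) volume 0 1 := fun j l e =>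
    Continuous.intervalIntegrable (by have := hcont j l e; fun_prop) _ _
  simp only [hsum, Finset.mul_sum]
  have hsi : IntervalIntegrable (fun s : ℝ => ∑ j, s ^ 2 * (x j * (
      fderiv ℝ (fun x => B x j k) (s • x) (EuclideanSpace.single i 1)
        - fderiv ℝ (fun x => B x j i) (s • x) (EuclideanSpace.single k 1)))) volume 0 1 := by
    simpa only [Finset.sum_fn] using IntervalIntegrable.sum Finset.univ fun j _ => hi j
  rw [intervalIntegral.integral_add hB2 hsi,
    intervalIntegral.integral_finsetSum fun j _ => hi j]
  have havg : ∀ j l, average id (scaling d) (fun x => B x j l) x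
      = ∫ s in (0 : ℝ)..1, s * B (s • x) j l := fun j l => rfl
  have hdiag : ∫ s in (0 : ℝ)..1, 2 * s * B (s • x) i k
      = average id (scaling d) (fun x => B x i k) x
        - average id (scaling d) (fun x => B x k i) x := by
    rw [havg, havg, ← intervalIntegral.integral_sub]
    · refine intervalIntegral.integral_congr fun s _ => ?_
      simp only [hB.antisymm (s • x) k i]
      ring
    · exact (continuous_id.mul hB').intervalIntegrable _ _
    · exact (continuous_id.mul ((hB.smooth k i).continuous.comp
        (continuous_id.smul continuous_const))).intervalIntegrable _ _
  rw [hdiag]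
  have hpt : ∀ j, ∫ s in (0 : ℝ)..1, s ^ 2 * (x j * (
      fderiv ℝ (fun x => B x j k) (s • x) (EuclideanSpace.single i 1)
        - fderiv ℝ (fun x => B x j i) (s • x) (EuclideanSpace.single k 1)))
      = x j * (∫ s in (0 : ℝ)..1, s ^ 2 *
          fderiv ℝ (fun x => B x j k) (s • x) (EuclideanSpace.single i 1))
        - x j * ∫ s in (0 : ℝ)..1, s ^ 2 *
          fderiv ℝ (fun x => B x j i) (s • x) (EuclideanSpace.single k 1) := by
    intro j
    rw [← mul_sub, ← intervalIntegral.integral_sub (hi2 _ _ _) (hi2 _ _ _),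
      ← intervalIntegral.integral_const_mul]
    refine intervalIntegral.integral_congr fun s _ => ?_
    simp only
    ring
  simp only [hpt]
  have hs1 : ∀ (i : Fin d) (c : Fin d → ℝ),
      ∑ j, (EuclideanSpace.single i (1 : ℝ) : Pos d) j * c j = c i := by
    intro i c
    simp
  rw [← hs1 i fun j => average id (scaling d) (fun x => B x j k) x,
    ← hs1 k fun j => average id (scaling d) (fun x => B x j i) x,
    ← Finset.sum_sub_distrib, ← Finset.sum_add_distrib]
  exact Finset.sum_congr rfl fun j _ => by ring

/-! ### The circulation along a segment -/

/-- The points `q + (s - 1/2) v` of the segment from `q - v/2` to `q + v/2`. -/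
def segmentPoint (d : ℕ) (s : ℝ) : PosPair d →L[ℝ] Pos d :=
  ContinuousLinearMap.fst ℝ (Pos d) (Pos d)
    + (s - 2⁻¹) • ContinuousLinearMap.snd ℝ (Pos d) (Pos d)

lemma segmentPoint_apply (s : ℝ) (z : PosPair d) :
    segmentPoint d s z = z.1 + (s - 2⁻¹) • z.2 := rfl

lemma continuous_segmentPoint : Continuous (segmentPoint d) :=
  continuous_const.add ((continuous_id.sub continuous_const).smul continuous_const)

/-- The mean of a function over the segment from `q - v/2` to `q + v/2`. -/
def segmentMean (f : Pos d → ℝ) : PosPair d → ℝ := average (fun _ => 1) (segmentPoint d) f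

lemma isSymbol_segmentMean {f : Pos d → ℝ} {k : ℕ} (hf : IsSymbol (fun x => (1 + ‖x‖) ^ k) f) :
    IsSymbol (fun z : PosPair d => (1 + ‖z‖) ^ k) (segmentMean f) :=
  isSymbol_average continuous_const continuous_segmentPoint hf

/-- The circulation `φ(q + v/2, q - v/2)` in midpoint coordinates. -/
def midCirculation (B : Pos d → Fin d → Fin d → ℝ) (z : PosPair d) : ℝ :=
  ∑ k, z.2 k * segmentMean (fun x => potential B x k) z

lemma IsRegularMagneticField.circulation_eq (hB : IsRegularMagneticField B) (q v : Pos d) :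
    circulation B (q + (2⁻¹ : ℝ) • v) (q - (2⁻¹ : ℝ) • v) = midCirculation B (q, v) := by
  have hv : q + (2⁻¹ : ℝ) • v - (q - (2⁻¹ : ℝ) • v) = v := by module
  have hp : ∀ s : ℝ, q - (2⁻¹ : ℝ) • v + s • v = segmentPoint d s (q, v) := by
    intro s
    rw [segmentPoint_apply]
    module
  have hk : ∀ k, (q + (2⁻¹ : ℝ) • v) k - (q - (2⁻¹ : ℝ) • v) k = v k := fun k =>
    congrArg (fun w : Pos d => w k) hv
  rw [circulation, midCirculation]
  simp only [hv, hp, hk]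
  rw [intervalIntegral.integral_finsetSum]
  · refine Finset.sum_congr rfl fun k _ => ?_
    rw [segmentMean, average, intervalIntegral.integral_mul_const, mul_comm]
    simp only [one_mul]
  · intro k _
    have h1 := (hB.isSymbol_potential k).contDiff.continuous
    have h2 : Continuous fun s => segmentPoint d s (q, v) :=
      continuous_segmentPoint.clm_apply continuous_const
    exact ((h1.comp h2).mul continuous_const).intervalIntegrable _ _

lemma IsRegularMagneticField.isSymbol_midCirculation (hB : IsRegularMagneticField B) :
    IsSymbol (fun z => (1 + ‖z‖) ^ 2) (midCirculation B) := by
  refine IsSymbol.sum _ fun k _ => ?_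
  have h := (IsSymbol.of_clm ((EuclideanSpace.proj k : Pos d →L[ℝ] ℝ).comp
      (ContinuousLinearMap.snd ℝ (Pos d) (Pos d)))).mul
    (fun x => by positivity) (fun x => by positivity)
    (isSymbol_segmentMean (hB.isSymbol_potential k))
  simpa [pow_two] using h

/-- The derivative of the circulation when the segment is translated: up to the values of the
potential at the end points it is the flux of the field through the swept strip. -/
lemma IsRegularMagneticField.fderiv_midCirculation (hB : IsRegularMagneticField B) (j : Fin d)
    (q v : Pos d) :
    fderiv ℝ (midCirculation B) (q, v) (EuclideanSpace.single j 1, 0)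
      = potential B (q + (2⁻¹ : ℝ) • v) j - potential B (q - (2⁻¹ : ℝ) • v) j
        + ∑ k, v k * segmentMean (fun x => B x j k) (q, v) := by
  have h : ∀ k : Fin d, HasFDerivAt
      (fun z : PosPair d => z.2 k * segmentMean (fun x => potential B x k) z)
      (v k • fderiv ℝ (segmentMean fun x => potential B x k) (q, v)
        + segmentMean (fun x => potential B x k) (q, v) •
          ((EuclideanSpace.proj k : Pos d →L[ℝ] ℝ).comp
            (ContinuousLinearMap.snd ℝ (Pos d) (Pos d)) : PosPair d →L[ℝ] ℝ)) (q, v) := fun k =>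
    ((EuclideanSpace.proj k : Pos d →L[ℝ] ℝ).comp
      (ContinuousLinearMap.snd ℝ (Pos d) (Pos d))).hasFDerivAt.mul
      ((isSymbol_segmentMean (hB.isSymbol_potential k)).differentiable (q, v)).hasFDerivAt
  have hfd : fderiv ℝ (midCirculation B) (q, v) = _ := (HasFDerivAt.fun_sum fun k _ => h k).fderiv
  have hcont : ∀ (k : Fin d) (e : Pos d), Continuous (fun s : ℝ =>
      fderiv ℝ (fun x => potential B x k) (segmentPoint d s (q, v)) e) := fun k e =>
    (((hB.isSymbol_potential k).fderiv_apply e).contDiff.continuous).comp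
      (continuous_segmentPoint.clm_apply continuous_const)
  have hseg : ∀ s, segmentPoint d s (EuclideanSpace.single j (1 : ℝ), (0 : Pos d))
      = EuclideanSpace.single j 1 := fun s => by simp [segmentPoint_apply]
  have hleft : fderiv ℝ (midCirculation B) (q, v) (EuclideanSpace.single j 1, 0)
      = ∑ k, v k * ∫ s in (0 : ℝ)..1, fderiv ℝ (fun x => potential B x k)
          (segmentPoint d s (q, v)) (EuclideanSpace.single j 1) := by
    rw [hfd, sum_apply]
    refine Finset.sum_congr rfl fun k _ => ?_
    rw [add_apply, smul_apply, smul_apply, segmentMean, fderiv_average continuous_const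
      continuous_segmentPoint (hB.isSymbol_potential k)]
    simp [hseg]
  have hends : potential B (q + (2⁻¹ : ℝ) • v) j - potential B (q - (2⁻¹ : ℝ) • v) j
      = ∑ k, v k * ∫ s in (0 : ℝ)..1, fderiv ℝ (fun x => potential B x j)
          (segmentPoint d s (q, v)) (EuclideanSpace.single k 1) := by
    have hd : ∀ s : ℝ, HasDerivAt (fun s : ℝ => potential B (segmentPoint d s (q, v)) j)
        (∑ k, v k * fderiv ℝ (fun x => potential B x j) (segmentPoint d s (q, v))
          (EuclideanSpace.single k 1)) s := by
      intro s
      have h1 : HasDerivAt (fun s : ℝ => segmentPoint d s (q, v)) v s := by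
        have := (((hasDerivAt_id s).sub_const (2⁻¹ : ℝ)).smul_const v).const_add q
        simpa [segmentPoint_apply] using this
      have h2 := ((hB.isSymbol_potential j).differentiable _).hasFDerivAt.comp_hasDerivAt s h1
      refine h2.congr_deriv ?_
      have hx : v = ∑ k, v k • EuclideanSpace.single k (1 : ℝ) := by
        ext l
        simp [Finset.sum_apply, Pi.single_apply]
      conv_lhs => rw [hx, map_sum]
      rw [← hx]
      simp only [map_smul, smul_eq_mul]
    have h1 : segmentPoint d 1 (q, v) = q + (2⁻¹ : ℝ) • v := by
      rw [segmentPoint_apply]; norm_num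
    have h0 : segmentPoint d 0 (q, v) = q - (2⁻¹ : ℝ) • v := by
      rw [segmentPoint_apply]; norm_num [sub_eq_add_neg]
    rw [← h1, ← h0, ← intervalIntegral.integral_eq_sub_of_hasDerivAt (fun s _ => hd s)
      (Continuous.intervalIntegrable (by fun_prop) _ _), intervalIntegral.integral_finsetSum]
    · exact Finset.sum_congr rfl fun k _ => intervalIntegral.integral_const_mul _ _
    · exact fun k _ => Continuous.intervalIntegrable (by fun_prop) _ _
  rw [hleft, hends, ← Finset.sum_add_distrib]
  refine Finset.sum_congr rfl fun k _ => ?_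
  rw [← mul_add, segmentMean, average]
  congr 1
  rw [← sub_eq_iff_eq_add', ← intervalIntegral.integral_sub
    ((hcont k _).intervalIntegrable _ _) ((hcont j _).intervalIntegrable _ _)]
  refine intervalIntegral.integral_congr fun s _ => ?_
  simp only [one_mul]
  exact hB.fderiv_potential_sub j k _

end Magnetic

/-! ### The magnetic phase factor -/

lemma hasTemperateGrowth_exp_I_mul :
    Function.HasTemperateGrowth (fun t : ℝ => Complex.exp (Complex.I * (t : ℂ))) := by
  have hd : ∀ t : ℝ, HasDerivAt (fun t : ℝ => Complex.exp (Complex.I * (t : ℂ)))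
      (Complex.I * Complex.exp (Complex.I * (t : ℂ))) t := fun t =>
    (((hasDerivAt_id t).ofReal_comp.const_mul Complex.I).cexp).congr_deriv (by simp [mul_comm])
  have hs : ContDiff ℝ ∞ (fun t : ℝ => Complex.exp (Complex.I * (t : ℂ))) :=
    (contDiff_const.mul Complex.ofRealCLM.contDiff).cexp
  have hb : ∀ n : ℕ, iteratedDeriv n (fun t : ℝ => Complex.exp (Complex.I * (t : ℂ)))
      = fun t : ℝ => Complex.I ^ n * Complex.exp (Complex.I * (t : ℂ)) := by
    intro n
    induction n with
    | zero => ext t; simp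
    | succ n ih =>
      rw [iteratedDeriv_succ, ih]
      ext t
      rw [((hd t).const_mul (Complex.I ^ n)).deriv]
      ring
  refine ⟨hs, fun n => ⟨0, 1, fun t => ?_⟩⟩
  rw [norm_iteratedFDeriv_eq_norm_iteratedDeriv, hb]
  simp

/-- The difference of the circulations along the left and the right segment. -/
def superCirculation (B : Pos d → Fin d → Fin d → ℝ) (X : SuperPhase d) : ℝ :=
  midCirculation B X.1 - midCirculation B X.2

/-- The magnetic phase factor in midpoint coordinates. -/
def phaseFactor (B : Pos d → Fin d → Fin d → ℝ) (X : SuperPhase d) : ℂ :=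
  Complex.exp (Complex.I * (superCirculation B X : ℂ))

variable {B : Pos d → Fin d → Fin d → ℝ}

lemma IsRegularMagneticField.hasTemperateGrowth_phaseFactor (hB : IsRegularMagneticField B) :
    Function.HasTemperateGrowth (phaseFactor B) := by
  have h := hB.isSymbol_midCirculation.hasTemperateGrowth
  have h1 : Function.HasTemperateGrowth (fun X : SuperPhase d => midCirculation B X.1) :=
    h.comp (ContinuousLinearMap.fst ℝ (PosPair d) (PosPair d)).hasTemperateGrowth
  have h2 : Function.HasTemperateGrowth (fun X : SuperPhase d => midCirculation B X.2) :=
    h.comp (ContinuousLinearMap.snd ℝ (PosPair d) (PosPair d)).hasTemperateGrowth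
  exact hasTemperateGrowth_exp_I_mul.comp (h1.sub h2)

lemma IsRegularMagneticField.hasFDerivAt_phaseFactor (hB : IsRegularMagneticField B)
    (X : SuperPhase d) :
    HasFDerivAt (phaseFactor B) ((Complex.I * phaseFactor B X) • (Complex.ofRealCLM.comp
      ((fderiv ℝ (midCirculation B) X.1).comp (ContinuousLinearMap.fst ℝ (PosPair d) (PosPair d))
        - (fderiv ℝ (midCirculation B) X.2).comp
          (ContinuousLinearMap.snd ℝ (PosPair d) (PosPair d))))) X := by
  have hγ := hB.isSymbol_midCirculation.differentiable
  have h : HasFDerivAt (superCirculation B)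
      ((fderiv ℝ (midCirculation B) X.1).comp (ContinuousLinearMap.fst ℝ (PosPair d) (PosPair d))
        - (fderiv ℝ (midCirculation B) X.2).comp
          (ContinuousLinearMap.snd ℝ (PosPair d) (PosPair d))) X :=
    ((hγ X.1).hasFDerivAt.comp X
      (ContinuousLinearMap.fst ℝ (PosPair d) (PosPair d)).hasFDerivAt).sub
      ((hγ X.2).hasFDerivAt.comp X (ContinuousLinearMap.snd ℝ (PosPair d) (PosPair d)).hasFDerivAt)
  have h2 := ((Complex.ofRealCLM.hasFDerivAt.comp X h).const_mul Complex.I).cexp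
  refine h2.congr_fderiv ?_
  rw [smul_smul, mul_comm]
  rfl

/-! ### Test functions in midpoint coordinates -/

/-- The passage from midpoint coordinates `((q_L, v_L), (q_R, v_R))` to the end points
`(x_L, (x_R, (y_L, y_R)))` of the left and the right segment. -/
def endpoints (d : ℕ) : SuperPhase d ≃L[ℝ] Pos d × (Pos d × PosPair d) where
  toFun X := (X.1.1 + (2⁻¹ : ℝ) • X.1.2, (X.2.1 + (2⁻¹ : ℝ) • X.2.2,
    (X.1.1 - (2⁻¹ : ℝ) • X.1.2, X.2.1 - (2⁻¹ : ℝ) • X.2.2)))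
  map_add' X Y := by
    refine Prod.ext ?_ (Prod.ext ?_ (Prod.ext ?_ ?_)) <;> simp only [Prod.fst_add, Prod.snd_add] <;>
      module
  map_smul' c X := by
    refine Prod.ext ?_ (Prod.ext ?_ (Prod.ext ?_ ?_)) <;>
      simp only [Prod.smul_fst, Prod.smul_snd, RingHom.id_apply] <;> module
  invFun z := (((2⁻¹ : ℝ) • (z.1 + z.2.2.1), z.1 - z.2.2.1),
    ((2⁻¹ : ℝ) • (z.2.1 + z.2.2.2), z.2.1 - z.2.2.2))
  left_inv X := by
    refine Prod.ext (Prod.ext ?_ ?_) (Prod.ext ?_ ?_) <;> dsimp only <;> module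
  right_inv z := by
    refine Prod.ext ?_ (Prod.ext ?_ (Prod.ext ?_ ?_)) <;> dsimp only <;> module
  continuous_toFun := by fun_prop
  continuous_invFun := by fun_prop

lemma endpoints_apply (X : SuperPhase d) : endpoints d X =
    (X.1.1 + (2⁻¹ : ℝ) • X.1.2, (X.2.1 + (2⁻¹ : ℝ) • X.2.2,
    (X.1.1 - (2⁻¹ : ℝ) • X.1.2, X.2.1 - (2⁻¹ : ℝ) • X.2.2))) := rfl

/-- Transport of a Schwartz function of the end points to midpoint coordinates, followed by
multiplication with the magnetic phase factor. -/
def midpointCLM (B : Pos d → Fin d → Fin d → ℝ) :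
    𝓢(Pos d × (Pos d × PosPair d), ℂ) →L[ℂ] SuperSchw d :=
  (SchwartzMap.smulLeftCLM ℂ (phaseFactor B)).comp
    (SchwartzMap.compCLMOfContinuousLinearEquiv ℂ (endpoints d))

/-- The test function `g(x_L) f(x_R) k_T(y_L, y_R)` in midpoint coordinates, with the magnetic phase
factor. -/
def testFunction (B : Pos d → Fin d → Fin d → ℝ) (T : Smoothing d) (f g : Schw d) : SuperSchw d :=
  midpointCLM B (tensor g (tensor f (kernelCLM d T)))

/-- The test function without the magnetic phase factor. -/
def amplitude (T : Smoothing d) (f g : Schw d) (X : SuperPhase d) : ℂ :=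
  tensor g (tensor f (kernelCLM d T)) (endpoints d X)

lemma amplitude_apply (T : Smoothing d) (f g : Schw d) (X : SuperPhase d) :
    amplitude T f g X = g (X.1.1 + (2⁻¹ : ℝ) • X.1.2) * (f (X.2.1 + (2⁻¹ : ℝ) • X.2.2) *
      T (dirac (X.2.1 - (2⁻¹ : ℝ) • X.2.2)) (X.1.1 - (2⁻¹ : ℝ) • X.1.2)) := rfl

lemma IsRegularMagneticField.testFunction_apply (hB : IsRegularMagneticField B) (T : Smoothing d)
    (f g : Schw d) (X : SuperPhase d) :
    testFunction B T f g X = phaseFactor B X * amplitude T f g X :=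
  SchwartzMap.smulLeftCLM_apply_apply hB.hasTemperateGrowth_phaseFactor _ X

/-! ### Existence of the quantization -/

/-- The normalization of the magnetic super Weyl transform. -/
def weylConst (d : ℕ) : ℂ := ((2 * Real.pi : ℂ) ^ (2 * d))⁻¹

lemma IsRegularMagneticField.superWeylPairing_eq (hB : IsRegularMagneticField B)
    (Φ : SuperPhase d → ℂ) (T : Smoothing d) (f g : Schw d) :
    superWeylPairing B Φ (fun xL xR yL yR => g xL * f xR * smoothingKernel T yL yR)
      = weylConst d * superPairing Φ (testFunction B T f g) := by
  have h : ∀ X, superWeylTranspose B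
      (fun xL xR yL yR => g xL * f xR * smoothingKernel T yL yR) X
      = weylConst d * fibreFourier (testFunction B T f g) X := by
    intro X
    rw [superWeylTranspose, weylConst, fibreFourier]
    congr 1
    refine integral_congr_ae (Eventually.of_forall fun v => ?_)
    simp only [hB.circulation_eq, hB.testFunction_apply, amplitude_apply, phaseFactor,
      superCirculation, smoothingKernel, phasePairing, fibrePart_apply, basePart_apply, assemble]
    ring
  rw [superWeylPairing, superPairing, ← integral_const_mul]
  refine integral_congr_ae (Eventually.of_forall fun X => ?_)
  simp only [h]
  ring

lemma IsRegularMagneticField.isSuperQuantization_iff (hB : IsRegularMagneticField B)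
    {Φ : SuperPhase d → ℂ} {𝔗 : SuperOp d} : IsSuperQuantization B Φ 𝔗 ↔
      ∀ T f g, 𝔗 T f g = weylConst d * superPairing Φ (testFunction B T f g) := by
  simp only [IsSuperQuantization, hB.superWeylPairing_eq]

/-- Every symbol of polynomial growth has a quantization: `(T, f, g) ↦ ⟨K^A Φ, g ⊗ f ⊗ k_T⟩` is
obtained by currying a tempered distribution twice, and `k_T` depends continuously on `T`. -/
lemma IsRegularMagneticField.exists_isSuperQuantization (hB : IsRegularMagneticField B)
    {Φ : SuperPhase d → ℂ} (hΦ : PolyBounded Φ) : ∃ 𝔗 : SuperOp d, IsSuperQuantization B Φ 𝔗 :=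
  ⟨(curryTensor (curryTensor (weylConst d • hΦ.pairingCLM.comp (midpointCLM B)))).comp
    (kernelCLM d), hB.isSuperQuantization_iff.2 fun _ _ _ => rfl⟩

/-! ### Operators on test functions which act on symbols -/

/-- The operator `D` on test functions is, for the pairing with symbols, the transpose of an
operator which preserves the symbols of weight `M`. -/
def ActsOnSymbols (M : SuperPhase d → ℝ) (D : SuperSchw d →L[ℂ] SuperSchw d) : Prop :=
  ∀ Φ, IsSymbol M Φ → ∃ Ψ, IsSymbol M Ψ ∧ ∀ F, superPairing Φ (D F) = superPairing Ψ F

section ActsOnSymbols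

variable {M : SuperPhase d → ℝ} {D D' : SuperSchw d →L[ℂ] SuperSchw d}

lemma ActsOnSymbols.comp (hD : ActsOnSymbols M D) (hD' : ActsOnSymbols M D') :
    ActsOnSymbols M (D.comp D') := by
  intro Φ hΦ
  obtain ⟨Ψ, hΨ, h⟩ := hD Φ hΦ
  obtain ⟨Ψ', hΨ', h'⟩ := hD' Ψ hΨ
  exact ⟨Ψ', hΨ', fun F => (h _).trans (h' F)⟩

lemma ActsOnSymbols.smul (c : ℂ) (hD : ActsOnSymbols M D) : ActsOnSymbols M (c • D) := by
  intro Φ hΦ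
  obtain ⟨Ψ, hΨ, h⟩ := hD Φ hΦ
  refine ⟨fun X => c * Ψ X, hΨ.clm_comp (ContinuousLinearMap.mul ℝ ℂ c), fun F => ?_⟩
  rw [superPairing_smul_left, ← h, ← superPairing_smul_right]
  rfl

lemma ActsOnSymbols.add (hM : IsTemperedWeight M) (hD : ActsOnSymbols M D)
    (hD' : ActsOnSymbols M D') : ActsOnSymbols M (D + D') := by
  intro Φ hΦ
  obtain ⟨Ψ, hΨ, h⟩ := hD Φ hΦ
  obtain ⟨Ψ', hΨ', h'⟩ := hD' Φ hΦ
  refine ⟨fun X => Ψ X + Ψ' X, hΨ.add hΨ', fun F => ?_⟩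
  rw [PolyBounded.superPairing_add_left (hΨ.polyBounded hM) (hΨ'.polyBounded hM), ← h, ← h',
    ← PolyBounded.superPairing_add_right (hΦ.polyBounded hM)]
  rfl

lemma ActsOnSymbols.zero : ActsOnSymbols M (0 : SuperSchw d →L[ℂ] SuperSchw d) := fun _ _ =>
  ⟨fun _ => 0, IsSymbol.zero, fun F => by simp [superPairing, fibreFourier]⟩

lemma ActsOnSymbols.sum (hM : IsTemperedWeight M) {ι : Type*} (s : Finset ι)
    {D : ι → SuperSchw d →L[ℂ] SuperSchw d} (hD : ∀ i, ActsOnSymbols M (D i)) :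
    ActsOnSymbols M (∑ i ∈ s, D i) := by
  classical
  induction s using Finset.induction_on with
  | empty => simpa using ActsOnSymbols.zero
  | insert a s ha ih =>
    rw [Finset.sum_insert ha]
    exact (hD a).add hM ih

lemma actsOnSymbols_lineDeriv (hM : IsTemperedWeight M) (q : PosPair d) :
    ActsOnSymbols M (LineDeriv.lineDerivOpCLM ℂ (SuperSchw d) (baseEmb q)) := fun Φ hΦ =>
  ⟨fun X => -fderiv ℝ Φ X (baseEmb q), (hΦ.fderiv_apply _).neg, fun F => by
    have h := superPairing_base_fderiv hM hΦ F q
    have h2 := superPairing_smul_left (-1) (fun X => fderiv ℝ Φ X (baseEmb q)) F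
    simp only [neg_one_mul] at h2
    rw [h2, ← h, ← coe_lineDerivOp]
    rfl⟩

/-- Multiplication of test functions by `i (v_L · a_L - v_R · a_R)`. -/
def fibreMul (a : PosPair d) : SuperSchw d →L[ℂ] SuperSchw d :=
  SchwartzMap.smulLeftCLM ℂ (fun X => Complex.I * (phasePairing a (fibrePart X) : ℝ))

lemma fibreMul_apply (a : PosPair d) (F : SuperSchw d) (X : SuperPhase d) :
    fibreMul a F X = Complex.I * (phasePairing a (fibrePart X) : ℝ) * F X :=
  SchwartzMap.smulLeftCLM_apply_apply (hasTemperateGrowth_phasePairing a) F X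

lemma actsOnSymbols_fibreMul (hM : IsTemperedWeight M) (a : PosPair d) :
    ActsOnSymbols M (fibreMul a) := fun Φ hΦ =>
  ⟨fun X => -fderiv ℝ Φ X (fibreEmb a), (hΦ.fderiv_apply _).neg, fun F => by
    have h := superPairing_phase_mul hM hΦ F a
    have h2 := superPairing_smul_left (-1) (fun X => fderiv ℝ Φ X (fibreEmb a)) F
    simp only [neg_one_mul] at h2
    rw [h2, ← h]
    exact congrArg _ (funext fun X => fibreMul_apply a F X)⟩

lemma IsSymbol.hasTemperateGrowth_of_bounded {b : SuperPhase d → ℂ}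
    (hb : IsSymbol (fun _ => 1) b) : Function.HasTemperateGrowth b :=
  IsSymbol.hasTemperateGrowth (k := 0) (by simpa using hb)

lemma actsOnSymbols_smulLeft (hM : IsTemperedWeight M) {b : SuperPhase d → ℂ}
    (hb : IsSymbol (fun _ => 1) b) : ActsOnSymbols M (SchwartzMap.smulLeftCLM ℂ b) := fun Φ hΦ => by
  obtain ⟨Ψ, hΨ, h⟩ := exists_symbol_of_bounded_mul hM hΦ hb
  refine ⟨Ψ, hΨ, fun F => ?_⟩
  rw [← h F]
  exact congrArg _ (funext fun X =>
    SchwartzMap.smulLeftCLM_apply_apply hb.hasTemperateGrowth_of_bounded F X)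

end ActsOnSymbols

/-! ### Commutators with the observables -/

/-- The mean `∫_0^1 B_{jk}(q + (s - 1/2) v) ds` over the left segment. -/
def leftFlux (B : Pos d → Fin d → Fin d → ℝ) (j k : Fin d) (X : SuperPhase d) : ℂ :=
  (segmentMean (fun x => B x j k) X.1 : ℝ)

/-- The mean `∫_0^1 B_{jk}(q + (s - 1/2) v) ds` over the right segment. -/
def rightFlux (B : Pos d → Fin d → Fin d → ℝ) (j k : Fin d) (X : SuperPhase d) : ℂ :=
  (segmentMean (fun x => B x j k) X.2 : ℝ)

lemma IsRegularMagneticField.isSymbol_leftFlux (hB : IsRegularMagneticField B) (j k : Fin d) :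
    IsSymbol (fun _ => 1) (leftFlux B j k) := by
  have h : IsSymbol (fun X : SuperPhase d => (1 + ‖X.1‖) ^ 0) (leftFlux B j k) :=
    ((isSymbol_segmentMean (hB.isSymbol j k)).comp_clm
    (ContinuousLinearMap.fst ℝ (PosPair d) (PosPair d))).clm_comp Complex.ofRealCLM
  simpa using h

lemma IsRegularMagneticField.isSymbol_rightFlux (hB : IsRegularMagneticField B) (j k : Fin d) :
    IsSymbol (fun _ => 1) (rightFlux B j k) := by
  have h : IsSymbol (fun X : SuperPhase d => (1 + ‖X.2‖) ^ 0) (rightFlux B j k) :=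
    ((isSymbol_segmentMean (hB.isSymbol j k)).comp_clm
    (ContinuousLinearMap.snd ℝ (PosPair d) (PosPair d))).clm_comp Complex.ofRealCLM
  simpa using h

/-- The operator on test functions which corresponds to the commutator with a generator. For the
momentum operators it contains the magnetic field, but not the potential. -/
def commutatorOp (B : Pos d → Fin d → Fin d → ℝ) : Generator d → (SuperSchw d →L[ℂ] SuperSchw d)
  | .left (.position j) => (-Complex.I) • fibreMul (EuclideanSpace.single j 1, 0)
  | .right (.position j) => Complex.I • fibreMul (0, EuclideanSpace.single j 1)
  | .left (.momentum j) =>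
      Complex.I • LineDeriv.lineDerivOpCLM ℂ (SuperSchw d) (baseEmb (EuclideanSpace.single j 1, 0))
      + ∑ k, (SchwartzMap.smulLeftCLM ℂ (leftFlux B j k)).comp
          ((-Complex.I) • fibreMul (EuclideanSpace.single k 1, 0))
  | .right (.momentum j) =>
      (-Complex.I) •
        LineDeriv.lineDerivOpCLM ℂ (SuperSchw d) (baseEmb (0, EuclideanSpace.single j 1))
      + ∑ k, (SchwartzMap.smulLeftCLM ℂ (rightFlux B j k)).comp
          (Complex.I • fibreMul (0, EuclideanSpace.single k 1))

lemma IsRegularMagneticField.actsOnSymbols_commutatorOp (hB : IsRegularMagneticField B)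
    {M : SuperPhase d → ℝ} (hM : IsTemperedWeight M) (𝔖 : Generator d) :
    ActsOnSymbols M (commutatorOp B 𝔖) := by
  rcases 𝔖 with (j | j) | (j | j)
  · exact (actsOnSymbols_fibreMul hM _).smul _
  · exact ((actsOnSymbols_lineDeriv hM _).smul _).add hM (ActsOnSymbols.sum hM _ fun k =>
      (actsOnSymbols_smulLeft hM (hB.isSymbol_leftFlux j k)).comp
        ((actsOnSymbols_fibreMul hM _).smul _))
  · exact (actsOnSymbols_fibreMul hM _).smul _
  · exact ((actsOnSymbols_lineDeriv hM _).smul _).add hM (ActsOnSymbols.sum hM _ fun k =>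
      (actsOnSymbols_smulLeft hM (hB.isSymbol_rightFlux j k)).comp
        ((actsOnSymbols_fibreMul hM _).smul _))

lemma neg_I_smul_fibreMul_left (j : Fin d) (F : SuperSchw d) (X : SuperPhase d) :
    ((-Complex.I) • fibreMul (EuclideanSpace.single j 1, 0)) F X = (X.1.2 j : ℂ) * F X := by
  change -Complex.I * fibreMul _ F X = _
  rw [fibreMul_apply]
  simp only [phasePairing, fibrePart_apply, inner_zero_left, sub_zero,
    EuclideanSpace.inner_single_left, map_one, one_mul]
  rw [← mul_assoc, ← mul_assoc, neg_mul, Complex.I_mul_I, neg_neg, one_mul]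

lemma I_smul_fibreMul_right (j : Fin d) (F : SuperSchw d) (X : SuperPhase d) :
    (Complex.I • fibreMul (0, EuclideanSpace.single j 1)) F X = (X.2.2 j : ℂ) * F X := by
  change Complex.I * fibreMul _ F X = _
  rw [fibreMul_apply]
  simp only [phasePairing, fibrePart_apply, inner_zero_left, zero_sub,
    EuclideanSpace.inner_single_left, map_one, one_mul]
  rw [← mul_assoc, ← mul_assoc, Complex.I_mul_I]
  push_cast
  ring

lemma coordMul_apply (j : Fin d) (f : Schw d) (x : Pos d) : coordMul j f x = (x j : ℂ) * f x :=
  SchwartzMap.smulLeftCLM_apply_apply (hasTemperateGrowth_ofReal_comp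
    (EuclideanSpace.proj j : Pos d →L[ℝ] ℝ).hasTemperateGrowth) f x

lemma IsRegularMagneticField.potentialMul_apply (hB : IsRegularMagneticField B) (j : Fin d)
    (f : Schw d) (x : Pos d) : potentialMul B j f x = (potential B x j : ℂ) * f x :=
  SchwartzMap.smulLeftCLM_apply_apply (hasTemperateGrowth_ofReal_comp
    (hB.isSymbol_potential j).hasTemperateGrowth) f x

lemma dirac_comp_coordMul (j : Fin d) (y : Pos d) :
    (dirac y).comp (coordMul j) = (y j : ℂ) • dirac y :=
  ContinuousLinearMap.ext fun f => coordMul_apply j f y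

lemma IsRegularMagneticField.dirac_comp_transpose_momentum (hB : IsRegularMagneticField B)
    (j : Fin d) (y : Pos d) : (dirac y).comp ((Observable.momentum j).transpose B)
      = Complex.I • diracDeriv j y - (potential B y j : ℂ) • dirac y :=
  ContinuousLinearMap.ext fun f =>
    congrArg (fun c => Complex.I * partialDeriv j f y - c) (hB.potentialMul_apply j f y)

lemma fderiv_tensor {E F : Type*} [NormedAddCommGroup E] [NormedSpace ℝ E] [NormedAddCommGroup F]
    [NormedSpace ℝ F] (f : 𝓢(E, ℂ)) (g : 𝓢(F, ℂ)) (z w : E × F) :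
    fderiv ℝ (tensor f g) z w = fderiv ℝ f z.1 w.1 * g z.2 + f z.1 * fderiv ℝ g z.2 w.2 := by
  have h1 := (f.hasFDerivAt z.1).comp z (ContinuousLinearMap.fst ℝ E F).hasFDerivAt
  have h2 := (g.hasFDerivAt z.2).comp z (ContinuousLinearMap.snd ℝ E F).hasFDerivAt
  have h : HasFDerivAt (tensor f g) _ z := h1.mul h2
  rw [h.fderiv]
  simp only [add_apply, smul_apply, smul_eq_mul]
  change f z.1 * fderiv ℝ g z.2 w.2 + g z.2 * fderiv ℝ f z.1 w.1 = _
  ring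

lemma fderiv_kernelCLM (T : Smoothing d) (z w : PosPair d) :
    fderiv ℝ (kernelCLM d T) z w = ∑ i, (pairCoord i w : ℂ) * pairKernel (kernelDeriv i T) z := by
  have h : HasFDerivAt (kernelCLM d T) _ z := hasFDerivAt_pairKernel T z
  rw [h.fderiv, sum_apply]
  rfl

lemma fderiv_kernelCLM_left (T : Smoothing d) (z : PosPair d) (j : Fin d) :
    fderiv ℝ (kernelCLM d T) z (EuclideanSpace.single j 1, 0)
      = partialDeriv j (T (dirac z.2)) z.1 := by
  rw [fderiv_kernelCLM, Fintype.sum_sum_type]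
  simp [pairCoord, pairKernel_kernelDeriv_inl, apply_ite]

lemma fderiv_kernelCLM_right (T : Smoothing d) (z : PosPair d) (j : Fin d) :
    fderiv ℝ (kernelCLM d T) z (0, EuclideanSpace.single j 1)
      = T (diracDeriv j z.2) z.1 := by
  rw [fderiv_kernelCLM, Fintype.sum_sum_type]
  simp [pairCoord, pairKernel_kernelDeriv_inr, apply_ite]

lemma IsRegularMagneticField.fderiv_testFunction (hB : IsRegularMagneticField B) (T : Smoothing d)
    (f g : Schw d) (X e : SuperPhase d) :
    fderiv ℝ (testFunction B T f g) X e
      = phaseFactor B X * (fderiv ℝ (tensor g (tensor f (kernelCLM d T))) (endpoints d X)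
          (endpoints d e))
        + Complex.I *
          (fderiv ℝ (midCirculation B) X.1 e.1 - fderiv ℝ (midCirculation B) X.2 e.2 : ℝ)
          * testFunction B T f g X := by
  have h1 := ((tensor g (tensor f (kernelCLM d T))).hasFDerivAt (endpoints d X)).comp X
    (endpoints d).hasFDerivAt
  have h2 : HasFDerivAt (testFunction B T f g) _ X :=
    ((hB.hasFDerivAt_phaseFactor X).mul h1).congr_of_eventuallyEq
      (Eventually.of_forall fun X => hB.testFunction_apply T f g X)
  rw [h2.fderiv, hB.testFunction_apply]
  simp only [add_apply, smul_apply, smul_eq_mul]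
  change _ * fderiv ℝ (tensor g (tensor f (kernelCLM d T))) (endpoints d X) (endpoints d e)
    + amplitude T f g X * (Complex.I * phaseFactor B X *
      ((fderiv ℝ (midCirculation B) X.1 e.1 - fderiv ℝ (midCirculation B) X.2 e.2 : ℝ) : ℂ)) = _
  ring

/-- Translating the left segment along `e_j` differentiates `g` at `x_L`, the kernel at `y_L`, and
the magnetic phase, whose derivative is the difference of the values of `A_j` at `x_L` and `y_L`
plus the flux of the field. -/
lemma IsRegularMagneticField.fderiv_testFunction_left (hB : IsRegularMagneticField B)
    (T : Smoothing d) (f g : Schw d) (X : SuperPhase d) (j : Fin d) :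
    fderiv ℝ (testFunction B T f g) X (baseEmb (EuclideanSpace.single j 1, 0))
      = testFunction B T f (partialDeriv j g) X
        + testFunction B (kernelDeriv (.inl j) T) f g X
        + Complex.I * ((potential B (X.1.1 + (2⁻¹ : ℝ) • X.1.2) j : ℂ)
            - potential B (X.1.1 - (2⁻¹ : ℝ) • X.1.2) j
            + ∑ k, (X.1.2 k : ℂ) * leftFlux B j k X) * testFunction B T f g X := by
  have hend : endpoints d (baseEmb (EuclideanSpace.single j (1 : ℝ), 0))
      = (EuclideanSpace.single j 1, (0, (EuclideanSpace.single j 1, 0))) := by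
    simp [endpoints_apply, baseEmb_apply]
  rw [hB.fderiv_testFunction, hend, fderiv_tensor, fderiv_tensor, baseEmb_apply]
  simp only [map_zero, zero_mul, zero_add, endpoints_apply, fderiv_kernelCLM_left]
  have hγ : fderiv ℝ (midCirculation B) X.2 ((0 : Pos d), (0 : Pos d)) = 0 := map_zero _
  rw [hγ, sub_zero, hB.fderiv_midCirculation, hB.testFunction_apply, hB.testFunction_apply,
    hB.testFunction_apply, amplitude_apply, amplitude_apply, amplitude_apply]
  simp only [tensor_apply, kernelCLM_apply, smoothingKernel, leftFlux]
  change _ = phaseFactor B X * _ + phaseFactor B X * (_ * (_ *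
    partialDeriv j (T (dirac (X.2.1 - (2⁻¹ : ℝ) • X.2.2))) (X.1.1 - (2⁻¹ : ℝ) • X.1.2))) + _
  simp only [partialDeriv_apply]
  push_cast
  ring

lemma IsRegularMagneticField.fderiv_testFunction_right (hB : IsRegularMagneticField B)
    (T : Smoothing d) (f g : Schw d) (X : SuperPhase d) (j : Fin d) :
    fderiv ℝ (testFunction B T f g) X (baseEmb (0, EuclideanSpace.single j 1))
      = testFunction B T (partialDeriv j f) g X
        + testFunction B (kernelDeriv (.inr j) T) f g X
        - Complex.I * ((potential B (X.2.1 + (2⁻¹ : ℝ) • X.2.2) j : ℂ)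
            - potential B (X.2.1 - (2⁻¹ : ℝ) • X.2.2) j
            + ∑ k, (X.2.2 k : ℂ) * rightFlux B j k X) * testFunction B T f g X := by
  have hend : endpoints d (baseEmb (0, EuclideanSpace.single j (1 : ℝ)))
      = (0, (EuclideanSpace.single j 1, (0, EuclideanSpace.single j 1))) := by
    simp [endpoints_apply, baseEmb_apply]
  rw [hB.fderiv_testFunction, hend, fderiv_tensor, fderiv_tensor, baseEmb_apply]
  simp only [map_zero, zero_mul, zero_add, endpoints_apply, fderiv_kernelCLM_right]
  have hγ : fderiv ℝ (midCirculation B) X.1 ((0 : Pos d), (0 : Pos d)) = 0 := map_zero _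
  rw [hγ, zero_sub, hB.fderiv_midCirculation, hB.testFunction_apply, hB.testFunction_apply,
    hB.testFunction_apply, amplitude_apply, amplitude_apply, amplitude_apply]
  simp only [kernelCLM_apply, smoothingKernel, rightFlux]
  change _ = phaseFactor B X * _ + phaseFactor B X * (_ * (_ *
    T (diracDeriv j (X.2.1 - (2⁻¹ : ℝ) • X.2.2)) (X.1.1 - (2⁻¹ : ℝ) • X.1.2))) - _
  simp only [partialDeriv_apply]
  push_cast
  ring

/-- The two terms of the commutator with a generator, on the level of test functions. For the
momentum operators, the difference of the values of the potential at the end points of the segment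
cancels against the derivative of the magnetic phase, and only the flux of the field is left. -/
lemma IsRegularMagneticField.commutatorOp_testFunction (hB : IsRegularMagneticField B)
    (𝔖 : Generator d) (T : Smoothing d) (f g : Schw d) :
    commutatorOp B 𝔖 (testFunction B T f g) + testFunction B (𝔖.onSmoothing B T) f g
      = match 𝔖 with
        | .left S => testFunction B T f (S.transpose B g)
        | .right S => testFunction B T (S.onSchwartz B f) g := by
  rcases 𝔖 with (j | j) | (j | j) <;> ext X
  · change ((-Complex.I) • fibreMul (EuclideanSpace.single j 1, 0)) (testFunction B T f g) X
      + testFunction B _ f g X = testFunction B T f (coordMul j g) X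
    have hT : ∀ u, (Generator.left (.position j)).onSmoothing B T u = coordMul j (T u) :=
      fun _ => rfl
    rw [neg_I_smul_fibreMul_left, hB.testFunction_apply, hB.testFunction_apply,
      hB.testFunction_apply, amplitude_apply, amplitude_apply, amplitude_apply, hT,
      coordMul_apply, coordMul_apply]
    simp only [PiLp.add_apply, PiLp.sub_apply, PiLp.smul_apply, smul_eq_mul]
    push_cast
    ring
  · have h := hB.fderiv_testFunction_left T f g X j
    have h1 : testFunction B T f ((Observable.momentum j).transpose B g) X
        = Complex.I * testFunction B T f (partialDeriv j g) X
          - potential B (X.1.1 + (2⁻¹ : ℝ) • X.1.2) j * testFunction B T f g X := by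
      have hg : ∀ x, (Observable.momentum j).transpose B g x
          = Complex.I * partialDeriv j g x - potential B x j * g x :=
        fun x => congrArg (fun c => Complex.I * partialDeriv j g x - c)
          (hB.potentialMul_apply j g x)
      simp only [hB.testFunction_apply, amplitude_apply, hg]
      ring
    have h2 : testFunction B ((Generator.left (.momentum j)).onSmoothing B T) f g X
        = -Complex.I * testFunction B (kernelDeriv (.inl j) T) f g X
          - potential B (X.1.1 - (2⁻¹ : ℝ) • X.1.2) j * testFunction B T f g X := by
      have hk : ∀ u x, (Generator.left (.momentum j)).onSmoothing B T u x
          = -Complex.I * kernelDeriv (.inl j) T u x - potential B x j * T u x :=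
        fun u x => congrArg (fun c => -Complex.I * partialDeriv j (T u) x - c)
          (hB.potentialMul_apply j (T u) x)
      simp only [hB.testFunction_apply, amplitude_apply, hk]
      ring
    have h3 : commutatorOp B (.left (.momentum j)) (testFunction B T f g) X
        = Complex.I * fderiv ℝ (testFunction B T f g) X (baseEmb (EuclideanSpace.single j 1, 0))
          + (∑ k, (X.1.2 k : ℂ) * leftFlux B j k X) * testFunction B T f g X := by
      rw [commutatorOp, add_apply, add_apply, sum_apply, sum_apply, Finset.sum_mul]
      refine congrArg₂ (· + ·) (congrArg (Complex.I * ·) (congrFun (coe_lineDerivOp _ _) X)) ?_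
      refine Finset.sum_congr rfl fun k _ => ?_
      rw [ContinuousLinearMap.comp_apply, SchwartzMap.smulLeftCLM_apply_apply
        (hB.isSymbol_leftFlux j k).hasTemperateGrowth_of_bounded, neg_I_smul_fibreMul_left,
        smul_eq_mul]
      ring
    change commutatorOp B (.left (.momentum j)) (testFunction B T f g) X
      + testFunction B ((Generator.left (.momentum j)).onSmoothing B T) f g X
      = testFunction B T f ((Observable.momentum j).transpose B g) X
    rw [h1, h2, h3, h]
    linear_combination ((potential B (X.1.1 + (2⁻¹ : ℝ) • X.1.2) j : ℂ)
      - potential B (X.1.1 - (2⁻¹ : ℝ) • X.1.2) j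
      + ∑ k, (X.1.2 k : ℂ) * leftFlux B j k X) * testFunction B T f g X * Complex.I_mul_I
  · change (Complex.I • fibreMul (0, EuclideanSpace.single j 1)) (testFunction B T f g) X
      + testFunction B _ f g X = testFunction B T (coordMul j f) g X
    have hT : ∀ y, (Generator.right (.position j)).onSmoothing B T (dirac y)
        = (y j : ℂ) • T (dirac y) := fun y =>
      (congrArg T (dirac_comp_coordMul j y)).trans (map_smul _ _ _)
    rw [I_smul_fibreMul_right, hB.testFunction_apply, hB.testFunction_apply,
      hB.testFunction_apply, amplitude_apply, amplitude_apply, amplitude_apply, hT,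
      coordMul_apply, smul_apply]
    simp only [PiLp.add_apply, PiLp.sub_apply, PiLp.smul_apply, smul_eq_mul]
    push_cast
    ring
  · have h := hB.fderiv_testFunction_right T f g X j
    have h1 : testFunction B T ((Observable.momentum j).onSchwartz B f) g X
        = -Complex.I * testFunction B T (partialDeriv j f) g X
          - potential B (X.2.1 + (2⁻¹ : ℝ) • X.2.2) j * testFunction B T f g X := by
      have hf : ∀ x, (Observable.momentum j).onSchwartz B f x
          = -Complex.I * partialDeriv j f x - potential B x j * f x :=
        fun x => congrArg (fun c => -Complex.I * partialDeriv j f x - c)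
          (hB.potentialMul_apply j f x)
      simp only [hB.testFunction_apply, amplitude_apply, hf]
      ring
    have h2 : testFunction B ((Generator.right (.momentum j)).onSmoothing B T) f g X
        = Complex.I * testFunction B (kernelDeriv (.inr j) T) f g X
          - potential B (X.2.1 - (2⁻¹ : ℝ) • X.2.2) j * testFunction B T f g X := by
      have hk : ∀ y x, (Generator.right (.momentum j)).onSmoothing B T (dirac y) x
          = Complex.I * kernelDeriv (.inr j) T (dirac y) x - potential B y j * T (dirac y) x := by
        intro y x
        have hu : (Generator.right (.momentum j)).onSmoothing B T (dirac y)
            = T (Complex.I • diracDeriv j y - (potential B y j : ℂ) • dirac y) :=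
          congrArg T (hB.dirac_comp_transpose_momentum j y)
        rw [hu, map_sub, map_smul, map_smul]
        rfl
      simp only [hB.testFunction_apply, amplitude_apply, hk]
      ring
    have h3 : commutatorOp B (.right (.momentum j)) (testFunction B T f g) X
        = -Complex.I * fderiv ℝ (testFunction B T f g) X (baseEmb (0, EuclideanSpace.single j 1))
          + (∑ k, (X.2.2 k : ℂ) * rightFlux B j k X) * testFunction B T f g X := by
      rw [commutatorOp, add_apply, add_apply, sum_apply, sum_apply, Finset.sum_mul]
      refine congrArg₂ (· + ·) (congrArg (-Complex.I * ·) (congrFun (coe_lineDerivOp _ _) X)) ?_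
      refine Finset.sum_congr rfl fun k _ => ?_
      rw [ContinuousLinearMap.comp_apply, SchwartzMap.smulLeftCLM_apply_apply
        (hB.isSymbol_rightFlux j k).hasTemperateGrowth_of_bounded, I_smul_fibreMul_right,
        smul_eq_mul]
      ring
    change commutatorOp B (.right (.momentum j)) (testFunction B T f g) X
      + testFunction B ((Generator.right (.momentum j)).onSmoothing B T) f g X
      = testFunction B T ((Observable.momentum j).onSchwartz B f) g X
    rw [h1, h2, h3, h]
    linear_combination ((potential B (X.2.1 + (2⁻¹ : ℝ) • X.2.2) j : ℂ)
      - potential B (X.2.1 - (2⁻¹ : ℝ) • X.2.2) j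
      + ∑ k, (X.2.2 k : ℂ) * rightFlux B j k X) * testFunction B T f g X * Complex.I_mul_I

lemma IsRegularMagneticField.exists_symbol_commutator (hB : IsRegularMagneticField B)
    {M : SuperPhase d → ℝ} (hM : IsTemperedWeight M) {Φ : SuperPhase d → ℂ} (hΦ : IsSymbol M Φ)
    {𝔗 : SuperOp d} (h𝔗 : IsSuperQuantization B Φ 𝔗) (𝔖 : Generator d) :
    ∃ Ψ, IsSymbol M Ψ ∧ IsSuperQuantization B Ψ (commutator B 𝔖 𝔗) := by
  obtain ⟨Ψ, hΨ, h⟩ := hB.actsOnSymbols_commutatorOp hM 𝔖 Φ hΦ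
  refine ⟨Ψ, hΨ, hB.isSuperQuantization_iff.2 fun T f g => ?_⟩
  rw [hB.isSuperQuantization_iff] at h𝔗
  have hadd := PolyBounded.superPairing_add_right (hΦ.polyBounded hM)
    (commutatorOp B 𝔖 (testFunction B T f g)) (testFunction B (𝔖.onSmoothing B T) f g)
  have key : (𝔖.onRough B (𝔗 T)) f g = weylConst d * superPairing Φ
      (commutatorOp B 𝔖 (testFunction B T f g) + testFunction B (𝔖.onSmoothing B T) f g :
        SuperSchw d) := by
    rw [hB.commutatorOp_testFunction]
    rcases 𝔖 with S | S
    · exact h𝔗 T f _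
    · exact h𝔗 T _ g
  change (𝔖.onRough B (𝔗 T)) f g - 𝔗 (𝔖.onSmoothing B T) f g = _
  rw [key, h𝔗, ← h]
  change weylConst d * superPairing Φ (⇑(commutatorOp B 𝔖 (testFunction B T f g))
    + ⇑(testFunction B (𝔖.onSmoothing B T) f g)) - _ = _
  rw [hadd]
  ring

lemma IsRegularMagneticField.exists_symbol_iteratedCommutator (hB : IsRegularMagneticField B)
    {M : SuperPhase d → ℝ} (hM : IsTemperedWeight M) (l : List (Generator d))
    {Φ : SuperPhase d → ℂ} (hΦ : IsSymbol M Φ)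
    {𝔗 : SuperOp d} (h𝔗 : IsSuperQuantization B Φ 𝔗) :
    ∃ Ψ, IsSymbol M Ψ ∧ IsSuperQuantization B Ψ (iteratedCommutator B l 𝔗) := by
  induction l generalizing Φ 𝔗 with
  | nil => exact ⟨Φ, hΦ, h𝔗⟩
  | cons 𝔖 l ih =>
    obtain ⟨Ψ, hΨ, h⟩ := hB.exists_symbol_commutator hM hΦ h𝔗 𝔖
    exact ih hΨ h

end

end MagneticSuper

open MagneticSuper
theorem proposition6p2 {d : ℕ} (B : Pos d → Fin d → Fin d → ℝ) (hB : IsRegularMagneticField B)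
    (M : SuperPhase d → ℝ) (hM : IsTemperedWeight M)
    (Φ : SuperPhase d → ℂ) (hΦ : Φ ∈ superClass M) :
    ∃ 𝔗 : SuperOp d, IsSuperQuantization B Φ 𝔗 ∧
      ∀ l : List (Generator d),
        ∃ Ψ ∈ superClass M, IsSuperQuantization B Ψ (iteratedCommutator B l 𝔗) := by
  have hΦ' : IsSymbol M Φ := ⟨hΦ.1, hΦ.2⟩
  obtain ⟨𝔗, h𝔗⟩ := hB.exists_isSuperQuantization (hΦ'.polyBounded hM)
  refine ⟨𝔗, h𝔗, fun l => ?_⟩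
  obtain ⟨Ψ, hΨ, h⟩ := hB.exists_symbol_iteratedCommutator hM l hΦ' h𝔗
  exact ⟨Ψ, ⟨hΨ.contDiff, hΨ.bound⟩, h⟩
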